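/- Let $n > k \ge 1$ be integers, let $a_1,\dots,a_n$ be agents, let $p_i$ be the submission authored by $a_i$, and let $S \in [0,1]^{n\times n}$ be a matrix of similarities. An assignment (with loads of $k$) is a set $\mathcal M$ of pairs $(a_i,p_j)$ such that every agent and every submission occurs in exactly $k$ pairs and $(a_i,p_i)\notin\mathcal M$ for all $i$; its total similarity is $\sum_{(a_i,p_j)\in\mathcal M} S_{i,j}$, and $\mathrm{Opt}_S$ denotes the maximum total similarity of an assignment. An assignment $\mathcal M$ respects a partition of the agents if $(a_i,p_j)\in\mathcal M$ implies that $a_i$ and $a_j$ lie in different subsets; it is strategyproof-via-partitioning (here with $2k+1$ subsets) if it respects some partition of the agents into $2k+1$ subsets, empty subsets being allowed. The graph $G_{\mathcal M}$ is the directed graph on $v_1,\dots,v_n$ with an edge $(v_i,v_j)$ for each $(a_i,p_j)\in\mathcal M$. An equitable $\alpha$-coloring of it is a map $f:\{v_1,\dots,v_n\}\to\{1,\dots,\alpha\}$ that gives different colors to the two ends of every edge and whose color classes (possibly empty) differ in size by at most one. The Multi-Partition Algorithm, on input $(n,k,S)$, takes an assignment $\mathcal M^*$ of total similarity $\mathrm{Opt}_S$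 and an equitable $(2k+1)$-coloring of $G_{\mathcal M^*}$, and returns $\mathcal M^*$ together with the partition of the agents into the $2k+1$ color classes. **Theorem (Multi-Partition Algorithm).** For all $n > k\ge 1$ and all $S\in[0,1]^{n\times n}$: 1. For every assignment $\mathcal M^*$ of total similarity $\mathrm{Opt}_S$, every vertex of $G_{\mathcal M^*}$ has total degree (in-degree plus out-degree) at most $2k$, and $G_{\mathcal M^*}$ has an equitable $(2k+1)$-coloring. 2. Whatever optimal assignment and equitable coloring the algorithm takes, it returns a partition of the agents into $2k+1$ subsets, each containing either $\lfloor \frac{n}{2k+1}\rfloor$ or $\lceil \frac{n}{2k+1}\rceil$ agents (so that the sizes differ by at most one), and an assignment with loads of $k$ that respects this partition, hence is strategyproof-via-partitioning, and has total similarity $\mathrm{Opt}_S$. 3. The algorithm can be implemented in polynomial time: there are a single program, for a random access machine that adds, subtracts and compares natural numbers and real numbers at unit cost, and a single polynomial $q$ such that on every such input $(n,k,S)$ the program halts after at most $q(n)$ steps with a possible result of the algorithm. -/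

import Mathlib

namespace PeerAssessment

/-! ### Assignments, total similarity, partitions

Agent `a_i` and its submission `p_i` are both indexed by `i : Fin n`; the pair `(i, j)` in an
assignment means that agent `a_i` evaluates submission `p_j`. -/

/-- Assignments with loads of `k`. -/
structure IsAssignment {n : ℕ} (k : ℕ) (M : Finset (Fin n × Fin n)) : Prop where
  submission_load : ∀ j, (Finset.univ.filter fun i => (i, j) ∈ M).card = k
  agent_load : ∀ i, (Finset.univ.filter fun j => (i, j) ∈ M).card = k
  no_self : ∀ i, (i, i) ∉ M

/-- The total similarity of the assigned pairs. -/
def totalSimilarity {n : ℕ} (S : Matrix (Fin n) (Fin n) ℝ) (M : Finset (Fin n × Fin n)) : ℝ :=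
  ∑ e ∈ M, S e.1 e.2

/-- `M` is a maximum-similarity assignment with loads of `k`. -/
def IsMaxSimilarityAssignment {n : ℕ} (S : Matrix (Fin n) (Fin n) ℝ) (k : ℕ)
    (M : Finset (Fin n × Fin n)) : Prop :=
  IsAssignment k M ∧ ∀ M', IsAssignment k M' → totalSimilarity S M' ≤ totalSimilarity S M

/-- The maximum total similarity of an assignment with loads of `k`. The set is finite, and it is
nonempty when `k < n`, so that the supremum is then a maximum. -/
noncomputable def opt {n : ℕ} (S : Matrix (Fin n) (Fin n) ℝ) (k : ℕ) : ℝ :=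
  sSup {x | ∃ M, IsAssignment k M ∧ totalSimilarity S M = x}

/-- The sets `parts t` form a partition of the agents into `m` (possibly empty) subsets. -/
def IsAgentPartition {n m : ℕ} (parts : Fin m → Finset (Fin n)) : Prop :=
  (∀ t u, t ≠ u → Disjoint (parts t) (parts u)) ∧ ∀ i, ∃ t, i ∈ parts t

/-- No agent is assigned to a submission authored in the agent's own subset. -/
def Respects {n m : ℕ} (M : Finset (Fin n × Fin n)) (parts : Fin m → Finset (Fin n)) : Prop :=
  ∀ t, ∀ i ∈ parts t, ∀ j ∈ parts t, (i, j) ∉ M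

/-- An assignment that is strategyproof via a partition into `m` subsets. -/
def IsStrategyproofViaPartitioning {n : ℕ} (m : ℕ) (M : Finset (Fin n × Fin n)) : Prop :=
  ∃ parts : Fin m → Finset (Fin n), IsAgentPartition parts ∧ Respects M parts

/-! ### The graph of an assignment and equitable colorings -/

/-- The directed graph with an edge from `i` to `j` whenever `(i, j) ∈ M`. -/
def assignmentGraph {n : ℕ} (M : Finset (Fin n × Fin n)) : Digraph (Fin n) where
  Adj i j := (i, j) ∈ M

/-- Out-degree plus in-degree. -/
noncomputable def totalDegree {V : Type*} (G : Digraph V) (v : V) : ℕ :=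
  {w | G.Adj v w}.ncard + {w | G.Adj w v}.ncard

/-- Equitable `α`-colorings of a (finite) directed graph. -/
def IsEquitableColoring {V : Type*} (G : Digraph V) {α : ℕ} (f : V → Fin α) : Prop :=
  (∀ v w, G.Adj v w → f v ≠ f w) ∧
    ∀ x y, ({v | f v = x}.ncard : ℤ) - ({v | f v = y}.ncard : ℤ) ≤ 1

/-- The color classes of `f`. -/
def colorClasses {n m : ℕ} (f : Fin n → Fin m) (c : Fin m) : Finset (Fin n) :=
  Finset.univ.filter fun i => f i = c

/-- The possible results `(M, parts)` of the multi-partition algorithm: take a maximum-similarity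
assignment `M` with loads of `k`, take an equitable `(2k+1)`-coloring of the graph of `M`, and
return `M` together with the partition into color classes. -/
def IsMultiPartitionOutput {n : ℕ} (S : Matrix (Fin n) (Fin n) ℝ) (k : ℕ)
    (M : Finset (Fin n × Fin n)) (parts : Fin (2 * k + 1) → Finset (Fin n)) : Prop :=
  IsMaxSimilarityAssignment S k M ∧
    ∃ f : Fin n → Fin (2 * k + 1),
      IsEquitableColoring (assignmentGraph M) f ∧ parts = colorClasses f

/-! ### A machine model with a step count

Structured programs for a random access machine with real registers. The memory consists of named
two-dimensional arrays of natural numbers and of real numbers; a scalar variable is an entry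
`(0, 0)`, a vector uses the entries `(i, 0)`. A program is a finite piece of text, so it names
finitely many arrays; the indices are computed at run time. The only arithmetic is addition and
subtraction, truncated on the natural numbers, and the only test is comparison. There is no
multiplication, no rounding of real numbers, no conversion between the two sorts, and no real
constant except `0`: after `t` steps the numbers in memory are still only exponentially large
in `t`. Each operation, each memory access and each test costs one step. -/

/-- Memory contents: `nat a i j` and `real a i j` are the entries `(i, j)` of the arrays named
`a`. -/
structure Store where
  nat : ℕ → ℕ → ℕ → ℕ
  real : ℕ → ℕ → ℕ → ℝ

/-- Expressions for natural numbers. -/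
inductive NatExp : Type
  | const (c : ℕ)
  | get (a : ℕ) (i j : NatExp)
  | add (x y : NatExp)
  | sub (x y : NatExp)

/-- Expressions for real numbers. -/
inductive RealExp : Type
  | zero
  | get (a : ℕ) (i j : NatExp)
  | add (x y : RealExp)
  | sub (x y : RealExp)

/-- Tests. -/
inductive Test : Type
  | natLe (x y : NatExp)
  | realLe (x y : RealExp)
  | not (b : Test)
  | and (b c : Test)

/-- Programs. -/
inductive Program : Type
  | skip
  | setNat (a : ℕ) (i j : NatExp) (e : NatExp)
  | setReal (a : ℕ) (i j : NatExp) (e : RealExp)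
  | seq (c d : Program)
  | ite (b : Test) (c d : Program)
  | while (b : Test) (c : Program)

def NatExp.val (s : Store) : NatExp → ℕ
  | .const c => c
  | .get a i j => s.nat a (i.val s) (j.val s)
  | .add x y => x.val s + y.val s
  | .sub x y => x.val s - y.val s

/-- The number of steps taken by an evaluation. -/
def NatExp.cost : NatExp → ℕ
  | .const _ => 1
  | .get _ i j => i.cost + j.cost + 1
  | .add x y => x.cost + y.cost + 1
  | .sub x y => x.cost + y.cost + 1

noncomputable def RealExp.val (s : Store) : RealExp → ℝ
  | .zero => 0
  | .get a i j => s.real a (i.val s) (j.val s)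
  | .add x y => x.val s + y.val s
  | .sub x y => x.val s - y.val s

/-- The number of steps taken by an evaluation. -/
def RealExp.cost : RealExp → ℕ
  | .zero => 1
  | .get _ i j => i.cost + j.cost + 1
  | .add x y => x.cost + y.cost + 1
  | .sub x y => x.cost + y.cost + 1

def Test.Holds (s : Store) : Test → Prop
  | .natLe x y => x.val s ≤ y.val s
  | .realLe x y => x.val s ≤ y.val s
  | .not b => ¬ b.Holds s
  | .and b c => b.Holds s ∧ c.Holds s

/-- The number of steps taken by an evaluation. -/
def Test.cost : Test → ℕ
  | .natLe x y => x.cost + y.cost + 1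
  | .realLe x y => x.cost + y.cost + 1
  | .not b => b.cost + 1
  | .and b c => b.cost + c.cost + 1

/-- Overwrite one entry of an array of natural numbers. -/
def Store.setNat (s : Store) (a i j v : ℕ) : Store where
  nat := fun a' i' j' => if a' = a ∧ i' = i ∧ j' = j then v else s.nat a' i' j'
  real := s.real

/-- Overwrite one entry of an array of real numbers. -/
noncomputable def Store.setReal (s : Store) (a i j : ℕ) (v : ℝ) : Store where
  nat := s.nat
  real := fun a' i' j' => if a' = a ∧ i' = i ∧ j' = j then v else s.real a' i' j'

/-- `Runs c s t s'`: the program `c`, started with memory `s`, halts after exactly `t` steps with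
memory `s'`. -/
inductive Runs : Program → Store → ℕ → Store → Prop
  | skip (s : Store) : Runs .skip s 1 s
  | setNat (s : Store) (a : ℕ) (i j e : NatExp) :
      Runs (.setNat a i j e) s (i.cost + j.cost + e.cost + 1)
        (s.setNat a (i.val s) (j.val s) (e.val s))
  | setReal (s : Store) (a : ℕ) (i j : NatExp) (e : RealExp) :
      Runs (.setReal a i j e) s (i.cost + j.cost + e.cost + 1)
        (s.setReal a (i.val s) (j.val s) (e.val s))
  | seq {c d : Program} {s s' s'' : Store} {t t' : ℕ} :
      Runs c s t s' → Runs d s' t' s'' → Runs (.seq c d) s (t + t') s''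
  | ite_true {b : Test} {c d : Program} {s s' : Store} {t : ℕ} :
      b.Holds s → Runs c s t s' → Runs (.ite b c d) s (b.cost + t + 1) s'
  | ite_false {b : Test} {c d : Program} {s s' : Store} {t : ℕ} :
      ¬ b.Holds s → Runs d s t s' → Runs (.ite b c d) s (b.cost + t + 1) s'
  | while_true {b : Test} {c : Program} {s s' s'' : Store} {t t' : ℕ} :
      b.Holds s → Runs c s t s' → Runs (.while b c) s' t' s'' →
        Runs (.while b c) s (b.cost + t + t' + 1) s''
  | while_false {b : Test} {c : Program} {s : Store} :
      ¬ b.Holds s → Runs (.while b c) s (b.cost + 1) s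

/-- The initial memory on the input `(n, k, S)`: the numbers `n` and `k` are in the arrays `0` and
`1` of natural numbers, the matrix `S` is in the array `0` of real numbers, and all else is `0`. -/
def inputStore {n : ℕ} (k : ℕ) (S : Matrix (Fin n) (Fin n) ℝ) : Store where
  nat := fun a i j =>
    if a = 0 ∧ i = 0 ∧ j = 0 then n else if a = 1 ∧ i = 0 ∧ j = 0 then k else 0
  real := fun a i j =>
    if h : a = 0 ∧ i < n ∧ j < n then S ⟨i, h.2.1⟩ ⟨j, h.2.2⟩ else 0

/-- The final memory contains the result `(M, parts)`: the array `2` of natural numbers is the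
0-1 matrix of `M`, and the entry `(i, 0)` of the array `3` is the number of the subset to which
agent `i` belongs. -/
def Store.HasOutput {n m : ℕ} (s : Store) (M : Finset (Fin n × Fin n))
    (parts : Fin m → Finset (Fin n)) : Prop :=
  (∀ i j : Fin n, s.nat 2 i j = if (i, j) ∈ M then 1 else 0) ∧
    (∀ i : Fin n, s.nat 3 i 0 < m) ∧
    ∀ (t : Fin m) (i : Fin n), i ∈ parts t ↔ s.nat 3 i 0 = t

end PeerAssessment

open PeerAssessment

/-! In an assignment every vertex has out-degree `k` and in-degree `k`, hence total degree `2k`, and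
the Hajnal–Szemerédi theorem supplies an equitable coloring with `2k+1` colors. Its color classes
separate the two ends of every edge, which is exactly what respecting the partition means, and the
assignment itself is not altered, so no similarity is lost. The substance of the theorem is the
polynomial running time: both the optimal assignment and the coloring have to come from explicit
programs. The coloring program is also what proves that the coloring exists.

Running time. If every loop makes at most `N` iterations whenever it is executed, a fixed program
halts within a fixed polynomial in `N` (`Program.exists_polynomial_time`). It is therefore enough to
give each loop a variant that is bounded polynomially in `n`; `wp_while` combines correctness and
time. Searches are written as formulas with bounded quantifiers and decided by brute force
(`Fml.wp_eval`), so no efficient data structures have to be verified.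

Assignment. The primal-dual method for the transportation problem is used. A 0-1 matrix with zero
diagonal is kept together with row and column potentials that satisfy complementary slackness
(`LoadMatrix`). From the rows with sum less than `k` alternating paths of tight entries are grown.
If a marked column has room, walking back along decreasing stamps adds a one to the matrix
(`wp_walkStep`). Otherwise a Hall-type count, which uses `k < n` to make up for the forbidden
diagonal, gives an entry that leaves the marked part (`LoadMatrix.exists_cross`), and a change of
the potentials by the least slack makes such an entry tight (`wp_growStep`). Once all row sums are
`k`, weak duality proves optimality (`LoadMatrix.isMaxSimilarityAssignment`).

Coloring. Fewer than `2k+1` dummy vertices, forming a clique, make the number of vertices a multiple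
of `2k+1`. The vertices are inserted one at a time into a coloring with classes of equal size, along
the lines of the proof of Kierstead and Kostochka. The vertex `u` to be inserted nominally holds a
place, the hole, in a class. A class is accessible if moving one vertex from each class to the next
leads from it to the hole. If `u` fits into an accessible class, a shift of vertices inserts it.
Otherwise every vertex outside of the accessible classes has a neighbor in each of them. If some `z`
in an accessible class is the only neighbor there of such a vertex `y` and can itself move on, then
`y` replaces `z`, and the problem is left with fewer colors. If not, two double counts
(`Pending.exists_pair`) give a `z` that is the only neighbor in its class of two nonadjacent
vertices `y` and `y'`; after `y` has replaced `z` and `u` has been placed among the other classes,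
`z` is the vertex to be inserted and the class of `y'` has become accessible in addition.
Lexicographic descent in the number of colors and the number of inaccessible classes ends the
insertion. Finally the dummies have different colors, so deleting them leaves classes whose sizes
differ by at most one. -/

namespace PeerAssessment

/-! ### Weakest preconditions with a time bound -/

/-- An upper bound for the running time when every loop makes at most `N` iterations. -/
def Program.time (N : ℕ) : Program → ℕ
  | .skip => 1
  | .setNat _ i j e => i.cost + j.cost + e.cost + 1
  | .setReal _ i j e => i.cost + j.cost + e.cost + 1
  | .seq c d => c.time N + d.time N
  | .ite b c d => b.cost + (c.time N + d.time N) + 1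
  | .while b c => N * (b.cost + c.time N + 1) + (b.cost + 1)

/-- The program is fixed while `N` varies, so each loop contributes one factor `N` and the degree is
at most the nesting depth of the loops. -/
theorem Program.exists_polynomial_time :
    ∀ c : Program, ∃ p : Polynomial ℕ, ∀ N, c.time N = p.eval N
  | .skip => ⟨.C 1, fun N => by simp [Program.time]⟩
  | .setNat a i j e => ⟨.C (i.cost + j.cost + e.cost + 1), fun N => by
      simp only [Program.time, Polynomial.eval_C]⟩
  | .setReal a i j e => ⟨.C (i.cost + j.cost + e.cost + 1), fun N => by
      simp only [Program.time, Polynomial.eval_C]⟩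
  | .seq c d => by
    obtain ⟨p, hp⟩ := c.exists_polynomial_time
    obtain ⟨q, hq⟩ := d.exists_polynomial_time
    exact ⟨p + q, fun N => by simp [Program.time, hp, hq]⟩
  | .ite b c d => by
    obtain ⟨p, hp⟩ := c.exists_polynomial_time
    obtain ⟨q, hq⟩ := d.exists_polynomial_time
    exact ⟨.C b.cost + (p + q) + .C 1, fun N => by
      simp only [Program.time, hp, hq, Polynomial.eval_add, Polynomial.eval_C]⟩
  | .while b c => by
    obtain ⟨p, hp⟩ := c.exists_polynomial_time
    exact ⟨.X * (.C b.cost + p + .C 1) + .C (b.cost + 1), fun N => by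
      simp only [Program.time, hp, Polynomial.eval_add, Polynomial.eval_mul, Polynomial.eval_C,
        Polynomial.eval_X]⟩

/-- The program halts within the time bound, in a memory with the property `Q`. -/
def wp (N : ℕ) (c : Program) (Q : Store → Prop) (s : Store) : Prop :=
  ∃ t s', Runs c s t s' ∧ t ≤ c.time N ∧ Q s'

/-- Does the program contain an assignment to the array `a` of natural numbers? -/
def Program.writesNat (a : ℕ) : Program → Bool
  | .skip => false
  | .setNat a' _ _ _ => a == a'
  | .setReal _ _ _ _ => false
  | .seq c d => c.writesNat a || d.writesNat a
  | .ite _ c d => c.writesNat a || d.writesNat a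
  | .while _ c => c.writesNat a

/-- Does the program contain an assignment to the array `a` of real numbers? -/
def Program.writesReal (a : ℕ) : Program → Bool
  | .skip => false
  | .setNat _ _ _ _ => false
  | .setReal a' _ _ _ => a == a'
  | .seq c d => c.writesReal a || d.writesReal a
  | .ite _ c d => c.writesReal a || d.writesReal a
  | .while _ c => c.writesReal a

/-- The two memories agree on all arrays to which the program does not assign. -/
structure Frame (c : Program) (s s' : Store) : Prop where
  nat : ∀ a, c.writesNat a = false → s'.nat a = s.nat a
  real : ∀ a, c.writesReal a = false → s'.real a = s.real a

theorem Frame.refl (c : Program) (s : Store) : Frame c s s := ⟨fun _ _ => rfl, fun _ _ => rfl⟩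

theorem Frame.trans {c : Program} {s s' s'' : Store} (h : Frame c s s') (h' : Frame c s' s'') :
    Frame c s s'' :=
  ⟨fun a ha => (h'.nat a ha).trans (h.nat a ha), fun a ha => (h'.real a ha).trans (h.real a ha)⟩

/-- Whether an array is written is computed from the program text; later, the invariance of an array
under a long program is therefore a side condition that `rfl` settles. -/
theorem Frame.of_runs {c : Program} {s s' : Store} {t : ℕ} (h : Runs c s t s') :
    Frame c s s' := by
  induction h with
  | skip s => exact .refl _ _
  | setNat s a i j e =>
    refine ⟨fun b hb => ?_, fun b hb => rfl⟩
    have : b ≠ a := by simpa [Program.writesNat] using hb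
    funext x y
    simp [Store.setNat, this]
  | setReal s a i j e =>
    refine ⟨fun b hb => rfl, fun b hb => ?_⟩
    have : b ≠ a := by simpa [Program.writesReal] using hb
    funext x y
    simp [Store.setReal, this]
  | seq _ _ h₁ h₂ =>
    constructor <;> intro b hb
    · simp only [Program.writesNat, Bool.or_eq_false_iff] at hb
      rw [h₂.nat b hb.2, h₁.nat b hb.1]
    · simp only [Program.writesReal, Bool.or_eq_false_iff] at hb
      rw [h₂.real b hb.2, h₁.real b hb.1]
  | ite_true _ _ h =>
    constructor <;> intro b hb
    · simp only [Program.writesNat, Bool.or_eq_false_iff] at hb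
      exact h.nat b hb.1
    · simp only [Program.writesReal, Bool.or_eq_false_iff] at hb
      exact h.real b hb.1
  | ite_false _ _ h =>
    constructor <;> intro b hb
    · simp only [Program.writesNat, Bool.or_eq_false_iff] at hb
      exact h.nat b hb.2
    · simp only [Program.writesReal, Bool.or_eq_false_iff] at hb
      exact h.real b hb.2
  | while_true _ _ _ h₁ h₂ =>
    constructor <;> intro b hb
    · rw [h₂.nat b hb, h₁.nat b hb]
    · rw [h₂.real b hb, h₁.real b hb]
  | while_false _ => exact .refl _ _

section Rules

variable {N : ℕ} {Q Q' : Store → Prop} {s : Store}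

/-- The continuation receives the frame of the program, so a specification only has to mention the
arrays that change. -/
theorem wp.mono {c : Program} (h : wp N c Q s) (hQ : ∀ s', Frame c s s' → Q s' → Q' s') :
    wp N c Q' s := by
  obtain ⟨t, s', hr, ht, hq⟩ := h
  exact ⟨t, s', hr, ht, hQ s' (.of_runs hr) hq⟩

theorem wp_skip (h : Q s) : wp N .skip Q s := ⟨1, s, .skip s, le_rfl, h⟩

theorem wp_setNat {a : ℕ} {i j e : NatExp} (h : Q (s.setNat a (i.val s) (j.val s) (e.val s))) :
    wp N (.setNat a i j e) Q s := ⟨_, _, .setNat s a i j e, le_rfl, h⟩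

theorem wp_setReal {a : ℕ} {i j : NatExp} {e : RealExp}
    (h : Q (s.setReal a (i.val s) (j.val s) (e.val s))) :
    wp N (.setReal a i j e) Q s := ⟨_, _, .setReal s a i j e, le_rfl, h⟩

theorem wp_seq {c d : Program} (h : wp N c (wp N d Q) s) : wp N (.seq c d) Q s := by
  obtain ⟨t, s', hr, ht, t', s'', hr', ht', hq⟩ := h
  exact ⟨_, _, .seq hr hr', Nat.add_le_add ht ht', hq⟩

theorem wp_ite {b : Test} {c d : Program} (h₁ : b.Holds s → wp N c Q s)
    (h₂ : ¬ b.Holds s → wp N d Q s) : wp N (.ite b c d) Q s := by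
  by_cases hb : b.Holds s
  · obtain ⟨t, s', hr, ht, hq⟩ := h₁ hb
    exact ⟨_, _, .ite_true hb hr, by simp only [Program.time]; omega, hq⟩
  · obtain ⟨t, s', hr, ht, hq⟩ := h₂ hb
    exact ⟨_, _, .ite_false hb hr, by simp only [Program.time]; omega, hq⟩

/-- Total correctness of loops, with an invariant `I` and a variant `μ`. -/
theorem wp_while {b : Test} {c : Program} (I : Store → Prop) (μ : Store → ℕ)
    (h₀ : I s) (hμ : μ s ≤ N)
    (hstep : ∀ s', Frame c s s' → I s' → b.Holds s' → wp N c (fun s'' => I s'' ∧ μ s'' < μ s') s')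
    (hend : ∀ s', Frame c s s' → I s' → ¬ b.Holds s' → Q s') : wp N (.while b c) Q s := by
  -- The induction is on a bound `m` for the variant and not on the variant, because the same `m`
  -- counts the iterations in the time bound.
  have key : ∀ m s', μ s' ≤ m → I s' → Frame c s s' → ∃ t s'', Runs (.while b c) s' t s'' ∧
      t ≤ m * (b.cost + c.time N + 1) + (b.cost + 1) ∧ Q s'' := by
    intro m
    induction m with
    | zero =>
      intro s' hm hI hF
      by_cases hb : b.Holds s'
      · obtain ⟨_, _, _, _, _, h⟩ := hstep s' hF hI hb
        omega
      · exact ⟨_, _, .while_false hb, by omega, hend s' hF hI hb⟩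
    | succ m ih =>
      intro s' hm hI hF
      by_cases hb : b.Holds s'
      · obtain ⟨t, s₁, hr, ht, hI₁, hμ₁⟩ := hstep s' hF hI hb
        obtain ⟨t', s₂, hr', ht', hq⟩ := ih s₁ (by omega) hI₁ (hF.trans (.of_runs hr))
        exact ⟨_, _, .while_true hb hr hr', by rw [Nat.add_mul]; omega, hq⟩
      · exact ⟨_, _, .while_false hb, by omega, hend s' hF hI hb⟩
  obtain ⟨t, s', hr, ht, hq⟩ := key N s hμ h₀ (.refl _ _)
  exact ⟨t, s', hr, ht, hq⟩

end Rules

/-- The scalar variable in the array `a`. -/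
abbrev scalar (a : ℕ) : NatExp := .get a (.const 0) (.const 0)

/-- Assignment to a scalar variable. -/
abbrev assign (a : ℕ) (e : NatExp) : Program := .setNat a (.const 0) (.const 0) e

/-- `forLoop v a c` runs `c` for all values of the scalar variable `v` that are less than the value
of the scalar variable `a`. -/
def forLoop (v a : ℕ) (c : Program) : Program :=
  .seq (assign v (.const 0))
    (.while (.natLe (.add (scalar v) (.const 1)) (scalar a))
      (.seq c (assign v (.add (scalar v) (.const 1)))))

/-- The body writes neither the loop variable nor the bound, so `s.nat a 0 0` minus the loop
variable is a variant. The invariant for `i + 1` is required after the increment of the loop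
variable. -/
theorem wp_forLoop {N v a : ℕ} {c : Program} {Q : Store → Prop} {s : Store}
    (I : ℕ → Store → Prop) (hv : c.writesNat v = false) (ha : c.writesNat a = false) (hva : a ≠ v)
    (hN : s.nat a 0 0 ≤ N) (h₀ : I 0 (s.setNat v 0 0 0))
    (hstep : ∀ i s', i < s.nat a 0 0 → Frame (forLoop v a c) s s' → s'.nat v 0 0 = i → I i s' →
      wp N c (fun s'' => I (i + 1) (s''.setNat v 0 0 (i + 1))) s')
    (hend : ∀ s', Frame (forLoop v a c) s s' → I (s.nat a 0 0) s' → Q s') :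
    wp N (forLoop v a c) Q s := by
  have hwa : (forLoop v a c).writesNat a = false := by
    simp [forLoop, Program.writesNat, ha, hva]
  refine wp_seq (wp_setNat ?_)
  simp only [NatExp.val]
  have hsa : (s.setNat v 0 0 0).nat a = s.nat a := by
    funext x y; simp [Store.setNat, hva]
  have hFr : ∀ s', Frame (.seq c (assign v (.add (scalar v) (.const 1)))) (s.setNat v 0 0 0) s' →
      Frame (forLoop v a c) s s' := by
    intro s' hF
    constructor
    · intro b hb
      simp only [forLoop, Program.writesNat, Bool.or_eq_false_iff, beq_eq_false_iff_ne] at hb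
      rw [hF.nat b (by simp [Program.writesNat, hb])]
      funext x y
      simp [Store.setNat, hb.1]
    · intro b hb
      simp only [forLoop, Program.writesReal, Bool.or_eq_false_iff] at hb
      rw [hF.real b (by simp [Program.writesReal, hb])]
      rfl
  refine wp_while (fun s' => s'.nat v 0 0 ≤ s.nat a 0 0 ∧ I (s'.nat v 0 0) s')
    (fun s' => s.nat a 0 0 - s'.nat v 0 0) ?_ (by omega) ?_ ?_
  · simpa [Store.setNat] using h₀
  · intro s' hF hI hb
    simp only [Test.Holds, NatExp.val] at hb
    have hsa' : s'.nat a = s.nat a := (hFr s' hF).nat a hwa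
    rw [hsa'] at hb
    refine wp_seq ((hstep _ s' (by omega) (hFr s' hF) rfl hI.2).mono fun s'' hF' h => wp_setNat ?_)
    have hv'' : s''.nat v = s'.nat v := hF'.nat v hv
    simp only [NatExp.val, hv'']
    have : (s''.setNat v 0 0 (s'.nat v 0 0 + 1)).nat v 0 0 = s'.nat v 0 0 + 1 := by
      simp [Store.setNat]
    rw [this]
    exact ⟨⟨by omega, h⟩, by omega⟩
  · intro s' hF hI hb
    simp only [Test.Holds, NatExp.val] at hb
    have hsa' : s'.nat a = s.nat a := (hFr s' hF).nat a hwa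
    rw [hsa'] at hb
    have : s'.nat v 0 0 = s.nat a 0 0 := by omega
    exact hend s' (hFr s' hF) (this ▸ hI.2)

/-! ### Deciding formulas with bounded quantifiers

The value of the variable bound at depth `d` is the entry `(d, 0)` of the array `100`; the truth
value of the subformula at depth `d` is put into the entry `(d, 0)` of the array `101`. -/

/-- Formulas; the quantifier `ex a` is bounded by the scalar variable `a`. -/
inductive Fml : Type
  | atom (b : Test)
  | and (φ ψ : Fml)
  | not (φ : Fml)
  | ex (a : ℕ) (φ : Fml)

/-- The variable bound at depth `d`. -/
abbrev bvar (d : ℕ) : NatExp := .get 100 (.const d) (.const 0)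

/-- The truth value computed at depth `d`. -/
abbrev res (d : ℕ) : NatExp := .get 101 (.const d) (.const 0)

/-- A program that decides a formula. -/
def Fml.eval : Fml → ℕ → Program
  | .atom b, d => .ite b (.setNat 101 (.const d) (.const 0) (.const 1))
      (.setNat 101 (.const d) (.const 0) (.const 0))
  | .and φ ψ, d => .seq (φ.eval d) (.ite (.natLe (.const 1) (res d)) (ψ.eval d) .skip)
  | .not φ, d => .seq (φ.eval d)
      (.setNat 101 (.const d) (.const 0) (.sub (.const 1) (res d)))
  | .ex a φ, d => .seq (.setNat 100 (.const d) (.const 0) (.const 0))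
      (.seq (.setNat 101 (.const d) (.const 0) (.const 0))
        (.while (.and (.natLe (.add (bvar d) (.const 1)) (scalar a)) (.natLe (res d) (.const 0)))
          (.seq (φ.eval (d + 1))
            -- On success the variable is not increased, so it still holds the witness when the loop
            -- stops.
            (.ite (.natLe (.const 1) (res (d + 1)))
              (.setNat 101 (.const d) (.const 0) (.const 1))
              (.setNat 100 (.const d) (.const 0) (.add (bvar d) (.const 1)))))))

/-- The truth of a formula at depth `d`. -/
def Fml.Sat : Fml → ℕ → Store → Prop
  | .atom b, _, s => b.Holds s
  | .and φ ψ, d, s => φ.Sat d s ∧ ψ.Sat d s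
  | .not φ, d, s => ¬ φ.Sat d s
  | .ex a φ, d, s => ∃ i, i < s.nat a 0 0 ∧ φ.Sat (d + 1) (s.setNat 100 d 0 i)

/-- The outermost existential quantifiers are witnessed by the contents of the array `100`. -/
def Fml.Witnessed : Fml → ℕ → Store → Prop
  | .ex a φ, d, s => s.nat 100 d 0 < s.nat a 0 0 ∧ φ.Witnessed (d + 1) s
  | φ, d, s => φ.Sat d s

def NatExp.isConstLT (d : ℕ) : NatExp → Bool
  | .const c => decide (c < d)
  | _ => false

/-- The expression does not depend on the array `101`, nor on the array `100` except for the
variables that are bound at depths less than `d`. -/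
def NatExp.ok (d : ℕ) : NatExp → Bool
  | .const _ => true
  | .get a i j => (a != 100 && a != 101 && i.ok d && j.ok d) ||
      (a == 100 && i.isConstLT d && j.isConstLT 1)
  | .add x y => x.ok d && y.ok d
  | .sub x y => x.ok d && y.ok d

def RealExp.ok (d : ℕ) : RealExp → Bool
  | .zero => true
  | .get _ i j => i.ok d && j.ok d
  | .add x y => x.ok d && y.ok d
  | .sub x y => x.ok d && y.ok d

def Test.ok (d : ℕ) : Test → Bool
  | .natLe x y => x.ok d && y.ok d
  | .realLe x y => x.ok d && y.ok d
  | .not b => b.ok d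
  | .and b c => b.ok d && c.ok d

def Fml.ok : Fml → ℕ → Bool
  | .atom b, d => b.ok d
  | .and φ ψ, d => φ.ok d && ψ.ok d
  | .not φ, d => φ.ok d
  | .ex a φ, d => a != 100 && a != 101 && φ.ok (d + 1)

/-- All quantifiers of the formula are bounded by numbers less than `N`. -/
def Fml.Bounded (N : ℕ) (s : Store) : Fml → Prop
  | .atom _ => True
  | .and φ ψ => φ.Bounded N s ∧ ψ.Bounded N s
  | .not φ => φ.Bounded N s
  | .ex a φ => s.nat a 0 0 < N ∧ φ.Bounded N s

/-- Agreement outside the scratch arrays and on the variables bound at depths less than `d`. -/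
structure Agree (d : ℕ) (s s' : Store) : Prop where
  real : s'.real = s.real
  nat : ∀ a, a ≠ 100 → a ≠ 101 → s'.nat a = s.nat a
  bvar : ∀ i, i < d → s'.nat 100 i 0 = s.nat 100 i 0

theorem NatExp.val_congr {d : ℕ} {s s' : Store} (h : Agree d s s') (e : NatExp) (he : e.ok d) :
    e.val s' = e.val s := by
  induction e with
  | const c => rfl
  | get a i j hi hj =>
    simp only [NatExp.ok, Bool.or_eq_true, Bool.and_eq_true, bne_iff_ne, beq_iff_eq] at he
    rcases he with he | he
    · simp only [NatExp.val, hi he.1.2, hj he.2, h.nat a he.1.1.1 he.1.1.2]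
    · obtain ⟨⟨rfl, h1⟩, h2⟩ := he
      cases i <;> simp [NatExp.isConstLT] at h1
      cases j <;> simp [NatExp.isConstLT] at h2
      subst h2
      exact h.bvar _ h1
  | add x y hx hy =>
    simp only [NatExp.ok, Bool.and_eq_true] at he
    simp only [NatExp.val, hx he.1, hy he.2]
  | sub x y hx hy =>
    simp only [NatExp.ok, Bool.and_eq_true] at he
    simp only [NatExp.val, hx he.1, hy he.2]

theorem RealExp.val_congr {d : ℕ} {s s' : Store} (h : Agree d s s') (e : RealExp) (he : e.ok d) :
    e.val s' = e.val s := by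
  induction e with
  | zero => rfl
  | get a i j =>
    simp only [RealExp.ok, Bool.and_eq_true] at he
    simp only [RealExp.val, i.val_congr h he.1, j.val_congr h he.2, h.real]
  | add x y hx hy =>
    simp only [RealExp.ok, Bool.and_eq_true] at he
    simp only [RealExp.val, hx he.1, hy he.2]
  | sub x y hx hy =>
    simp only [RealExp.ok, Bool.and_eq_true] at he
    simp only [RealExp.val, hx he.1, hy he.2]

theorem Test.holds_congr {d : ℕ} {s s' : Store} (h : Agree d s s') (b : Test) (hb : b.ok d) :
    b.Holds s' ↔ b.Holds s := by
  induction b with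
  | natLe x y =>
    simp only [Test.ok, Bool.and_eq_true] at hb
    simp only [Test.Holds, x.val_congr h hb.1, y.val_congr h hb.2]
  | realLe x y =>
    simp only [Test.ok, Bool.and_eq_true] at hb
    simp only [Test.Holds, x.val_congr h hb.1, y.val_congr h hb.2]
  | not b ih => simp only [Test.Holds, ih hb]
  | and b c hb' hc' =>
    simp only [Test.ok, Bool.and_eq_true] at hb
    simp only [Test.Holds, hb' hb.1, hc' hb.2]

theorem Agree.setNat_bvar {d : ℕ} {s s' : Store} (h : Agree d s s') (i : ℕ) :
    Agree (d + 1) (s.setNat 100 d 0 i) (s'.setNat 100 d 0 i) := by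
  refine ⟨h.real, fun a h1 h2 => ?_, fun j hj => ?_⟩
  · funext x y
    simp [Store.setNat, h1, h.nat a h1 h2]
  · simp only [Store.setNat]
    split_ifs with h'
    · rfl
    · simp only [true_and, and_true] at h'
      exact h.bvar j (by omega)

theorem Fml.sat_congr {s s' : Store} (φ : Fml) {d : ℕ} (h : Agree d s s') (hφ : φ.ok d) :
    φ.Sat d s' ↔ φ.Sat d s := by
  induction φ generalizing d s s' with
  | atom b => exact b.holds_congr h hφ
  | and φ ψ h₁ h₂ =>
    simp only [Fml.ok, Bool.and_eq_true] at hφ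
    simp only [Fml.Sat, h₁ h hφ.1, h₂ h hφ.2]
  | not φ ih => simp only [Fml.Sat, ih h hφ]
  | ex a φ ih =>
    simp only [Fml.ok, Bool.and_eq_true, bne_iff_ne] at hφ
    simp only [Fml.Sat, h.nat a hφ.1.1 hφ.1.2, ih (h.setNat_bvar _) hφ.2]

theorem Fml.bounded_congr {N : ℕ} {s s' : Store} (φ : Fml) {d d' : ℕ} (h : Agree d' s s')
    (hφ : φ.ok d) : φ.Bounded N s' ↔ φ.Bounded N s := by
  induction φ generalizing d with
  | atom b => rfl
  | and φ ψ h₁ h₂ =>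
    simp only [Fml.ok, Bool.and_eq_true] at hφ
    simp only [Fml.Bounded, h₁ hφ.1, h₂ hφ.2]
  | not φ ih => exact ih hφ
  | ex a φ ih =>
    simp only [Fml.ok, Bool.and_eq_true, bne_iff_ne] at hφ
    simp only [Fml.Bounded, h.nat a hφ.1.1 hφ.1.2, ih hφ.2]

theorem Agree.trans {d : ℕ} {s s' s'' : Store} (h : Agree d s s') (h' : Agree d s' s'') :
    Agree d s s'' :=
  ⟨h'.real.trans h.real, fun a h1 h2 => (h'.nat a h1 h2).trans (h.nat a h1 h2),
    fun i hi => (h'.bvar i hi).trans (h.bvar i hi)⟩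

theorem Agree.mono {d d' : ℕ} {s s' : Store} (h : Agree d s s') (hd : d' ≤ d) : Agree d' s s' :=
  ⟨h.real, h.nat, fun i hi => h.bvar i (by omega)⟩

theorem Agree.setNat_res (d i v : ℕ) (s : Store) : Agree d s (s.setNat 101 i 0 v) := by
  refine ⟨rfl, fun a h1 h2 => ?_, fun j hj => ?_⟩
  · funext x y; simp [Store.setNat, h2]
  · simp [Store.setNat]

theorem Agree.setNat_high (d v : ℕ) (s : Store) : Agree d s (s.setNat 100 d 0 v) := by
  refine ⟨rfl, fun a h1 h2 => ?_, fun j hj => ?_⟩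
  · funext x y; simp [Store.setNat, h1]
  · simp [Store.setNat, hj.ne]

theorem Fml.witnessed_setNat_res {s : Store} (i v : ℕ) (φ : Fml) {d : ℕ} (hφ : φ.ok d)
    (h : φ.Witnessed d s) : φ.Witnessed d (s.setNat 101 i 0 v) := by
  induction φ generalizing d with
  | ex a φ ih =>
    simp only [Fml.ok, Bool.and_eq_true, bne_iff_ne] at hφ
    refine ⟨?_, ih hφ.2 h.2⟩
    have := h.1
    simpa [Store.setNat, hφ.1.2] using this
  | atom b => exact (Fml.sat_congr _ (Agree.setNat_res d i v s) hφ).2 h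
  | and φ ψ => exact (Fml.sat_congr _ (Agree.setNat_res d i v s) hφ).2 h
  | not φ => exact (Fml.sat_congr _ (Agree.setNat_res d i v s) hφ).2 h

theorem Fml.Witnessed.sat {s : Store} {φ : Fml} {d : ℕ} (h : φ.Witnessed d s) : φ.Sat d s := by
  induction φ generalizing d with
  | ex a φ ih =>
    refine ⟨_, h.1, ?_⟩
    have : s.setNat 100 d 0 (s.nat 100 d 0) = s := by
      cases s
      simp only [Store.setNat, Store.mk.injEq, and_true]
      funext a i j
      split_ifs with h
      · rw [h.1, h.2.1, h.2.2]
      · rfl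
    rw [this]
    exact ih h.2
  | atom b => exact h
  | and φ ψ => exact h
  | not φ => exact h

/-- What deciding a formula at depth `d` does to the memory. -/
structure Decided (φ : Fml) (d : ℕ) (s s' : Store) : Prop where
  agree : Agree d s s'
  res : ∀ i, i < d → s'.nat 101 i 0 = s.nat 101 i 0
  result : (s'.nat 101 d 0 = 1 ∧ φ.Witnessed d s') ∨ (s'.nat 101 d 0 = 0 ∧ ¬ φ.Sat d s)

/-- Deciding at depth `d` touches the scratch arrays only at depths `d` and beyond, which protects
the variables and results of the enclosing quantifiers; this is what carries the induction. -/
theorem Fml.wp_eval {N : ℕ} (φ : Fml) {d : ℕ} {s : Store} (hφ : φ.ok d) (hN : φ.Bounded N s) :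
    wp N (φ.eval d) (Decided φ d s) s := by
  induction φ generalizing d s with
  | atom b =>
    refine wp_ite (fun h => wp_setNat ?_) (fun h => wp_setNat ?_) <;> simp only [NatExp.val]
    · refine ⟨.setNat_res _ _ _ _, fun i hi => by simp [Store.setNat, hi.ne], .inl
        ⟨by simp [Store.setNat], ?_⟩⟩
      exact (Fml.sat_congr (.atom b) (Agree.setNat_res d d 1 s) hφ).2 h
    · exact ⟨.setNat_res _ _ _ _, fun i hi => by simp [Store.setNat, hi.ne], .inr
        ⟨by simp [Store.setNat], h⟩⟩
  | and φ ψ h₁ h₂ =>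
    simp only [Fml.ok, Bool.and_eq_true] at hφ
    refine wp_seq ((h₁ hφ.1 hN.1).mono fun s' _ h' => wp_ite (fun hb => ?_) (fun hb => ?_))
    · simp only [Test.Holds, NatExp.val] at hb
      have hφs : φ.Sat d s' := by
        rcases h'.result with h | h
        · exact h.2.sat
        · omega
      refine (h₂ hφ.2 ((ψ.bounded_congr h'.agree hφ.2).2 hN.2)).mono fun s'' _ h'' =>
        ⟨h'.agree.trans h''.agree, fun i hi => (h''.res i hi).trans (h'.res i hi), ?_⟩
      rcases h''.result with h | h
      -- Deciding `ψ` at the same depth may overwrite the witnesses of `φ`. Only the truth of `φ`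
      -- survives, and `Witnessed` asks for no more, since it looks through leading quantifiers
      -- only.
      · exact .inl ⟨h.1, (φ.sat_congr h''.agree hφ.1).2 hφs, h.2.sat⟩
      · exact .inr ⟨h.1, fun hs => h.2 ((ψ.sat_congr h'.agree hφ.2).2 hs.2)⟩
    · simp only [Test.Holds, NatExp.val] at hb
      refine wp_skip ⟨h'.agree, h'.res, ?_⟩
      rcases h'.result with h | h
      · omega
      · exact .inr ⟨h.1, fun hs => h.2 hs.1⟩
  | not φ ih =>
    refine wp_seq ((ih hφ hN).mono fun s' _ h' => wp_setNat ?_)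
    simp only [NatExp.val]
    have hag := h'.agree.trans (Agree.setNat_res d d (1 - s'.nat 101 d 0) s')
    refine ⟨hag, fun i hi => ?_, ?_⟩
    · simpa [Store.setNat, hi.ne] using h'.res i hi
    · rcases h'.result with h | h
      · refine .inr ⟨by simp [Store.setNat, h.1], fun hs => hs ?_⟩
        exact (φ.sat_congr h'.agree hφ).1 h.2.sat
      · refine .inl ⟨by simp [Store.setNat, h.1], fun hs => h.2 ?_⟩
        exact (φ.sat_congr hag hφ).1 hs
  | ex a φ ih =>
    have hφ' := hφ
    simp only [Fml.ok, Bool.and_eq_true, bne_iff_ne] at hφ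
    obtain ⟨⟨ha, ha'⟩, hφ⟩ := hφ
    refine wp_seq (wp_setNat (wp_seq (wp_setNat ?_)))
    simp only [NatExp.val]
    set s₁ := (s.setNat 100 d 0 0).setNat 101 d 0 0 with hs₁
    have hag₁ : Agree d s s₁ := (Agree.setNat_high d 0 s).trans (Agree.setNat_res d d 0 _)
    have hNa : s.nat a 0 0 < N := hN.1
    refine wp_while (fun s' => Agree d s s' ∧ (∀ i, i < d → s'.nat 101 i 0 = s.nat 101 i 0) ∧
      ((s'.nat 101 d 0 = 1 ∧ (Fml.ex a φ).Witnessed d s') ∨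
        (s'.nat 101 d 0 = 0 ∧ s'.nat 100 d 0 ≤ s.nat a 0 0 ∧
          ∀ i, i < s'.nat 100 d 0 → ¬ φ.Sat (d + 1) (s.setNat 100 d 0 i))))
      -- The second summand drops when a witness is found. It makes the variant start at the bound
      -- plus one, hence the strict inequality in `Fml.Bounded`.
      (fun s' => (s.nat a 0 0 - s'.nat 100 d 0) + (1 - s'.nat 101 d 0)) ?_ ?_ ?_ ?_
    · refine ⟨hag₁, fun i hi => by simp [hs₁, Store.setNat, hi.ne], .inr ⟨by simp [hs₁, Store.setNat],
        by simp [hs₁, Store.setNat], fun i hi => ?_⟩⟩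
      simp [hs₁, Store.setNat] at hi
    · omega
    · rintro s' _ ⟨hag, hres, hI⟩ hb
      simp only [Test.Holds, NatExp.val, hag.nat a ha ha'] at hb
      obtain ⟨hb1, hb2⟩ := hb
      rcases hI with hI | ⟨hI0, hI1, hI2⟩
      · omega
      have hag' : Agree (d + 1) (s.setNat 100 d 0 (s'.nat 100 d 0)) s' := by
        refine ⟨hag.real, fun x h1 h2 => ?_, fun i hi => ?_⟩
        · rw [hag.nat x h1 h2]; funext y z; simp [Store.setNat, h1]
        · simp only [Store.setNat, true_and, and_true]
          split_ifs with h
          · rw [h]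
          · exact hag.bvar i (by omega)
      refine wp_seq ((ih hφ ((φ.bounded_congr hag hφ).2 hN.2)).mono fun s'' _ h'' => ?_)
      have h100 : s''.nat 100 d 0 = s'.nat 100 d 0 := h''.agree.bvar d (by omega)
      have h101 : s''.nat 101 d 0 = s'.nat 101 d 0 := h''.res d (by omega)
      have hag'' : Agree d s s'' := hag.trans (h''.agree.mono (by omega))
      refine wp_ite (fun hb => wp_setNat ?_) (fun hb => wp_setNat ?_) <;>
        simp only [Test.Holds, NatExp.val] at hb ⊢
      · rcases h''.result with h | h
        swap
        · omega
        refine ⟨⟨hag''.trans (.setNat_res _ _ _ _), fun i hi => ?_, .inl ⟨by simp [Store.setNat],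
          ?_, Fml.witnessed_setNat_res _ _ φ hφ h.2⟩⟩, ?_⟩
        · simp only [Store.setNat, hi.ne, false_and, and_false, if_false]
          rw [h''.res i (by omega), hres i hi]
        · simp only [Store.setNat, ha', false_and, if_false, Nat.reduceEqDiff, h100,
            hag''.nat a ha ha']
          omega
        · simp [Store.setNat, h100]
          omega
      · rcases h''.result with h | h
        · omega
        refine ⟨⟨hag''.trans (.setNat_high _ _ _), fun i hi => ?_, .inr ⟨?_, ?_, ?_⟩⟩, ?_⟩
        · simp only [Store.setNat, false_and, if_false, Nat.reduceEqDiff]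
          rw [h''.res i (by omega), hres i hi]
        · simp [Store.setNat, h101, hI0]
        · simp only [Store.setNat, h100, and_self, if_true]
          omega
        · intro i hi
          simp only [Store.setNat, h100, and_self, if_true] at hi
          rcases Nat.lt_succ_iff_lt_or_eq.1 hi with hi | rfl
          · exact hI2 i hi
          · exact fun hs => h.2 ((φ.sat_congr hag' hφ).2 hs)
        · simp [Store.setNat, h100, h101, hI0]
          omega
    · rintro s' _ ⟨hag, hres, hI⟩ hb
      refine ⟨hag, hres, ?_⟩
      simp only [Test.Holds, NatExp.val, hag.nat a ha ha'] at hb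
      rcases hI with hI | ⟨hI0, hI1, hI2⟩
      · exact .inl hI
      · refine .inr ⟨hI0, ?_⟩
        rintro ⟨i, hi, hs⟩
        exact hI2 i (by omega) hs

/-- Branch on a formula; in the first branch its existential variables hold witnesses. -/
def branch (φ : Fml) (c d : Program) : Program :=
  .seq (φ.eval 0) (.ite (.natLe (.const 1) (res 0)) c d)

theorem wp_branch {N : ℕ} {φ : Fml} {c d : Program} {Q : Store → Prop} {s : Store}
    (hφ : φ.ok 0) (hN : φ.Bounded N s)
    (h₁ : ∀ s', Agree 0 s s' → φ.Witnessed 0 s' → wp N c Q s')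
    (h₂ : ∀ s', Agree 0 s s' → ¬ φ.Sat 0 s → wp N d Q s') : wp N (branch φ c d) Q s := by
  refine wp_seq ((φ.wp_eval hφ hN).mono fun s' _ h => wp_ite (fun hb => ?_) (fun hb => ?_)) <;>
    simp only [Test.Holds, NatExp.val] at hb
  · rcases h.result with h' | h'
    · exact h₁ s' h.agree h'.2
    · omega
  · rcases h.result with h' | h'
    · omega
    · exact h₂ s' h.agree h'.2

end PeerAssessment

namespace PeerAssessment

/-! ### Load matrices with potentials -/

open Finset in
theorem sum_range_replace {n j₀ : ℕ} (f : ℕ → ℕ) (v : ℕ) (h : j₀ < n) :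
    ∑ j ∈ range n, (if j = j₀ then v else f j) + f j₀ = ∑ j ∈ range n, f j + v := by
  rw [← add_sum_erase _ _ (mem_range.2 h), ← add_sum_erase _ f (mem_range.2 h)]
  rw [sum_congr rfl fun j hj => if_neg (ne_of_mem_erase hj), if_pos rfl]
  ring

/-- A 0-1 matrix `M` with zero diagonal, row sums `dA`, column sums `dS`, and potentials `π`, `ρ`
that certify that it is optimal for these sums. -/
structure LoadMatrix (n : ℕ) (S : ℕ → ℕ → ℝ) (M : ℕ → ℕ → ℕ) (dA dS : ℕ → ℕ) (π ρ : ℕ → ℝ) :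
    Prop where
  zero_or_one : ∀ i < n, ∀ j < n, M i j = 0 ∨ M i j = 1
  diag : ∀ i < n, M i i = 0
  row : ∀ i < n, dA i = ∑ j ∈ Finset.range n, M i j
  col : ∀ j < n, dS j = ∑ i ∈ Finset.range n, M i j
  le_of_one : ∀ i < n, ∀ j < n, M i j = 1 → π i + ρ j ≤ S i j
  le_of_zero : ∀ i < n, ∀ j < n, i ≠ j → M i j = 0 → S i j ≤ π i + ρ j

section

variable {n k : ℕ} {S : ℕ → ℕ → ℝ} {M : ℕ → ℕ → ℕ} {dA dS : ℕ → ℕ} {π ρ : ℕ → ℝ}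

/-- A tight entry satisfies both slackness inequalities, so it can be switched on, or off in
`LoadMatrix.remove`, without touching the potentials. -/
theorem LoadMatrix.insert (h : LoadMatrix n S M dA dS π ρ) {i j : ℕ} (hi : i < n) (hj : j < n)
    (hij : i ≠ j) (hM : M i j = 0) (ht : S i j = π i + ρ j) :
    LoadMatrix n S (fun i' j' => if i' = i ∧ j' = j then 1 else M i' j')
      (fun i' => if i' = i then dA i + 1 else dA i')
      (fun j' => if j' = j then dS j + 1 else dS j') π ρ where
  zero_or_one i' hi' j' hj' := by
    split_ifs
    · exact .inr rfl
    · exact h.zero_or_one i' hi' j' hj'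
  diag i' hi' := by
    rw [if_neg (by omega)]
    exact h.diag i' hi'
  row i' hi' := by
    split_ifs with h'
    · subst h'
      have := sum_range_replace (M i') 1 hj
      simp only [true_and]
      rw [h.row i' hi']
      omega
    · simp [h', h.row i' hi']
  col j' hj' := by
    split_ifs with h'
    · subst h'
      have := sum_range_replace (fun i => M i j') 1 hi
      simp only [and_true]
      rw [h.col j' hj']
      omega
    · simp [h', h.col j' hj']
  le_of_one i' hi' j' hj' := by
    split_ifs with h'
    · rw [h'.1, h'.2, ht]
      exact fun _ => le_rfl
    · exact h.le_of_one i' hi' j' hj'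
  le_of_zero i' hi' j' hj' hne := by
    split_ifs with h'
    · simp
    · exact h.le_of_zero i' hi' j' hj' hne

theorem LoadMatrix.remove (h : LoadMatrix n S M dA dS π ρ) {i j : ℕ} (hi : i < n) (hj : j < n)
    (hM : M i j = 1) (ht : S i j = π i + ρ j) :
    LoadMatrix n S (fun i' j' => if i' = i ∧ j' = j then 0 else M i' j')
      (fun i' => if i' = i then dA i - 1 else dA i')
      (fun j' => if j' = j then dS j - 1 else dS j') π ρ where
  zero_or_one i' hi' j' hj' := by
    split_ifs
    · exact .inl rfl
    · exact h.zero_or_one i' hi' j' hj'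
  diag i' hi' := by
    split_ifs
    · rfl
    · exact h.diag i' hi'
  row i' hi' := by
    split_ifs with h'
    · subst h'
      have := sum_range_replace (M i') 0 hj
      simp only [true_and]
      rw [h.row i' hi']
      omega
    · simp [h', h.row i' hi']
  col j' hj' := by
    split_ifs with h'
    · subst h'
      have := sum_range_replace (fun i => M i j') 0 hi
      simp only [and_true]
      rw [h.col j' hj']
      omega
    · simp [h', h.col j' hj']
  le_of_one i' hi' j' hj' := by
    split_ifs with h'
    · simp
    · exact h.le_of_one i' hi' j' hj'
  le_of_zero i' hi' j' hj' hne := by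
    split_ifs with h'
    · rw [h'.1, h'.2, ht]
      exact fun _ => le_rfl
    · exact h.le_of_zero i' hi' j' hj' hne

/-- The rows with positive stamp `stA` and the columns with positive stamp `stB` are reachable by
alternating paths of tight entries from the rows with sum less than `k`, and the stamps increase
along these paths. Only stamps up to `b` are considered. -/
structure Marked (n k : ℕ) (S : ℕ → ℕ → ℝ) (M : ℕ → ℕ → ℕ) (dA : ℕ → ℕ) (π ρ : ℕ → ℝ)
    (stA stB : ℕ → ℕ) (b : ℕ) : Prop where
  row : ∀ i < n, 0 < stA i → stA i < b → k ≤ dA i → ∃ j < n, 0 < stB j ∧ stB j < stA i ∧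
    M i j = 1 ∧ S i j = π i + ρ j
  col : ∀ j < n, 0 < stB j → stB j ≤ b → ∃ i < n, i ≠ j ∧ 0 < stA i ∧ stA i < stB j ∧
    M i j = 0 ∧ S i j = π i + ρ j

variable {stA stB : ℕ → ℕ} {b : ℕ}

/-- During a walk the matrix changes only in rows whose stamps are not below the new cutoff. Stamps
decrease along the way back, so the part of the path still to be walked is intact; the cutoff `b` in
`Marked` exists for this purpose. -/
theorem Marked.congr {M' : ℕ → ℕ → ℕ} {dA' : ℕ → ℕ} {b' : ℕ}
    (h : Marked n k S M dA π ρ stA stB b) (hb : b' ≤ b)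
    (hd : ∀ i < n, stA i < b' → dA' i ≤ dA i)
    (hM : ∀ i < n, ∀ j < n, stA i < b' → stB j ≤ b' → M' i j = M i j) :
    Marked n k S M' dA' π ρ stA stB b' where
  row i hi h1 h2 h3 := by
    obtain ⟨j, hj, h4, h5, h6, h7⟩ := h.row i hi h1 (by omega) (h3.trans (hd i hi h2))
    exact ⟨j, hj, h4, h5, (hM i hi j hj h2 (by omega)).trans h6, h7⟩
  col j hj h1 h2 := by
    obtain ⟨i, hi, h3, h4, h5, h6, h7⟩ := h.col j hj h1 (by omega)
    exact ⟨i, hi, h3, h4, h5, (hM i hi j hj (by omega) h2).trans h6, h7⟩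

/-- An entry that leaves the marked part of the matrix. -/
def CrossRow (n : ℕ) (M : ℕ → ℕ → ℕ) (stA stB : ℕ → ℕ) (i j : ℕ) : Prop :=
  i < n ∧ j < n ∧ i ≠ j ∧ 0 < stA i ∧ stB j = 0 ∧ M i j = 0

def CrossCol (n : ℕ) (M : ℕ → ℕ → ℕ) (stA stB : ℕ → ℕ) (i j : ℕ) : Prop :=
  i < n ∧ j < n ∧ stA i = 0 ∧ 0 < stB j ∧ M i j = 1

/-- The sum `π i + ρ j` is unchanged when the row and the column are both marked or both unmarked.
It drops by `δ` in a marked row and an unmarked column, which endangers only the zeros there, and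
rises by `δ` in the opposite case, which endangers only the ones; the hypotheses bound `δ` by
precisely these slacks. -/
theorem LoadMatrix.shift (h : LoadMatrix n S M dA dS π ρ) {δ : ℝ} (hδ : 0 ≤ δ)
    (hr : ∀ i j, CrossRow n M stA stB i j → δ ≤ π i + ρ j - S i j)
    (hc : ∀ i j, CrossCol n M stA stB i j → δ ≤ S i j - (π i + ρ j)) :
    LoadMatrix n S M dA dS (fun i => if 0 < stA i then π i - δ else π i)
      (fun j => if 0 < stB j then ρ j + δ else ρ j) where
  zero_or_one := h.zero_or_one
  diag := h.diag
  row := h.row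
  col := h.col
  le_of_one i hi j hj h1 := by
    have h2 := h.le_of_one i hi j hj h1
    have h3 := hc i j
    unfold CrossCol at h3
    split_ifs with ha hb hb
    · linarith
    · linarith
    · linarith [h3 ⟨hi, hj, by omega, hb, h1⟩]
    · exact h2
  le_of_zero i hi j hj hij h1 := by
    have h2 := h.le_of_zero i hi j hj hij h1
    have h3 := hr i j
    unfold CrossRow at h3
    split_ifs with ha hb hb
    · linarith
    · linarith [h3 ⟨hi, hj, hij, ha, by omega, h1⟩]
    · linarith
    · exact h2

/-- The paths use only entries in a marked row and a marked column, where the two changes cancel. -/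
theorem Marked.shift (h : Marked n k S M dA π ρ stA stB b) (δ : ℝ) :
    Marked n k S M dA (fun i => if 0 < stA i then π i - δ else π i)
      (fun j => if 0 < stB j then ρ j + δ else ρ j) stA stB b where
  row i hi h1 h2 h3 := by
    obtain ⟨j, hj, h4, h5, h6, h7⟩ := h.row i hi h1 h2 h3
    exact ⟨j, hj, h4, h5, h6, by simp only [h1, h4, if_true]; linarith⟩
  col j hj h1 h2 := by
    obtain ⟨i, hi, h3, h4, h5, h6, h7⟩ := h.col j hj h1 h2
    exact ⟨i, hi, h3, h4, h5, h6, by simp only [h1, h4, if_true]; linarith⟩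

/-- The new stamp `b + 1` exceeds all the others, so it may refer to any of them and none of them
refers to it. The cutoff grows to `b + 2` because it is strict for rows. -/
theorem Marked.mark_col (h : Marked n k S M dA π ρ stA stB (b + 1)) (hA : ∀ i < n, stA i ≤ b)
    (hB : ∀ j < n, stB j ≤ b)
    {i j : ℕ} (hc : CrossRow n M stA stB i j) (ht : S i j = π i + ρ j) :
    Marked n k S M dA π ρ stA (fun j' => if j' = j then b + 1 else stB j') (b + 2) where
  row i' hi' h1 h2 h3 := by
    obtain ⟨j', hj', h4, h5, h6, h7⟩ := h.row i' hi' h1 (by have := hA i' hi'; omega) h3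
    have : j' ≠ j := by rintro rfl; have := hc.2.2.2.2.1; omega
    exact ⟨j', hj', by simpa [this], by simpa [this], h6, h7⟩
  col j' hj' := by
    split_ifs with h'
    · subst h'
      intro _ _
      exact ⟨i, hc.1, hc.2.2.1, hc.2.2.2.1, by have := hA i hc.1; omega, hc.2.2.2.2.2, ht⟩
    · intro h1 h2
      exact h.col j' hj' h1 (by have := hB j' hj'; omega)

theorem Marked.mark_row (h : Marked n k S M dA π ρ stA stB (b + 1)) (hA : ∀ i < n, stA i ≤ b)
    (hB : ∀ j < n, stB j ≤ b)
    {i j : ℕ} (hc : CrossCol n M stA stB i j) (ht : S i j = π i + ρ j) :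
    Marked n k S M dA π ρ (fun i' => if i' = i then b + 1 else stA i') stB (b + 2) where
  row i' hi' := by
    split_ifs with h'
    · subst h'
      intro _ _ _
      exact ⟨j, hc.2.1, hc.2.2.2.1, by have := hB j hc.2.1; omega, hc.2.2.2.2, ht⟩
    · intro h1 h2 h3
      exact h.row i' hi' h1 (by have := hA i' hi'; omega) h3
  col j' hj' h1 h2 := by
    obtain ⟨i', hi', h3, h4, h5, h6, h7⟩ := h.col j' hj' h1 (by have := hB j' hj'; omega)
    have : i' ≠ i := by rintro rfl; have := hc.2.2.1; omega
    exact ⟨i', hi', h3, by simpa [this], by simpa [this], h6, h7⟩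

open Finset in
/-- If no marked column can take one more entry and some row has to, then some entry leaves the
marked part. -/
theorem LoadMatrix.exists_cross (h : LoadMatrix n S M dA dS π ρ) (hk : k < n)
    (hA : ∀ i < n, dA i ≤ k) (hsrc : ∀ i < n, dA i < k → 0 < stA i)
    (hex : ∃ i < n, dA i < k) (hB : ∀ j < n, 0 < stB j → k ≤ dS j) :
    ∃ i j, CrossRow n M stA stB i j ∨ CrossCol n M stA stB i j := by
  by_contra hno
  push Not at hno
  set R := (range n).filter fun i => 0 < stA i with hR
  set T := (range n).filter fun j => 0 < stB j with hT
  set T' := (range n).filter fun j => ¬ 0 < stB j with hT'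
  have hcard : #T + #T' = n := by
    have := card_filter_add_card_filter_not (s := range n) (fun j => 0 < stB j)
    simpa [hT, hT'] using this
  have h1 : ∑ i ∈ R, dA i < #R * k := by
    rw [← smul_eq_mul, ← sum_const]
    obtain ⟨i, hi, hik⟩ := hex
    refine sum_lt_sum (fun i hi => ?_) ⟨i, ?_, hik⟩
    · exact hA i (by simp [hR] at hi; exact hi.1)
    · simp [hR, hi, hsrc i hi hik]
  have h2 : ∑ i ∈ R, dA i = ∑ j ∈ T, ∑ i ∈ R, M i j + ∑ i ∈ R, ∑ j ∈ T', M i j := by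
    rw [sum_comm (s := T), ← sum_add_distrib]
    refine sum_congr rfl fun i hi => ?_
    simp only [hR, mem_filter, mem_range] at hi
    rw [h.row i hi.1, hT, hT', sum_filter_add_sum_filter_not]
  -- Without a crossing entry all ones of a marked column lie in marked rows.
  have h3 : #T * k ≤ ∑ j ∈ T, ∑ i ∈ R, M i j := by
    rw [← smul_eq_mul, ← sum_const]
    refine sum_le_sum fun j hj => ?_
    simp only [hT, mem_filter, mem_range] at hj
    refine (hB j hj.1 hj.2).trans ?_
    rw [h.col j hj.1]
    refine (sum_subset (filter_subset _ _) fun i hi hi' => ?_).ge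
    simp only [mem_filter, mem_range] at hi'
    rw [mem_range] at hi
    rcases h.zero_or_one i hi j hj.1 with h0 | h0
    · exact h0
    · exact absurd ⟨hi, hj.1, by omega, hj.2, h0⟩ (hno i j).2
  -- Without a crossing entry a marked row has a one in every unmarked column except on the
  -- diagonal; the correction `#(R ∩ T')` counts these diagonal entries.
  have h4 : #R * #T' ≤ ∑ i ∈ R, ∑ j ∈ T', M i j + #(R ∩ T') := by
    have : ∀ i ∈ R, ∑ j ∈ T', M i j + (if i ∈ T' then 1 else 0) = #T' := by
      intro i hi
      simp only [hR, mem_filter, mem_range] at hi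
      rw [card_eq_sum_ones, ← sum_ite_eq' T' i (fun _ => 1), ← sum_add_distrib]
      refine sum_congr rfl fun j hj => ?_
      simp only [hT', mem_filter, mem_range] at hj
      split_ifs with hji
      · subst hji
        rw [h.diag j hj.1]
      · rcases h.zero_or_one i hi.1 j hj.1 with h0 | h0
        · exact absurd ⟨hi.1, hj.1, Ne.symm hji, hi.2, by omega, h0⟩ (hno i j).1
        · rw [h0, add_zero]
    have h5 : ∑ i ∈ R, (if i ∈ T' then 1 else 0) = #(R ∩ T') := by
      rw [← card_filter, filter_mem_eq_inter]
    rw [← h5, ← sum_add_distrib, sum_congr rfl this, sum_const, smul_eq_mul]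
  have h6 : #(R ∩ T') ≤ #R := card_le_card inter_subset_left
  have h7 : #(R ∩ T') ≤ #T' := card_le_card inter_subset_right
  have h8 : #R ≤ n := by simpa using card_le_card (filter_subset (fun i => 0 < stA i) (range n))
  have h9 : 0 < #R := by
    obtain ⟨i, hi, hik⟩ := hex
    exact card_pos.2 ⟨i, by simp [hR, hi, hsrc i hi hik]⟩
  clear_value R T T'
  generalize #R = a at *
  generalize #T = t at *
  generalize #T' = t' at *
  generalize #(R ∩ T') = d at *
  -- This is impossible because `d` is at most `a` and `t'`, while `t + t' = n`, `a ≤ n` and `k ≤ n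
  -- - 1`. The cases are `t = 0`, `0 < a ≤ t` and `t ≤ a`; in the last one the worst value `k = n -
  -- 1` is inserted.
  have hkey : t * k + a * t' < a * k + d := by omega
  rcases Nat.eq_zero_or_pos t with ht | ht
  · subst ht
    have : a * k + a ≤ a * t' := by
      rw [← Nat.mul_succ]
      exact Nat.mul_le_mul_left _ (by omega)
    omega
  · obtain ⟨t₁, rfl⟩ : ∃ x, t = x + 1 := ⟨t - 1, by omega⟩
    obtain ⟨a₁, rfl⟩ : ∃ x, a = x + 1 := ⟨a - 1, by omega⟩
    rcases le_total a₁ t₁ with hle | hle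
    · have : a₁ * k ≤ t₁ * k := Nat.mul_le_mul_right _ hle
      nlinarith
    · obtain ⟨e, rfl⟩ := Nat.exists_eq_add_of_le hle
      obtain ⟨f, hf⟩ : ∃ f, n = t₁ + e + 1 + f := ⟨n - (t₁ + e + 1), by omega⟩
      have ht' : t' = e + f := by omega
      subst ht'
      have hk' : k ≤ t₁ + e + f := by omega
      have : e * k ≤ e * (t₁ + e + f) := Nat.mul_le_mul_left _ hk'
      nlinarith

end

open Finset in
/-- The entries of a 0-1 matrix that are equal to `1`. -/
def ones (n : ℕ) (M : ℕ → ℕ → ℕ) : Finset (Fin n × Fin n) :=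
  univ.filter fun e => M e.1 e.2 = 1

theorem mem_ones {n : ℕ} {M : ℕ → ℕ → ℕ} {i j : Fin n} : (i, j) ∈ ones n M ↔ M i j = 1 := by
  simp [ones]

open Finset in
theorem card_filter_eq_sum {n : ℕ} (f : ℕ → ℕ) (hf : ∀ j < n, f j = 0 ∨ f j = 1) :
    #(univ.filter fun j : Fin n => f j = 1) = ∑ j ∈ range n, f j := by
  rw [card_filter, Finset.sum_range]
  refine sum_congr rfl fun j _ => ?_
  rcases hf j j.2 with h | h <;> simp [h]

open Finset in
-- Every agent and every submission occurs `k` times, so the potentials contribute the same amount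
-- to all assignments. Comparing total similarities thus amounts to comparing sums of `S i j - (π i
-- + ρ j)`.
theorem IsAssignment.sum_potentials {n k : ℕ} {M : Finset (Fin n × Fin n)} (h : IsAssignment k M)
    (π ρ : Fin n → ℝ) :
    ∑ e ∈ M, (π e.1 + ρ e.2) = k * ∑ i, π i + k * ∑ j, ρ j := by
  have key : ∀ f : Fin n × Fin n → ℝ, ∑ e ∈ M, f e = ∑ e, if e ∈ M then f e else 0 := by
    intro f
    rw [← sum_filter]
    congr 1
    ext e
    simp
  rw [sum_add_distrib, key, key, Fintype.sum_prod_type, Fintype.sum_prod_type_right, mul_sum, mul_sum]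
  congr 1
  · refine sum_congr rfl fun i _ => ?_
    dsimp only
    rw [← sum_filter, sum_const, h.agent_load i, nsmul_eq_mul]
  · refine sum_congr rfl fun j _ => ?_
    dsimp only
    rw [← sum_filter, sum_const, h.submission_load j, nsmul_eq_mul]

open Finset in
-- Weak duality: after subtraction of the potentials, the pairs that only the competitor uses
-- contribute at most zero, and the pairs that it gives up contribute at least zero.
theorem LoadMatrix.isMaxSimilarityAssignment {n k : ℕ} {S : Matrix (Fin n) (Fin n) ℝ}
    {S' : ℕ → ℕ → ℝ} (hS : ∀ i j : Fin n, S' i j = S i j) {M : ℕ → ℕ → ℕ} {dA dS : ℕ → ℕ}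
    {π ρ : ℕ → ℝ} (h : LoadMatrix n S' M dA dS π ρ) (hA : ∀ i < n, dA i = k)
    (hB : ∀ j < n, dS j ≤ k) : IsMaxSimilarityAssignment S k (ones n M) := by
  -- The column sums are at most `k` and have the same total `n * k` as the row sums.
  have hB' : ∀ j < n, dS j = k := by
    have h1 : ∑ j ∈ range n, dS j = ∑ j ∈ range n, k := by
      rw [sum_congr rfl fun j hj => h.col j (mem_range.1 hj), sum_comm]
      exact sum_congr rfl fun i hi => by rw [← h.row i (mem_range.1 hi), hA i (mem_range.1 hi)]
    have := (sum_eq_sum_iff_of_le fun j hj => hB j (mem_range.1 hj)).1 h1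
    exact fun j hj => this j (mem_range.2 hj)
  have hM : IsAssignment k (ones n M) := by
    refine ⟨fun j => ?_, fun i => ?_, fun i => ?_⟩
    · simp only [mem_ones]
      rw [card_filter_eq_sum (fun i => M i j) fun i hi => h.zero_or_one i hi j j.2,
        ← h.col j j.2, hB' j j.2]
    · simp only [mem_ones]
      rw [card_filter_eq_sum (fun j => M i j) fun j hj => h.zero_or_one i i.2 j hj,
        ← h.row i i.2, hA i i.2]
    · rw [mem_ones, h.diag i i.2]
      simp
  refine ⟨hM, fun M' hM' => ?_⟩
  have e1 := hM.sum_potentials (fun i => π i) fun j => ρ j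
  rw [← hM'.sum_potentials (fun i => π i) fun j => ρ j] at e1
  have e2 : ∑ e ∈ M' \ ones n M, (S e.1 e.2 - (π e.1 + ρ e.2)) ≤ 0 := by
    refine sum_nonpos fun e he => ?_
    obtain ⟨i, j⟩ := e
    rw [mem_sdiff, mem_ones] at he
    have hij : i ≠ j := by rintro rfl; exact hM'.no_self i he.1
    have := h.le_of_zero i i.2 j j.2 (by simpa [Fin.ext_iff] using hij)
      ((h.zero_or_one i i.2 j j.2).resolve_right he.2)
    rw [hS] at this
    simpa using this
  have e3 : 0 ≤ ∑ e ∈ ones n M \ M', (S e.1 e.2 - (π e.1 + ρ e.2)) := by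
    refine sum_nonneg fun e he => ?_
    obtain ⟨i, j⟩ := e
    rw [mem_sdiff, mem_ones] at he
    have := h.le_of_one i i.2 j j.2 he.1
    rw [hS] at this
    simpa using this
  have e4 := sum_sdiff_sub_sum_sdiff (s₁ := M') (s₂ := ones n M)
    (f := fun e : Fin n × Fin n => S e.1 e.2 - (π e.1 + ρ e.2))
  simp only [totalSimilarity]
  rw [sum_sub_distrib (s := M'), sum_sub_distrib (s := ones n M)] at e4
  linarith

end PeerAssessment

namespace PeerAssessment

/-! ### Symbolic execution -/

infixr:60 " ;; " => Program.seq
infixr:62 " ∧ₜ " => Test.and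

attribute [simp] NatExp.val RealExp.val Test.Holds Fml.Sat Fml.Witnessed Fml.Bounded

@[simp]
theorem Store.nat_setNat_same (s : Store) (a i j v : ℕ) :
    (s.setNat a i j v).nat a = fun i' j' => if i' = i ∧ j' = j then v else s.nat a i' j' := by
  funext i' j'
  simp [Store.setNat]

@[simp]
theorem Store.nat_setNat_ne (s : Store) {a a' : ℕ} (i j v : ℕ) (h : a' ≠ a) :
    (s.setNat a i j v).nat a' = s.nat a' := by
  funext i' j'
  simp [Store.setNat, h]

@[simp]
theorem Store.real_setNat (s : Store) (a i j v : ℕ) : (s.setNat a i j v).real = s.real := rfl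

@[simp]
theorem Store.real_setReal_same (s : Store) (a i j : ℕ) (v : ℝ) :
    (s.setReal a i j v).real a = fun i' j' => if i' = i ∧ j' = j then v else s.real a i' j' := by
  funext i' j'
  simp [Store.setReal]

@[simp]
theorem Store.real_setReal_ne (s : Store) {a a' : ℕ} (i j : ℕ) (v : ℝ) (h : a' ≠ a) :
    (s.setReal a i j v).real a' = s.real a' := by
  funext i' j'
  simp [Store.setReal, h]

@[simp]
theorem Store.nat_setReal (s : Store) (a i j : ℕ) (v : ℝ) : (s.setReal a i j v).nat = s.nat := rfl

/-- The entry `i` of the vector in the array `a`. -/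
abbrev entry (a : ℕ) (i : NatExp) : NatExp := .get a i (.const 0)

/-- The test `x < y`. -/
def Test.lt (x y : NatExp) : Test := .natLe (.add x (.const 1)) y

/-- The test `x = y`. -/
def Test.eq (x y : NatExp) : Test := .natLe x y ∧ₜ .natLe y x

/-- The test `x ≠ y`. -/
def Test.ne (x y : NatExp) : Test := .not (.eq x y)

/-- Disjunction of tests. -/
def Test.or (b c : Test) : Test := .not (.not b ∧ₜ .not c)

/-- Implication between tests. -/
def Test.imp (b c : Test) : Test := .not (b ∧ₜ .not c)

/-- Universal quantification. -/
def Fml.all (a : ℕ) (φ : Fml) : Fml := .not (.ex a (.not φ))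

/-- Implication. -/
def Fml.imp (φ ψ : Fml) : Fml := .not (.and φ (.not ψ))

@[simp]
theorem Test.holds_lt {x y : NatExp} {s : Store} : (Test.lt x y).Holds s ↔ x.val s < y.val s :=
  Iff.rfl

@[simp]
theorem Test.holds_eq {x y : NatExp} {s : Store} : (Test.eq x y).Holds s ↔ x.val s = y.val s :=
  le_antisymm_iff.symm

@[simp]
theorem Test.holds_ne {x y : NatExp} {s : Store} : (Test.ne x y).Holds s ↔ x.val s ≠ y.val s :=
  not_congr holds_eq

@[simp]
theorem Test.holds_or {b c : Test} {s : Store} : (b.or c).Holds s ↔ b.Holds s ∨ c.Holds s := by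
  simp only [Test.or, Test.Holds]
  tauto

@[simp]
theorem Test.holds_imp {b c : Test} {s : Store} : (b.imp c).Holds s ↔ (b.Holds s → c.Holds s) := by
  simp only [Test.imp, Test.Holds]
  tauto

@[simp]
theorem Fml.sat_all {a d : ℕ} {φ : Fml} {s : Store} : (Fml.all a φ).Sat d s ↔
    ∀ i, i < s.nat a 0 0 → φ.Sat (d + 1) (s.setNat 100 d 0 i) := by
  simp [Fml.all]

@[simp]
theorem Fml.witnessed_all {a d : ℕ} {φ : Fml} {s : Store} : (Fml.all a φ).Witnessed d s ↔
    ∀ i, i < s.nat a 0 0 → φ.Sat (d + 1) (s.setNat 100 d 0 i) := by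
  simp [Fml.all]

@[simp]
theorem Fml.sat_imp {d : ℕ} {φ ψ : Fml} {s : Store} :
    (Fml.imp φ ψ).Sat d s ↔ (φ.Sat d s → ψ.Sat d s) := by
  simp [Fml.imp]

@[simp]
theorem Fml.bounded_all {a N : ℕ} {φ : Fml} {s : Store} : (Fml.all a φ).Bounded N s ↔
    s.nat a 0 0 < N ∧ φ.Bounded N s := Iff.rfl

@[simp]
theorem Fml.bounded_imp {N : ℕ} {φ ψ : Fml} {s : Store} :
    (Fml.imp φ ψ).Bounded N s ↔ φ.Bounded N s ∧ ψ.Bounded N s := Iff.rfl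

/-! ### The program for the maximum-similarity assignment

Arrays of natural numbers: `2` the matrix, `4` and `5` its row and column sums, `6` and `7` the
stamps of rows and columns, `8` the largest stamp, `9` and `13` the current column and row, `10`,
`11` flags, `12` a loop variable. Arrays of real numbers: `1` and `2` the potentials, `3` the
amount by which they change. -/

/-- The matrix in the memory has row and column sums at most `k`. -/
structure Loads (n k : ℕ) (s : Store) : Prop where
  size : s.nat 0 0 0 = n
  load : s.nat 1 0 0 = k
  matrix : LoadMatrix n (s.real 0) (s.nat 2) (fun i => s.nat 4 i 0) (fun j => s.nat 5 j 0)
    (fun i => s.real 1 i 0) (fun j => s.real 2 j 0)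
  row_le : ∀ i < n, s.nat 4 i 0 ≤ k
  col_le : ∀ j < n, s.nat 5 j 0 ≤ k

/-- The stamps up to `b` are correct. -/
def StampsUpTo (n k : ℕ) (s : Store) (b : ℕ) : Prop :=
  Marked n k (s.real 0) (s.nat 2) (fun i => s.nat 4 i 0) (fun i => s.real 1 i 0)
    (fun j => s.real 2 j 0) (fun i => s.nat 6 i 0) (fun j => s.nat 7 j 0) b

/-- The number of ones in the matrix. -/
def matrixSum (n : ℕ) (s : Store) : ℕ := ∑ i ∈ Finset.range n, s.nat 4 i 0

/-- The entry `(i, j)` is tight. -/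
def tight (i j : NatExp) : Test :=
  .realLe (.get 0 i j) (.add (.get 1 i (.const 0)) (.get 2 j (.const 0))) ∧ₜ
    .realLe (.add (.get 1 i (.const 0)) (.get 2 j (.const 0))) (.get 0 i j)

@[simp]
theorem holds_tight {i j : NatExp} {s : Store} : (tight i j).Holds s ↔
    s.real 0 (i.val s) (j.val s) = s.real 1 (i.val s) 0 + s.real 2 (j.val s) 0 :=
  le_antisymm_iff.symm

def predRow : Fml := .ex 0 (.atom (.lt (entry 6 (bvar 0)) (entry 7 (scalar 9)) ∧ₜ
  .lt (.const 0) (entry 6 (bvar 0)) ∧ₜ .ne (bvar 0) (scalar 9) ∧ₜ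
  .eq (.get 2 (bvar 0) (scalar 9)) (.const 0) ∧ₜ tight (bvar 0) (scalar 9)))

/-- The first test lets the search fail when the row can keep its additional entry; this is how the
end of the augmenting path is recognized. -/
def predCol : Fml := .ex 0 (.atom (.lt (scalar 1) (entry 4 (scalar 13)) ∧ₜ
  .lt (entry 7 (bvar 0)) (entry 6 (scalar 13)) ∧ₜ
  .lt (.const 0) (entry 7 (bvar 0)) ∧ₜ
  .eq (.get 2 (scalar 13) (bvar 0)) (.const 1) ∧ₜ tight (scalar 13) (bvar 0)))

/-- One step back along an augmenting path. -/
def walkStep : Program :=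
  branch predRow
    (assign 13 (bvar 0) ;;
      .setNat 2 (scalar 13) (scalar 9) (.const 1) ;;
      .setNat 4 (scalar 13) (.const 0) (.add (entry 4 (scalar 13)) (.const 1)) ;;
      .setNat 5 (scalar 9) (.const 0) (.add (entry 5 (scalar 9)) (.const 1)) ;;
      branch predCol
        (assign 9 (bvar 0) ;;
          .setNat 2 (scalar 13) (scalar 9) (.const 0) ;;
          .setNat 4 (scalar 13) (.const 0) (.sub (entry 4 (scalar 13)) (.const 1)) ;;
          .setNat 5 (scalar 9) (.const 0) (.sub (entry 5 (scalar 9)) (.const 1)))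
        (assign 10 (.const 0)))
    (assign 10 (.const 0))

/-- The invariant of the walk along an augmenting path that ends in the column in the array `9`. -/
structure Walking (n k : ℕ) (s : Store) : Prop where
  loads : Loads n k s
  lt : s.nat 9 0 0 < n
  room : s.nat 5 (s.nat 9 0 0) 0 < k
  pos : 0 < s.nat 7 (s.nat 9 0 0) 0
  stamps : StampsUpTo n k s (s.nat 7 (s.nat 9 0 0) 0)

/-- A one is added to the current column in a row with smaller stamp. If the row sum now exceeds
`k`, the row gives up a one in a column of still smaller stamp; that column then has room, and the
walk goes on there. Otherwise the matrix has gained a one. -/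
theorem wp_walkStep {N n k : ℕ} {s : Store} (hN : n < N) (h : Walking n k s) :
    wp N walkStep (fun s' =>
      (s'.nat 10 = s.nat 10 ∧ Walking n k s' ∧
        s'.nat 7 (s'.nat 9 0 0) 0 < s.nat 7 (s.nat 9 0 0) 0 ∧ matrixSum n s' = matrixSum n s) ∨
      (s'.nat 10 0 0 = 0 ∧ Loads n k s' ∧ matrixSum n s' = matrixSum n s + 1)) s := by
  have hn := h.loads.size
  have hk := h.loads.load
  obtain ⟨i₀, hi₀, hne₀, hpos₀, hlt₀, hM₀, ht₀⟩ := h.stamps.col _ h.lt h.pos le_rfl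
  refine wp_branch rfl (by simp [predRow, hn, hN]) (fun s₁ hag hw => ?_) (fun s₁ hag hw => ?_)
  swap
  · refine absurd ⟨i₀, by rwa [hn], ?_⟩ hw
    simpa using ⟨hlt₀, hpos₀, hne₀, hM₀, ht₀⟩
  simp [predRow, hag.nat, hag.real, hn] at hw
  obtain ⟨hi, hlt, hpos, hne, hM, ht⟩ := hw
  have hrow := h.loads.row_le _ hi
  refine wp_seq (wp_setNat (wp_seq (wp_setNat (wp_seq (wp_setNat (wp_seq (wp_setNat ?_)))))))
  simp [hag.nat]
  set i := s₁.nat 100 0 0 with hi_def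
  set j := s.nat 9 0 0 with hj_def
  set s₂ := (((s₁.setNat 13 0 0 i).setNat 2 i j 1).setNat 4 i 0 (s.nat 4 i 0 + 1)).setNat 5 j 0
    (s.nat 5 j 0 + 1) with hs₂
  have hm := h.loads.matrix.insert hi h.lt hne hM ht
  have hsum : matrixSum n s₂ = matrixSum n s + 1 := by
    have := sum_range_replace (fun i => s.nat 4 i 0) (s.nat 4 i 0 + 1) hi
    simp [matrixSum, hs₂, hag.nat]
    omega
  have hk₂ : s₂.nat 1 0 0 = k := by simp [hs₂, hag.nat, hk]
  have hn₂ : s₂.nat 0 0 0 = n := by simp [hs₂, hag.nat, hn]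
  have hm₂ : LoadMatrix n (s₂.real 0) (s₂.nat 2) (fun i => s₂.nat 4 i 0) (fun j => s₂.nat 5 j 0)
      (fun i => s₂.real 1 i 0) (fun j => s₂.real 2 j 0) := by
    simpa [hs₂, hag.nat, hag.real] using hm
  have hcol₂ : ∀ j' < n, s₂.nat 5 j' 0 ≤ k := by
    intro j' hj'
    have h1 := h.loads.col_le j' hj'
    have h2 : s.nat 5 j 0 < k := h.room
    simp [hs₂, hag.nat]
    split_ifs <;> omega
  have hrow₂ : ∀ i' < n, i' ≠ i → s₂.nat 4 i' 0 ≤ k := by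
    intro i' hi' hne'
    simpa [hs₂, hag.nat, hne'] using h.loads.row_le i' hi'
  have h4i : s₂.nat 4 i 0 = s.nat 4 i 0 + 1 := by simp [hs₂]
  have h13 : s₂.nat 13 0 0 = i := by simp [hs₂]
  have h6 : s₂.nat 6 = s.nat 6 := by simp [hs₂, hag.nat]
  have h7 : s₂.nat 7 = s.nat 7 := by simp [hs₂, hag.nat]
  have h10 : s₂.nat 10 = s.nat 10 := by simp [hs₂, hag.nat]
  have h2ne : ∀ i' j', i' ≠ i → s₂.nat 2 i' j' = s.nat 2 i' j' := by
    intro i' j' h'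
    simp [hs₂, hag.nat, h']
  have h2ne' : ∀ i' j', j' ≠ j → s₂.nat 2 i' j' = s.nat 2 i' j' := by
    intro i' j' h'
    simp [hs₂, hag.nat, h']
  have h4ne : ∀ i', i' ≠ i → s₂.nat 4 i' 0 = s.nat 4 i' 0 := by
    intro i' h'
    simp [hs₂, hag.nat, h']
  have hre : s₂.real = s.real := by simp [hs₂, hag.real]
  clear_value s₂ i
  refine wp_branch rfl (by simp [predCol, hn₂, hN]) (fun s₃ hag hw => ?_) (fun s₃ hag hw => ?_)
  · simp [predCol, hag.nat, hag.real, hn₂, hk₂, h13] at hw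
    obtain ⟨hj', hki, hlt', hpos', hM', ht'⟩ := hw
    refine wp_seq (wp_setNat (wp_seq (wp_setNat (wp_seq (wp_setNat (wp_setNat ?_))))))
    simp [hag.nat, h13, h7, h10]
    set j' := s₃.nat 100 0 0
    have hjj' : j' ≠ j := by rintro h'; rw [h', h6, h7] at hlt'; omega
    have hm₃ := hm₂.remove hi hj' hM' ht'
    left
    refine ⟨⟨⟨by simp [hag.nat, hn₂], by simp [hag.nat, hk₂],
      by simpa [hag.nat, hag.real] using hm₃, ?_, ?_⟩, by simpa using hj', ?_, ?_, ?_⟩, ?_, ?_⟩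
    · intro i' hi'
      simp [hag.nat]
      split_ifs with h'
      · omega
      · exact hrow₂ i' hi' h'
    · intro j'' hj''
      have := hcol₂ _ hj''
      have := hcol₂ _ hj'
      simp [hag.nat]
      split_ifs <;> omega
    · have := hcol₂ _ hj'
      have : 0 < s₂.nat 5 j' 0 := by
        rw [hm₂.col _ hj']
        refine Finset.sum_pos' (fun _ _ => Nat.zero_le _) ⟨i, Finset.mem_range.2 hi, ?_⟩
        omega
      simp
      omega
    · simpa [hag.nat] using hpos'
    -- Both changes are in row `i`, whose stamp exceeds the new cutoff, the stamp of column `j'`.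
    · have hst : StampsUpTo n k s (s.nat 7 j 0) := h.stamps
      unfold StampsUpTo at hst ⊢
      simp [hag.nat, hag.real, h6, h7, hre]
      rw [h6, h7] at hlt'
      refine hst.congr (by omega) ?_ ?_
      · intro i' hi' h1
        have : i' ≠ i := by rintro rfl; omega
        simp [this, h4ne]
      · intro i' hi' j'' hj'' h1 h2
        have : i' ≠ i := by rintro rfl; omega
        simp [this, h2ne]
    · rw [h6, h7] at hlt'
      omega
    · have := sum_range_replace (fun i => s₂.nat 4 i 0) (s₂.nat 4 i 0 - 1) hi
      simp only [matrixSum] at hsum ⊢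
      simp [hag.nat]
      omega
  · refine wp_setNat ?_
    right
    -- A row that overflows had sum at least `k` before, so its stamp has a predecessor column and
    -- the search would have succeeded.
    have hle : s₂.nat 4 i 0 ≤ k := by
      by_contra hcon
      obtain ⟨j', hj', h1, h2, h3, h4⟩ := h.stamps.row i hi hpos hlt (by omega)
      refine hw ⟨j', by rwa [hn₂], ?_⟩
      have hjj' : j' ≠ j := by rintro rfl; omega
      simpa [h13, hk₂, h6, h7, hre, h2ne' _ _ hjj'] using ⟨by omega, h2, h1, h3, h4⟩
    refine ⟨by simp, ⟨by simp [hag.nat, hn₂], by simp [hag.nat, hk₂],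
      by simpa [hag.nat, hag.real] using hm₂, ?_, by simpa [hag.nat] using hcol₂⟩,
      by simpa [matrixSum, hag.nat] using hsum⟩
    intro i' hi'
    simp only [NatExp.val, ne_eq, Nat.reduceEqDiff, not_false_eq_true, Store.nat_setNat_ne, hag.nat]
    by_cases h' : i' = i
    · rwa [h']
    · exact hrow₂ i' hi' h'

end PeerAssessment

/-! ### Growing the marked part, and termination of the primal-dual method -/

namespace PeerAssessment

theorem LoadMatrix.congr {n : ℕ} {S : ℕ → ℕ → ℝ} {M : ℕ → ℕ → ℕ} {dA dS : ℕ → ℕ}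
    {π ρ π' ρ' : ℕ → ℝ} (h : LoadMatrix n S M dA dS π ρ) (hπ : ∀ i < n, π' i = π i)
    (hρ : ∀ j < n, ρ' j = ρ j) : LoadMatrix n S M dA dS π' ρ' where
  zero_or_one := h.zero_or_one
  diag := h.diag
  row := h.row
  col := h.col
  le_of_one i hi j hj := by rw [hπ i hi, hρ j hj]; exact h.le_of_one i hi j hj
  le_of_zero i hi j hj := by rw [hπ i hi, hρ j hj]; exact h.le_of_zero i hi j hj

theorem Marked.congr_potentials {n k b : ℕ} {S : ℕ → ℕ → ℝ} {M : ℕ → ℕ → ℕ} {dA stA stB : ℕ → ℕ}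
    {π ρ π' ρ' : ℕ → ℝ} (h : Marked n k S M dA π ρ stA stB b) (hπ : ∀ i < n, π' i = π i)
    (hρ : ∀ j < n, ρ' j = ρ j) : Marked n k S M dA π' ρ' stA stB b where
  row i hi h1 h2 h3 := by
    obtain ⟨j, hj, h⟩ := h.row i hi h1 h2 h3
    exact ⟨j, hj, by rwa [hπ i hi, hρ j hj]⟩
  col j hj h1 h2 := by
    obtain ⟨i, hi, h⟩ := h.col j hj h1 h2
    exact ⟨i, hi, by rwa [hπ i hi, hρ j hj]⟩

/-- The whole walk along an augmenting path. -/
def walk : Program :=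
  assign 10 (.const 1) ;; .while (.lt (.const 0) (scalar 10)) walkStep

theorem wp_walk {N n k : ℕ} {s : Store} (hN : n < N) (h : Walking n k s)
    (hb : s.nat 7 (s.nat 9 0 0) 0 ≤ N) :
    wp N walk (fun s' => Loads n k s' ∧ matrixSum n s' = matrixSum n s + 1) s := by
  refine wp_seq (wp_setNat ?_)
  refine wp_while (fun s' => (0 < s'.nat 10 0 0 ∧ Walking n k s' ∧
      matrixSum n s' = matrixSum n s) ∨
      (s'.nat 10 0 0 = 0 ∧ Loads n k s' ∧ matrixSum n s' = matrixSum n s + 1))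
    (fun s' => if s'.nat 10 0 0 = 0 then 0 else s'.nat 7 (s'.nat 9 0 0) 0) ?_ ?_ ?_ ?_
  · left
    refine ⟨by simp, ⟨⟨?_, ?_, ?_, ?_, ?_⟩, ?_, ?_, ?_, ?_⟩, ?_⟩
    · simpa using h.loads.size
    · simpa using h.loads.load
    · simpa using h.loads.matrix
    · simpa using h.loads.row_le
    · simpa using h.loads.col_le
    · simpa using h.lt
    · simpa using h.room
    · simpa using h.pos
    · simpa [StampsUpTo] using h.stamps
    · simp [matrixSum]
  · simpa using hb
  · rintro s' - (⟨h0, hw, hs⟩ | ⟨h0, hw, hs⟩) hb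
    · refine (wp_walkStep hN hw).mono fun s'' _ h'' => ?_
      rcases h'' with ⟨h1, h2, h3, h4⟩ | ⟨h1, h2, h3⟩
      · refine ⟨.inl ⟨by rwa [h1], h2, h4.trans hs⟩, ?_⟩
        rw [h1, if_neg (by omega), if_neg (by omega)]
        exact h3
      · refine ⟨.inr ⟨h1, h2, by omega⟩, ?_⟩
        rw [if_pos h1, if_neg (by omega)]
        exact hw.pos
    · simp at hb
      omega
  · rintro s' - (⟨h0, hw, hs⟩ | ⟨h0, hw, hs⟩) hb
    · simp at hb
      omega
    · exact ⟨hw, hs⟩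

/-- Mark exactly the rows with sum less than `k`. -/
def resetMarks : Program :=
  forLoop 12 0
    (.ite (.lt (entry 4 (scalar 12)) (scalar 1)) (.setNat 6 (scalar 12) (.const 0) (.const 1))
        (.setNat 6 (scalar 12) (.const 0) (.const 0)) ;;
      .setNat 7 (scalar 12) (.const 0) (.const 0)) ;;
  assign 8 (.const 1)

/-- The number of marked rows and columns. -/
def markedCount (n : ℕ) (s : Store) : ℕ :=
  ((Finset.range n).filter fun i => 0 < s.nat 6 i 0).card +
    ((Finset.range n).filter fun j => 0 < s.nat 7 j 0).card

theorem markedCount_le (n : ℕ) (s : Store) : markedCount n s ≤ 2 * n := by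
  have h1 := Finset.card_filter_le (Finset.range n) fun i => 0 < s.nat 6 i 0
  have h2 := Finset.card_filter_le (Finset.range n) fun i => 0 < s.nat 7 i 0
  rw [Finset.card_range] at h1 h2
  unfold markedCount
  omega

/-- The stamps are correct and all rows with sum less than `k` are marked. -/
structure Stamped (n k : ℕ) (s : Store) : Prop where
  stamps : StampsUpTo n k s (s.nat 8 0 0 + 1)
  row_le : ∀ i < n, s.nat 6 i 0 ≤ s.nat 8 0 0
  col_le : ∀ j < n, s.nat 7 j 0 ≤ s.nat 8 0 0
  source : ∀ i < n, s.nat 4 i 0 < k → 0 < s.nat 6 i 0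
  -- Every new stamp marks a new row or column. Stamps are therefore at most `2n + 1`, which bounds
  -- the length of a walk.
  count : s.nat 8 0 0 ≤ markedCount n s + 1

theorem wp_resetMarks {N n k : ℕ} {s : Store} (hn : s.nat 0 0 0 = n) (hk : s.nat 1 0 0 = k)
    (hN : n ≤ N) : wp N resetMarks (fun s' => Stamped n k s') s := by
  refine wp_seq (wp_forLoop (fun i s' => ∀ i' < i, (s'.nat 6 i' 0 =
    if s.nat 4 i' 0 < k then 1 else 0) ∧ s'.nat 7 i' 0 = 0) rfl rfl (by decide) (by omega)
    (by simp) ?_ ?_)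
  · intro i s' hi hF hv hI
    have h1 : s'.nat 1 = s.nat 1 := hF.nat 1 rfl
    have h4 : s'.nat 4 = s.nat 4 := hF.nat 4 rfl
    refine wp_seq (wp_ite (fun hb => wp_setNat (wp_setNat ?_)) (fun hb => wp_setNat (wp_setNat ?_)))
      <;> simp [h1, h4, hk, hv] at hb ⊢ <;> intro i' hi'
    · rcases Nat.lt_or_eq_of_le hi' with h' | rfl
      · simpa [h'.ne] using hI i' h'
      · simp [hb]
    · rcases Nat.lt_or_eq_of_le hi' with h' | rfl
      · simpa [h'.ne] using hI i' h'
      · simpa using hb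
  · intro s' hF hI
    rw [hn] at hI
    have h4 : s'.nat 4 = s.nat 4 := hF.nat 4 rfl
    refine wp_setNat ⟨⟨?_, ?_⟩, ?_, ?_, ?_, ?_⟩ <;> simp
    · intro i hi h1 h2 h3
      rw [(hI i hi).1] at h1
      rw [h4] at h3
      split_ifs at h1
      · omega
      · omega
    · intro j hj h1
      have := (hI j hj).2
      omega
    · intro i hi
      rw [(hI i hi).1]
      split_ifs <;> simp
    · intro i hi
      rw [(hI i hi).2]
      simp
    · intro i hi h1
      rw [h4] at h1
      rw [(hI i hi).1, if_pos h1]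
      simp

/-- Change the potentials of the marked rows and columns. -/
def shiftPotentials : Program :=
  forLoop 12 0
    (.ite (.lt (.const 0) (entry 6 (scalar 12)))
      (.setReal 1 (scalar 12) (.const 0)
        (.sub (.get 1 (scalar 12) (.const 0)) (.get 3 (.const 0) (.const 0)))) .skip ;;
    .ite (.lt (.const 0) (entry 7 (scalar 12)))
      (.setReal 2 (scalar 12) (.const 0)
        (.add (.get 2 (scalar 12) (.const 0)) (.get 3 (.const 0) (.const 0)))) .skip)

theorem wp_shiftPotentials {N n : ℕ} {s : Store} (hn : s.nat 0 0 0 = n) (hN : n ≤ N) :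
    wp N shiftPotentials (fun s' =>
      (∀ i < n, s'.real 1 i 0 =
        if 0 < s.nat 6 i 0 then s.real 1 i 0 - s.real 3 0 0 else s.real 1 i 0) ∧
      (∀ j < n, s'.real 2 j 0 =
        if 0 < s.nat 7 j 0 then s.real 2 j 0 + s.real 3 0 0 else s.real 2 j 0)) s := by
  refine wp_forLoop (fun i s' => ∀ i', (s'.real 1 i' 0 =
    if i' < i ∧ 0 < s.nat 6 i' 0 then s.real 1 i' 0 - s.real 3 0 0 else s.real 1 i' 0) ∧
    (s'.real 2 i' 0 =
      if i' < i ∧ 0 < s.nat 7 i' 0 then s.real 2 i' 0 + s.real 3 0 0 else s.real 2 i' 0))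
    rfl rfl (by decide) (by omega) (by simp) ?_ ?_
  · intro i s' hi hF hv hI
    have h6 : s'.nat 6 = s.nat 6 := hF.nat 6 rfl
    have h7 : s'.nat 7 = s.nat 7 := hF.nat 7 rfl
    have h3 : s'.real 3 = s.real 3 := hF.real 3 rfl
    refine wp_seq (wp_ite (fun hb => wp_setReal (wp_ite (fun hb' => wp_setReal ?_)
      (fun hb' => wp_skip ?_))) (fun hb => wp_skip (wp_ite (fun hb' => wp_setReal ?_)
      (fun hb' => wp_skip ?_)))) <;> simp [h6, h7, h3, hv] at hb hb' ⊢ <;> intro i' <;>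
      (by_cases h' : i' = i
       · subst h'
         simp [(hI i').1, (hI i').2, hb, hb']
       · simp [h', (hI i').1, (hI i').2, show i' ≤ i ↔ i' < i by omega])
  · intro s' hF hI
    rw [hn] at hI
    refine ⟨fun i hi => ?_, fun j hj => ?_⟩
    · simpa [hi] using (hI i).1
    · simpa [hj] using (hI j).2

def slackRow (i j : NatExp) : RealExp :=
  .sub (.add (.get 1 i (.const 0)) (.get 2 j (.const 0))) (.get 0 i j)

def slackCol (i j : NatExp) : RealExp :=
  .sub (.get 0 i j) (.add (.get 1 i (.const 0)) (.get 2 j (.const 0)))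

def crossRow (i j : NatExp) : Test :=
  .ne i j ∧ₜ .lt (.const 0) (entry 6 i) ∧ₜ .eq (entry 7 j) (.const 0) ∧ₜ
    .eq (.get 2 i j) (.const 0)

def crossCol (i j : NatExp) : Test :=
  .eq (entry 6 i) (.const 0) ∧ₜ .lt (.const 0) (entry 7 j) ∧ₜ .eq (.get 2 i j) (.const 1)

/-- The entry `(bvar 0, bvar 1)` satisfies `cross`, and its slack is minimal. -/
def minCross (cross : NatExp → NatExp → Test) (slack : NatExp → NatExp → RealExp) : Fml :=
  .ex 0 (.ex 0 (.and (.atom (cross (bvar 0) (bvar 1))) (.all 0 (.all 0 (.atom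
    ((crossRow (bvar 2) (bvar 3)).imp
        (.realLe (slack (bvar 0) (bvar 1)) (slackRow (bvar 2) (bvar 3))) ∧ₜ
      (crossCol (bvar 2) (bvar 3)).imp
        (.realLe (slack (bvar 0) (bvar 1)) (slackCol (bvar 2) (bvar 3)))))))))

/-- Change the potentials such that one more row or column can be marked, and mark it. -/
def growStep : Program :=
  branch (minCross crossRow slackRow)
    (.setReal 3 (.const 0) (.const 0) (slackRow (bvar 0) (bvar 1)) ;;
      assign 9 (bvar 1) ;; shiftPotentials ;; assign 8 (.add (scalar 8) (.const 1)) ;;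
      .setNat 7 (scalar 9) (.const 0) (scalar 8))
    (branch (minCross crossCol slackCol)
      (.setReal 3 (.const 0) (.const 0) (slackCol (bvar 0) (bvar 1)) ;;
        assign 13 (bvar 0) ;; shiftPotentials ;; assign 8 (.add (scalar 8) (.const 1)) ;;
        .setNat 6 (scalar 13) (.const 0) (scalar 8))
      .skip)

theorem card_filter_mark {n j v : ℕ} (f : ℕ → ℕ) (hj : j < n) (hf : f j = 0) (hv : 0 < v) :
    ((Finset.range n).filter fun x => 0 < (if x = j then v else f x)).card =
      ((Finset.range n).filter fun x => 0 < f x).card + 1 := by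
  rw [← Finset.card_insert_of_notMem (a := j) (by simp [hf])]
  congr 1
  ext x
  simp only [Finset.mem_filter, Finset.mem_range, Finset.mem_insert]
  split_ifs with h
  · simp [h, hj, hv]
  · simp [h]

/-- The least slack is taken over both kinds of crossing entries together, and an entry of one of
the kinds attains it. The program looks for the two kinds separately but compares with both. -/
theorem exists_minimal_cross {n : ℕ} {C D : ℕ → ℕ → Prop} {f g : ℕ → ℕ → ℝ}
    (h : ∃ i < n, ∃ j < n, C i j ∨ D i j) :
    (∃ i < n, ∃ j < n, C i j ∧ ∀ i' < n, ∀ j' < n, (C i' j' → f i j ≤ f i' j') ∧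
      (D i' j' → f i j ≤ g i' j')) ∨
    (∃ i < n, ∃ j < n, D i j ∧ ∀ i' < n, ∀ j' < n, (C i' j' → g i j ≤ f i' j') ∧
      (D i' j' → g i j ≤ g i' j')) := by
  classical
  let T : Finset (ℕ × ℕ × Bool) :=
    (Finset.range n ×ˢ Finset.range n ×ˢ Finset.univ).filter fun e =>
      if e.2.2 then C e.1 e.2.1 else D e.1 e.2.1
  have hT : T.Nonempty := by
    obtain ⟨i, hi, j, hj, h | h⟩ := h
    · exact ⟨(i, j, true), by simp [T, hi, hj, h]⟩
    · exact ⟨(i, j, false), by simp [T, hi, hj, h]⟩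
  obtain ⟨⟨i, j, x⟩, hx, hmin⟩ := T.exists_min_image
    (fun e => if e.2.2 then f e.1 e.2.1 else g e.1 e.2.1) hT
  have h1 : ∀ i' < n, ∀ j' < n, C i' j' → (if x then f i j else g i j) ≤ f i' j' :=
    fun i' hi' j' hj' h => by simpa using hmin (i', j', true) (by simp [T, hi', hj', h])
  have h2 : ∀ i' < n, ∀ j' < n, D i' j' → (if x then f i j else g i j) ≤ g i' j' :=
    fun i' hi' j' hj' h => by simpa using hmin (i', j', false) (by simp [T, hi', hj', h])
  cases x
  · right
    simp [T] at hx h1 h2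
    exact ⟨i, hx.1.1, j, hx.1.2, hx.2, fun i' hi' j' hj' => ⟨h1 i' hi' j' hj', h2 i' hi' j' hj'⟩⟩
  · left
    simp [T] at hx h1 h2
    exact ⟨i, hx.1.1, j, hx.1.2, hx.2, fun i' hi' j' hj' => ⟨h1 i' hi' j' hj', h2 i' hi' j' hj'⟩⟩

/-- Changing the potentials by the least slack keeps the certificate and makes the chosen crossing
entry tight, so its unmarked end can be marked. `LoadMatrix.exists_cross` excludes the case that
neither search succeeds. -/
theorem wp_growStep {N n k : ℕ} {s : Store} (hN : n < N) (hkn : k < n) (h : Loads n k s)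
    (hs : Stamped n k s) (hex : ∃ i < n, s.nat 4 i 0 < k)
    (hfull : ∀ j < n, 0 < s.nat 7 j 0 → k ≤ s.nat 5 j 0) :
    wp N growStep (fun s' => Loads n k s' ∧ Stamped n k s' ∧ matrixSum n s' = matrixSum n s ∧
      markedCount n s' = markedCount n s + 1) s := by
  have hn := h.size
  refine wp_branch rfl (by simp [minCross, hn, hN]) (fun s₁ hag hw => ?_) (fun s₁ hag hw => ?_)
  · simp [minCross, crossRow, crossCol, slackRow, slackCol, hag.nat, hag.real, hn] at hw
    obtain ⟨hi, hj, ⟨hne, hA, hB, hM⟩, hmin⟩ := hw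
    refine wp_seq (wp_setReal (wp_seq (wp_setNat (wp_seq ?_))))
    simp [slackRow, hag.real]
    set i := s₁.nat 100 0 0
    set j := s₁.nat 100 1 0
    set δ := s.real 1 i 0 + s.real 2 j 0 - s.real 0 i j with hδ
    have hδ0 : 0 ≤ δ := by linarith [h.matrix.le_of_zero i hi j hj hne hM]
    refine (wp_shiftPotentials (n := n) (by simp [hag.nat, hn]) hN.le).mono fun s₂ hF hp =>
      wp_seq (wp_setNat (wp_setNat ?_))
    have hnat : ∀ a, a ≠ 9 → a ≠ 12 → a ≠ 100 → a ≠ 101 → s₂.nat a = s.nat a := by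
      intro a h9 h12 h100 h101
      rw [hF.nat a (by simp [shiftPotentials, forLoop, Program.writesNat, h12])]
      simp [h9, hag.nat a h100 h101]
    have h9 : s₂.nat 9 0 0 = j := by
      rw [hF.nat 9 rfl]
      simp
    have hr0 : s₂.real 0 = s.real 0 := by
      rw [hF.real 0 rfl]
      simp [hag.real]
    simp [hag.nat, hag.real] at hp
    have hm := (h.matrix.shift hδ0 (fun i' j' hc => by
      linarith [(hmin i' hc.1 j' hc.2.1).1 hc.2.2.1 hc.2.2.2.1 hc.2.2.2.2.1 hc.2.2.2.2.2])
      (fun i' j' hc => by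
      linarith [(hmin i' hc.1 j' hc.2.1).2 hc.2.2.1 hc.2.2.2.1 hc.2.2.2.2])).congr hp.1 hp.2
    have hst := ((hs.stamps.shift δ).congr_potentials hp.1 hp.2).mark_col hs.row_le hs.col_le
      (i := i) (j := j) ⟨hi, hj, hne, hA, hB, hM⟩
      (by rw [hp.1 i hi, hp.2 j hj, if_pos hA, if_neg (by omega), hδ]; ring)
    have hcnt := card_filter_mark (fun j => s.nat 7 j 0) (v := s.nat 8 0 0 + 1) hj hB (by omega)
    refine ⟨⟨?_, ?_, ?_, ?_, ?_⟩, ⟨?_, ?_, ?_, ?_, ?_⟩, ?_, ?_⟩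
    · simp [hnat, hn]
    · simp [hnat, h.load]
    · simpa [hnat, hr0] using hm
    · simpa [hnat] using h.row_le
    · simpa [hnat] using h.col_le
    · simpa [StampsUpTo, hnat, hr0, h9] using hst
    · simp [hnat]
      exact fun i hi => (hs.row_le i hi).trans (by omega)
    · simp [hnat, h9]
      intro j' hj'
      have := hs.col_le j' hj'
      split_ifs <;> omega
    · simpa [hnat] using hs.source
    · have := hs.count
      simp only [markedCount] at this ⊢
      simp [hnat, h9, hcnt]
      omega
    · simp [matrixSum, hnat]
    · simp [markedCount, hnat, h9, hcnt]
      omega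
  · have hno : ¬ ∃ i < n, ∃ j < n, (i ≠ j ∧ 0 < s.nat 6 i 0 ∧ s.nat 7 j 0 = 0 ∧ s.nat 2 i j = 0) ∧
        ∀ i' < n, ∀ j' < n, ((i' ≠ j' ∧ 0 < s.nat 6 i' 0 ∧ s.nat 7 j' 0 = 0 ∧ s.nat 2 i' j' = 0) →
          s.real 1 i 0 + s.real 2 j 0 - s.real 0 i j ≤
            s.real 1 i' 0 + s.real 2 j' 0 - s.real 0 i' j') ∧
          ((s.nat 6 i' 0 = 0 ∧ 0 < s.nat 7 j' 0 ∧ s.nat 2 i' j' = 1) →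
          s.real 1 i 0 + s.real 2 j 0 - s.real 0 i j ≤
            s.real 0 i' j' - (s.real 1 i' 0 + s.real 2 j' 0)) := by
      simpa [minCross, crossRow, crossCol, slackRow, slackCol, hn] using hw
    obtain ⟨i₀, j₀, hc⟩ := h.matrix.exists_cross hkn h.row_le hs.source hex hfull
    have hmin := (exists_minimal_cross (n := n)
      (C := fun i j => i ≠ j ∧ 0 < s.nat 6 i 0 ∧ s.nat 7 j 0 = 0 ∧ s.nat 2 i j = 0)
      (D := fun i j => s.nat 6 i 0 = 0 ∧ 0 < s.nat 7 j 0 ∧ s.nat 2 i j = 1)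
      (f := fun i j => s.real 1 i 0 + s.real 2 j 0 - s.real 0 i j)
      (g := fun i j => s.real 0 i j - (s.real 1 i 0 + s.real 2 j 0)) (by
        rcases hc with hc | hc
        · exact ⟨i₀, hc.1, j₀, hc.2.1, .inl hc.2.2⟩
        · exact ⟨i₀, hc.1, j₀, hc.2.1, .inr hc.2.2⟩)).resolve_left hno
    refine wp_branch rfl (by simp [minCross, hag.nat, hn, hN]) (fun s₂ hag₂ hw => ?_)
      (fun s₂ hag₂ hw => ?_)
    swap
    · refine absurd ?_ hw
      simpa [minCross, crossRow, crossCol, slackRow, slackCol, hn, hag.nat, hag.real] using hmin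
    clear hmin
    have hag := hag.trans hag₂
    simp [minCross, crossRow, crossCol, slackRow, slackCol, hag.nat, hag.real, hn] at hw
    obtain ⟨hi, hj, ⟨hA, hB, hM⟩, hmin⟩ := hw
    refine wp_seq (wp_setReal (wp_seq (wp_setNat (wp_seq ?_))))
    simp [slackCol, hag.real]
    set i := s₂.nat 100 0 0
    set j := s₂.nat 100 1 0
    set δ := s.real 0 i j - (s.real 1 i 0 + s.real 2 j 0) with hδ
    have hδ0 : 0 ≤ δ := by linarith [h.matrix.le_of_one i hi j hj hM]
    refine (wp_shiftPotentials (n := n) (by simp [hag.nat, hn]) hN.le).mono fun s₃ hF hp =>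
      wp_seq (wp_setNat (wp_setNat ?_))
    have hnat : ∀ a, a ≠ 13 → a ≠ 12 → a ≠ 100 → a ≠ 101 → s₃.nat a = s.nat a := by
      intro a h13 h12 h100 h101
      rw [hF.nat a (by simp [shiftPotentials, forLoop, Program.writesNat, h12])]
      simp [h13, hag.nat a h100 h101]
    have h13 : s₃.nat 13 0 0 = i := by
      rw [hF.nat 13 rfl]
      simp
    have hr0 : s₃.real 0 = s.real 0 := by
      rw [hF.real 0 rfl]
      simp [hag.real]
    simp [hag.nat, hag.real] at hp
    have hm := (h.matrix.shift hδ0 (fun i' j' hc => by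
      linarith [(hmin i' hc.1 j' hc.2.1).1 hc.2.2.1 hc.2.2.2.1 hc.2.2.2.2.1 hc.2.2.2.2.2])
      (fun i' j' hc => by
      linarith [(hmin i' hc.1 j' hc.2.1).2 hc.2.2.1 hc.2.2.2.1 hc.2.2.2.2])).congr hp.1 hp.2
    have hst := ((hs.stamps.shift δ).congr_potentials hp.1 hp.2).mark_row hs.row_le hs.col_le
      (i := i) (j := j) ⟨hi, hj, hA, hB, hM⟩
      (by rw [hp.1 i hi, hp.2 j hj, if_neg (by omega), if_pos hB, hδ]; ring)
    have hcnt := card_filter_mark (fun i => s.nat 6 i 0) (v := s.nat 8 0 0 + 1) hi hA (by omega)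
    refine ⟨⟨?_, ?_, ?_, ?_, ?_⟩, ⟨?_, ?_, ?_, ?_, ?_⟩, ?_, ?_⟩
    · simp [hnat, hn]
    · simp [hnat, h.load]
    · simpa [hnat, hr0] using hm
    · simpa [hnat] using h.row_le
    · simpa [hnat] using h.col_le
    · simpa [StampsUpTo, hnat, hr0, h13] using hst
    · simp [hnat, h13]
      intro i' hi'
      have := hs.row_le i' hi'
      split_ifs <;> omega
    · simp [hnat]
      exact fun i hi => (hs.col_le i hi).trans (by omega)
    · simp [hnat, h13]
      intro i' hi' h'
      have := hs.source i' hi' h'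
      split_ifs <;> omega
    · have := hs.count
      simp only [markedCount] at this ⊢
      simp [hnat, h13, hcnt]
      omega
    · simp [matrixSum, hnat]
    · simp [markedCount, hnat, h13, hcnt]
      omega

def hasOpenRow : Fml := .ex 0 (.atom (.lt (entry 4 (bvar 0)) (scalar 1)))

def hasOpenCol : Fml :=
  .ex 0 (.atom (.lt (.const 0) (entry 7 (bvar 0)) ∧ₜ .lt (entry 5 (bvar 0)) (scalar 1)))

/-- Increase the number of ones, or mark one more row or column. -/
def matchStep : Program :=
  branch hasOpenRow
    (branch hasOpenCol (assign 9 (bvar 0) ;; walk ;; resetMarks) growStep)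
    (assign 11 (.const 0))

theorem matrixSum_le {n k : ℕ} {s : Store} (h : Loads n k s) : matrixSum n s ≤ n * k := by
  have := Finset.sum_le_card_nsmul (Finset.range n) (fun i => s.nat 4 i 0) k
    fun i hi => h.row_le i (Finset.mem_range.1 hi)
  simpa [matrixSum] using this

/-- A marked column with room is the end of an augmenting path. If some row sum is still less than
`k` but no marked column has room, the hypotheses of `wp_growStep` are met. -/
theorem wp_matchStep {N n k : ℕ} {s : Store} (hN : 2 * n < N) (hkn : k < n) (h : Loads n k s)
    (hs : Stamped n k s) :
    wp N matchStep (fun s' => Loads n k s' ∧ Stamped n k s' ∧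
      ((s'.nat 11 = s.nat 11 ∧ matrixSum n s' = matrixSum n s ∧
          markedCount n s' = markedCount n s + 1) ∨
        (s'.nat 11 = s.nat 11 ∧ matrixSum n s' = matrixSum n s + 1) ∨
        (s'.nat 11 0 0 = 0 ∧ matrixSum n s' = matrixSum n s ∧
          markedCount n s' = markedCount n s ∧ ∀ i < n, s'.nat 4 i 0 = k))) s := by
  have hn := h.size
  have hk := h.load
  have trans : ∀ s₁, Agree 0 s s₁ → Loads n k s₁ ∧ Stamped n k s₁ := by
    intro s₁ hag
    refine ⟨⟨?_, ?_, ?_, ?_, ?_⟩, ⟨?_, ?_, ?_, ?_, ?_⟩⟩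
    · simp [hag.nat, hn]
    · simp [hag.nat, hk]
    · simpa [hag.nat, hag.real] using h.matrix
    · simpa [hag.nat] using h.row_le
    · simpa [hag.nat] using h.col_le
    · simpa [StampsUpTo, hag.nat, hag.real] using hs.stamps
    · simpa [hag.nat] using hs.row_le
    · simpa [hag.nat] using hs.col_le
    · simpa [hag.nat] using hs.source
    · simpa [hag.nat, markedCount] using hs.count
  refine wp_branch rfl (by simp [hasOpenRow, hn]; omega) (fun s₁ hag hw => ?_)
    (fun s₁ hag hw => ?_)
  · simp [hasOpenRow, hag.nat, hn, hk] at hw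
    obtain ⟨h₁, hs₁⟩ := trans s₁ hag
    refine wp_branch rfl (by simp [hasOpenCol, hag.nat, hn]; omega) (fun s₂ hag₂ hw₂ => ?_)
      (fun s₂ hag₂ hw₂ => ?_)
    · have hag₂ := hag.trans hag₂
      obtain ⟨h₂, hs₂⟩ := trans s₂ hag₂
      simp [hasOpenCol, hag₂.nat, hn, hk] at hw₂
      refine wp_seq (wp_setNat (wp_seq ?_))
      have hcol := hs₂.col_le _ hw₂.1
      have hwalk : Walking n k (s₂.setNat 9 0 0 (s₂.nat 100 0 0)) := by
        refine ⟨⟨?_, ?_, ?_, ?_, ?_⟩, ?_, ?_, ?_, ?_⟩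
        · simpa using h₂.size
        · simpa using h₂.load
        · simpa using h₂.matrix
        · simpa using h₂.row_le
        · simpa using h₂.col_le
        · simpa using hw₂.1
        · simpa [hag₂.nat] using hw₂.2.2
        · simpa [hag₂.nat] using hw₂.2.1
        · have : Marked n k _ _ _ _ _ _ _ _ := hs₂.stamps.congr (b' := s₂.nat 7 (s₂.nat 100 0 0) 0)
            (by omega) (fun _ _ _ => le_rfl) (fun _ _ _ _ _ _ => rfl)
          simpa [StampsUpTo] using this
      refine (wp_walk (by omega) hwalk ?_).mono fun s₃ hF₃ h₃ => ?_
      · have := hs₂.count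
        have := markedCount_le n s₂
        simp
        omega
      refine (wp_resetMarks h₃.1.size h₃.1.load (by omega)).mono fun s₄ hF₄ h₄ => ?_
      have e0 : s₄.nat 0 = s₃.nat 0 := hF₄.nat 0 rfl
      have e1 : s₄.nat 1 = s₃.nat 1 := hF₄.nat 1 rfl
      have e2 : s₄.nat 2 = s₃.nat 2 := hF₄.nat 2 rfl
      have e4 : s₄.nat 4 = s₃.nat 4 := hF₄.nat 4 rfl
      have e5 : s₄.nat 5 = s₃.nat 5 := hF₄.nat 5 rfl
      have er : s₄.real = s₃.real := funext fun a => hF₄.real a rfl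
      refine ⟨⟨?_, ?_, ?_, ?_, ?_⟩, h₄, .inr (.inl ⟨?_, ?_⟩)⟩
      · rw [e0, h₃.1.size]
      · rw [e1, h₃.1.load]
      · rw [e2, e4, e5, er]
        exact h₃.1.matrix
      · rw [e4]
        exact h₃.1.row_le
      · rw [e5]
        exact h₃.1.col_le
      · rw [hF₄.nat 11 rfl, hF₃.nat 11 rfl]
        simp [hag₂.nat]
      · have := h₃.2
        simp only [matrixSum, e4] at this ⊢
        rw [this]
        simp [hag₂.nat]
    · have hag₂ := hag.trans hag₂
      obtain ⟨h₂, hs₂⟩ := trans s₂ hag₂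
      refine (wp_growStep (by omega) hkn h₂ hs₂ ⟨_, hw.1, by simpa [hag₂.nat] using hw.2⟩ ?_).mono
        fun s₃ hF h₃ => ⟨h₃.1, h₃.2.1, .inl ⟨?_, ?_, ?_⟩⟩
      · simpa [hasOpenCol, hag.nat, hag₂.nat, hn, hk] using hw₂
      · rw [hF.nat 11 rfl, hag₂.nat 11 (by decide) (by decide)]
      · rw [h₃.2.2.1]
        simp [matrixSum, hag₂.nat]
      · rw [h₃.2.2.2]
        simp [markedCount, hag₂.nat]
  · obtain ⟨h₁, hs₁⟩ := trans s₁ hag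
    simp [hasOpenRow, hn, hk] at hw
    refine wp_setNat ⟨⟨?_, ?_, ?_, ?_, ?_⟩, ⟨?_, ?_, ?_, ?_, ?_⟩, .inr (.inr ⟨?_, ?_, ?_, ?_⟩)⟩
    · simpa using h₁.size
    · simpa using h₁.load
    · simpa using h₁.matrix
    · simpa using h₁.row_le
    · simpa using h₁.col_le
    · simpa [StampsUpTo] using hs₁.stamps
    · simpa using hs₁.row_le
    · simpa using hs₁.col_le
    · simpa using hs₁.source
    · simpa [markedCount] using hs₁.count
    · simp
    · simp [matrixSum, hag.nat]
    · simp [markedCount, hag.nat]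
    · intro i hi
      simp [hag.nat]
      exact le_antisymm (h.row_le i hi) (hw i hi)

def maxEntry : Fml := .ex 0 (.ex 0 (.all 0 (.all 0 (.atom
  (.realLe (.get 0 (bvar 2) (bvar 3)) (.get 0 (bvar 0) (bvar 1)))))))

/-- Start with the zero matrix and a constant potential. -/
def matchInit : Program :=
  branch maxEntry (.setReal 3 (.const 0) (.const 0) (.get 0 (bvar 0) (bvar 1))) .skip ;;
  forLoop 12 0 (.setReal 1 (scalar 12) (.const 0) (.get 3 (.const 0) (.const 0))) ;;
  resetMarks

/-- The memory contains the input and nothing else. -/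
structure InitialStore (n k : ℕ) (s : Store) : Prop where
  size : s.nat 0 0 0 = n
  load : s.nat 1 0 0 = k
  nat : ∀ a, a ≠ 0 → a ≠ 1 → ∀ i j, s.nat a i j = 0
  real : ∀ a, a ≠ 0 → ∀ i j, s.real a i j = 0

theorem wp_matchInit {N n k : ℕ} {s : Store} (hN : n < N) (hn0 : 0 < n) (h : InitialStore n k s) :
    wp N matchInit (fun s' => Loads n k s' ∧ Stamped n k s') s := by
  have hn := h.size
  refine wp_seq (wp_branch rfl (by simp [maxEntry, hn, hN]) (fun s₁ hag hw => ?_)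
    (fun s₁ hag hw => ?_))
  swap
  · exfalso
    obtain ⟨e, he, hmax⟩ := (Finset.range n ×ˢ Finset.range n).exists_max_image
      (fun e => s.real 0 e.1 e.2) ⟨(0, 0), by simp [hn0]⟩
    simp at he
    refine hw ?_
    simp [maxEntry, hn]
    exact ⟨e.1, he.1, e.2, he.2, fun i hi j hj => hmax (i, j) (by simp [hi, hj])⟩
  simp [maxEntry, hag.nat, hag.real, hn] at hw
  refine wp_setReal ?_
  simp [hag.real]
  set δ := s.real 0 (s₁.nat 100 0 0) (s₁.nat 100 1 0)
  refine wp_seq (wp_forLoop (fun i s' => ∀ i' < i, s'.real 1 i' 0 = δ) rfl rfl (by decide)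
    (by simp [hag.nat, hn, hN.le]) (by simp) ?_ ?_)
  · intro i s' hi hF hv hI
    refine wp_setReal ?_
    have h3 : s'.real 3 0 0 = δ := by
      rw [hF.real 3 rfl]
      simp
    simp [h3, hv]
    exact fun i' hi' h' => hI i' (by omega)
  · intro s₂ hF hI
    simp [hag.nat, hn] at hI
    have hnat : ∀ a, a ≠ 12 → a ≠ 100 → a ≠ 101 → s₂.nat a = s.nat a := by
      intro a h12 h100 h101
      rw [hF.nat a (by simp [forLoop, Program.writesNat, h12])]
      simp [hag.nat a h100 h101]
    have h0 : ∀ a, a ≠ 0 → a ≠ 1 → a ≠ 12 → a ≠ 100 → a ≠ 101 → ∀ i j, s₂.nat a i j = 0 := by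
      intro a h0 h1 h12 h100 h101 i j
      rw [hnat a h12 h100 h101, h.nat a h0 h1]
    have hr0 : s₂.real 0 = s.real 0 := by
      rw [hF.real 0 rfl]
      simp [hag.real]
    have hr2 : ∀ i j, s₂.real 2 i j = 0 := by
      intro i j
      rw [hF.real 2 rfl]
      simp [hag.real, h.real]
    refine (wp_resetMarks (n := n) (k := k) (by simp [hnat, hn]) (by simp [hnat, h.load])
      hN.le).mono fun s₃ hF₃ h₃ => ⟨⟨?_, ?_, ?_, ?_, ?_⟩, h₃⟩
    · rw [hF₃.nat 0 rfl]
      simp [hnat, hn]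
    · rw [hF₃.nat 1 rfl]
      simp [hnat, h.load]
    · rw [hF₃.nat 2 rfl, hF₃.nat 4 rfl, hF₃.nat 5 rfl, hF₃.real 0 rfl, hF₃.real 1 rfl,
        hF₃.real 2 rfl]
      refine ⟨?_, ?_, ?_, ?_, ?_, ?_⟩
      · simp [h0]
      · simp [h0]
      · simp [h0]
      · simp [h0]
      · simp [h0]
      -- The row potentials are all equal to the largest entry of `S` and the column potentials are
      -- zero, which bounds every entry.
      · intro i hi j hj _ _
        rw [hI i hi, hr2, hr0]
        simpa using hw.2.2 i hi j hj
    · rw [hF₃.nat 4 rfl]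
      simp [h0]
    · rw [hF₃.nat 5 rfl]
      simp [h0]

/-- The program for the maximum-similarity assignment. -/
def matchProgram : Program :=
  matchInit ;; assign 11 (.const 1) ;; .while (.lt (.const 0) (scalar 11)) matchStep

theorem wp_matchProgram {N n k : ℕ} {s : Store} (hN : (n * k + 1) * (2 * n + 2) ≤ N)
    (hkn : k < n) (h : InitialStore n k s) :
    wp N matchProgram (fun s' => Loads n k s' ∧ ∀ i < n, s'.nat 4 i 0 = k) s := by
  have hN' : 2 * n + 2 ≤ N := (Nat.le_mul_of_pos_left _ (Nat.succ_pos _)).trans hN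
  refine wp_seq ((wp_matchInit (by omega) (by omega) h).mono fun s₁ hF h₁ => ?_)
  refine wp_seq (wp_setNat ?_)
  refine wp_while (fun s' => Loads n k s' ∧ Stamped n k s' ∧ s'.nat 11 0 0 ≤ 1 ∧
      (s'.nat 11 0 0 = 0 → ∀ i < n, s'.nat 4 i 0 = k))
    -- An augmentation may erase all marks, at most `2n` of them; the weight `2n + 2` of a one in
    -- the matrix outweighs this.
    (fun s' => (n * k - matrixSum n s') * (2 * n + 2) + (2 * n - markedCount n s') +
      s'.nat 11 0 0) ?_ ?_ ?_ ?_
  · obtain ⟨h₂, hs₂⟩ := h₁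
    refine ⟨⟨?_, ?_, ?_, ?_, ?_⟩, ⟨?_, ?_, ?_, ?_, ?_⟩, ?_, ?_⟩
    · simpa using h₂.size
    · simpa using h₂.load
    · simpa using h₂.matrix
    · simpa using h₂.row_le
    · simpa using h₂.col_le
    · simpa [StampsUpTo] using hs₂.stamps
    · simpa using hs₂.row_le
    · simpa using hs₂.col_le
    · simpa using hs₂.source
    · simpa [markedCount] using hs₂.count
    · simp
    · simp
  · have : (n * k - matrixSum n (s₁.setNat 11 0 0 1)) * (2 * n + 2) ≤ n * k * (2 * n + 2) :=
      Nat.mul_le_mul_right _ (Nat.sub_le _ _)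
    simp only [NatExp.val] at this ⊢
    simp
    rw [Nat.add_mul] at hN
    omega
  · rintro s' - ⟨h', hs', h11, -⟩ hb
    simp at hb
    refine (wp_matchStep (by omega) hkn h' hs').mono fun s'' _ h'' => ⟨⟨h''.1, h''.2.1, ?_⟩, ?_⟩
    · rcases h''.2.2 with ⟨h1, h2, h3⟩ | ⟨h1, h2⟩ | ⟨h1, h2, h3, h4⟩
      · rw [h1]
        exact ⟨h11, fun h => by omega⟩
      · rw [h1]
        exact ⟨h11, fun h => by omega⟩
      · exact ⟨by omega, fun _ => h4⟩
    · rcases h''.2.2 with ⟨h1, h2, h3⟩ | ⟨h1, h2⟩ | ⟨h1, h2, h3, h4⟩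
      · rw [h1, h2]
        have := markedCount_le n s''
        omega
      · have := matrixSum_le h''.1
        rw [h1, h2]
        obtain ⟨x, hx⟩ : ∃ x, n * k = matrixSum n s' + 1 + x := ⟨n * k - (matrixSum n s' + 1),
          by omega⟩
        rw [hx, show matrixSum n s' + 1 + x - (matrixSum n s' + 1) = x by omega,
          show matrixSum n s' + 1 + x - matrixSum n s' = x + 1 by omega, Nat.add_mul x 1]
        omega
      · rw [h1, h2, h3]
        omega
  · rintro s' - ⟨h', hs', h11, hk⟩ hb
    simp at hb
    exact ⟨h', hk hb⟩

end PeerAssessment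

namespace PeerAssessment

/-! ### Inserting a vertex into an equitable coloring -/

section Coloring

variable {α κ : Type*} (V : Finset α) (E : α → α → Prop) (col : α → κ)

/-- The vertex `u` is not yet inserted: no neighbor of `v` other than `u` has the color `X`. -/
def Movable (u v : α) (X : κ) : Prop := ∀ w, E v w → col w = X → w = u

/-- The color class `X` reaches the color class `h` by a sequence of color classes in `D` such that
each contains a vertex that is movable to the next one. -/
inductive Reaches (u : α) (D : Finset κ) (h : κ) : κ → Prop
  | base : h ∈ D → Reaches u D h h
  | step {x : α} {Z : κ} : col x ∈ D → x ∈ V → Movable E col u x Z → Reaches u D h Z →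
      Reaches u D h (col x)

/-- The only neighbor of `y` in the color class of `z` is `z`. -/
def Solo (u z y : α) : Prop := E z y ∧ ∀ w, E y w → col w = col z → w ≠ u → w = z

open Classical in
/-- A coloring with classes of size `s` for the colors in `C`, which is proper except for the edges
at `u`, in a graph in which every vertex has less than `#C` neighbors with a color in `C`. -/
structure Pending (s : ℕ) (u : α) (C : Finset κ) : Prop where
  symm : ∀ v w, E v w → E w v
  irrefl : ∀ v, ¬ E v v
  mem : ∀ v w, E v w → v ∈ V
  mem_u : u ∈ V
  size : ∀ X ∈ C, (V.filter fun v => col v = X).card = s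
  hole : col u ∈ C
  proper : ∀ v w, E v w → v ≠ u → w ≠ u → col v ≠ col w
  degree : ∀ v ∈ V, col v ∈ C → (V.filter fun w => E v w ∧ col w ∈ C).card < C.card

variable {V E col} {s : ℕ} {u : α} {C D : Finset κ} {h : κ}

theorem Reaches.mem {X : κ} (hX : Reaches V E col u D h X) : X ∈ D := by
  cases hX <;> assumption

theorem Reaches.hole_mem {X : κ} (hX : Reaches V E col u D h X) : h ∈ D := by
  induction hX with
  | base h => exact h
  | step _ _ _ _ ih => exact ih

theorem Reaches.mono {D' : Finset κ} {X : κ} (hX : Reaches V E col u D h X)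
    (hD : ∀ Y, Reaches V E col u D h Y → Y ∈ D') : Reaches V E col u D' h X := by
  induction hX with
  | base hm => exact .base (hD _ (.base hm))
  | step h1 h2 h3 h4 ih => exact .step (hD _ (.step h1 h2 h3 h4)) h2 h3 ih

/-- The constructor prolongs a path at its start; here a step is appended at its end. -/
theorem Reaches.extend {X Z : κ} {x : α} (hX : Reaches V E col u D (col x) X) (hx : x ∈ V)
    (hm : Movable E col u x Z) (hZ : Z ∈ D) : Reaches V E col u D Z X := by
  generalize hY : col x = Y at hX
  induction hX with
  | base hm' => subst hY; exact .step hm' hx hm (.base hZ)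
  | step h1 h2 h3 h4 ih => exact .step h1 h2 h3 ih

/-- The first step of a path that does not return to its start. -/
theorem Reaches.exists_first [DecidableEq κ] {U : κ} (hU : Reaches V E col u D h U) (hne : U ≠ h) :
    ∃ x ∈ V, ∃ Z, col x = U ∧ Movable E col u x Z ∧ Reaches V E col u (D.erase U) h Z := by
  have key : ∀ X, Reaches V E col u D h X → Reaches V E col u (D.erase U) h X ∨
      ∃ x ∈ V, ∃ Z, col x = U ∧ Movable E col u x Z ∧ Reaches V E col u (D.erase U) h Z := by
    intro X hX
    induction hX with
    | base hm => exact .inl (.base (Finset.mem_erase.2 ⟨hne.symm, hm⟩))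
    | @step x Z h1 h2 h3 h4 ih =>
      rcases ih with ih | ih
      · by_cases hx : col x = U
        · exact .inr ⟨x, h2, Z, hx, h3, ih⟩
        · exact .inl (.step (Finset.mem_erase.2 ⟨hx, h1⟩) h2 h3 ih)
      · exact .inr ih
  rcases key U hU with h | h
  · exact absurd h.mem (by simp)
  · exact h

open Finset Classical

theorem Pending.card_le_neighbors {T : Finset κ} {v : α}
    (h : ∀ X ∈ T, ∃ w ∈ V, E v w ∧ col w = X ∧ w ≠ u) :
    #T ≤ #(V.filter fun w => E v w ∧ col w ∈ T ∧ w ≠ u) := by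
  refine le_trans (card_le_card fun X hX => ?_) (card_image_le (f := col))
  obtain ⟨w, hw, h1, h2, h3⟩ := h X hX
  exact mem_image.2 ⟨w, by simp [hw, h1, h2, hX, h3], h2⟩

theorem Pending.card_colored (hP : Pending V E col s u C) {T : Finset κ} (hT : T ⊆ C) :
    #(V.filter fun v => col v ∈ T) = #T * s := by
  rw [card_eq_sum_card_fiberwise (f := col) (t := T) (fun v hv => by simpa using (mem_filter.1 hv).2)]
  rw [← smul_eq_mul, ← sum_const]
  refine sum_congr rfl fun X hX => ?_
  rw [← hP.size X (hT hX), filter_filter]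
  congr 1
  ext v
  simp only [mem_filter]
  constructor
  · rintro ⟨h1, h2, h3⟩; exact ⟨h1, h3⟩
  · rintro ⟨h1, h2⟩; exact ⟨h1, h2 ▸ hX, h2⟩

/-- The vertex `u` together with the color classes in `T`. -/
theorem Pending.card_insert (hP : Pending V E col s u C) {T : Finset κ} (hT : T ⊆ C)
    (hu : col u ∉ T) : #(V.filter fun v => v = u ∨ col v ∈ T) = #T * s + 1 := by
  rw [← hP.card_colored hT, ← card_insert_of_notMem (a := u) (by simp [hu])]
  congr 1
  ext v
  simp only [mem_filter, mem_insert]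
  constructor
  · rintro ⟨h1, h2 | h2⟩
    · exact .inl h2
    · exact .inr ⟨h1, h2⟩
  · rintro (h1 | h1)
    · exact ⟨h1 ▸ hP.mem_u, .inl h1⟩
    · exact ⟨h1.1, .inr h1.2⟩

variable (V E col u C) in
/-- The color classes that reach the class of `u`. -/
noncomputable def accessible : Finset κ := C.filter fun X => Reaches V E col u C (col u) X

theorem mem_accessible {X : κ} : X ∈ accessible V E col u C ↔ Reaches V E col u C (col u) X := by
  simp only [accessible, mem_filter, and_iff_right_iff_imp]
  exact Reaches.mem

theorem accessible_subset : accessible V E col u C ⊆ C := filter_subset _ _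

variable (V E col u C) in
/-- The color classes that do not reach the class of `u` when `U` is removed. -/
noncomputable def separated (U : κ) : Finset κ := (accessible V E col u C).filter fun X =>
  X ≠ U ∧ ¬ Reaches V E col u (C.erase U) (col u) X

theorem mem_separated {U X : κ} : X ∈ separated V E col u C U ↔
    Reaches V E col u C (col u) X ∧ X ≠ U ∧ ¬ Reaches V E col u (C.erase U) (col u) X := by
  simp only [separated, mem_filter, mem_accessible]

/-- In a minimal nonempty set of separated classes no class separates. -/
theorem separated_separated {U W : κ} (hU : Reaches V E col u C (col u) U)
    (hmin : ∀ U', Reaches V E col u C (col u) U' → (separated V E col u C U').Nonempty →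
      #(separated V E col u C U) ≤ #(separated V E col u C U'))
    (hW : W ∈ separated V E col u C U) : separated V E col u C W = ∅ := by
  by_contra hne
  obtain ⟨hW1, hW2, hW3⟩ := mem_separated.1 hW
  have hle := hmin W hW1 (nonempty_iff_ne_empty.2 hne)
  -- A path that avoids `U` cannot pass through `W`, since its remainder would lead from `W` to the
  -- hole without `U`.
  have avoid : ∀ X, Reaches V E col u (C.erase U) (col u) X →
      Reaches V E col u (C.erase W) (col u) X := fun X hX => hX.mono fun Y hY => by
    refine mem_erase.2 ⟨?_, (mem_erase.1 hY.mem).2⟩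
    rintro rfl
    exact hW3 hY
  have hUW : Reaches V E col u (C.erase W) (col u) U := by
    have hUm : U ∈ C.erase W := mem_erase.2 ⟨hW2.symm, hU.mem⟩
    by_cases hUh : U = col u
    · exact hUh ▸ .base (hUh ▸ hUm)
    · obtain ⟨x, hx, Z, rfl, hm, hZ⟩ := hU.exists_first hUh
      exact .step hUm hx hm (avoid Z hZ)
  -- `U` itself avoids `W`, so everything that `W` separates is separated by `U`, and `W` is
  -- missing: this contradicts minimality.
  have hlt : #(separated V E col u C W) < #(separated V E col u C U) := by
    refine card_lt_card ⟨fun X hX => ?_, fun hsub => ?_⟩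
    · obtain ⟨h1, h2, h3⟩ := mem_separated.1 hX
      refine mem_separated.2 ⟨h1, ?_, fun h => h3 (avoid X h)⟩
      rintro rfl
      exact h3 hUW
    · exact (mem_separated.1 (hsub hW)).2.1 rfl
  omega

theorem sum_card_comm {A B : Finset α} {R : α → α → Prop} :
    ∑ x ∈ A, #(B.filter fun y => R x y) = ∑ y ∈ B, #(A.filter fun x => R x y) := by
  simp only [card_filter]
  exact sum_comm

/-- The neighbors of `v` with a color in `C` are less than `#C`, and those among the accessible
classes are separated from the others. -/
theorem Pending.split_degree (hP : Pending V E col s u C) {v : α} (hv : v ∈ V) (hvC : col v ∈ C)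
    {T : Finset κ} (hT : T ⊆ C) (hu : col u ∈ T) :
    #(V.filter fun w => E v w ∧ col w ∈ T ∧ w ≠ u) +
      #((V.filter fun w => w = u ∨ col w ∈ C \ T).filter fun w => E v w) < #C := by
  refine lt_of_eq_of_lt ?_ (hP.degree v hv hvC)
  rw [← card_union_of_disjoint]
  · congr 1
    ext w
    simp only [mem_union, mem_filter, mem_sdiff]
    constructor
    · rintro (⟨h1, h2, h3, h4⟩ | ⟨⟨h1, h2⟩, h3⟩)
      · exact ⟨h1, h2, hT h3⟩
      · refine ⟨h1, h3, ?_⟩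
        rcases h2 with rfl | h2
        · exact hP.hole
        · exact h2.1
    · rintro ⟨h1, h2, h3⟩
      by_cases hwT : col w ∈ T
      · by_cases hwu : w = u
        · exact .inr ⟨⟨h1, .inl hwu⟩, h2⟩
        · exact .inl ⟨h1, h2, hwT, hwu⟩
      · exact .inr ⟨⟨h1, .inr ⟨h3, hwT⟩⟩, h2⟩
  · rw [Finset.disjoint_left]
    intro w hw hw'
    simp only [mem_filter, mem_sdiff] at hw hw'
    rcases hw'.1.2 with h | h
    · exact hw.2.2.2 h
    · exact h.2 hw.2.2.1

/-- A vertex outside of the accessible classes has a neighbor in each of them. -/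
theorem Pending.exists_neighbor (hP : Pending V E col s u C)
    (ha : ∀ X, Reaches V E col u C (col u) X → ¬ Movable E col u u X) {y : α} (hy : y ∈ V)
    (hyB : y = u ∨ col y ∈ C \ accessible V E col u C) {X : κ}
    (hX : X ∈ accessible V E col u C) : ∃ w ∈ V, E y w ∧ col w = X ∧ w ≠ u := by
  by_contra hno
  push Not at hno
  have hm : Movable E col u y X := fun w h1 h2 => hno w (hP.mem w y (hP.symm _ _ h1)) h1 h2
  rw [mem_accessible] at hX
  rcases hyB with rfl | hyB
  · exact ha X hX hm
  · rw [mem_sdiff, mem_accessible] at hyB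
    exact hyB.2 (.step hyB.1 hy hm hX)

/-- A vertex outside of the accessible classes has few neighbors outside of them. -/
theorem Pending.degree_outside (hP : Pending V E col s u C)
    (ha : ∀ X, Reaches V E col u C (col u) X → ¬ Movable E col u u X) {y : α} (hy : y ∈ V)
    (hyB : y = u ∨ col y ∈ C \ accessible V E col u C) :
    #((V.filter fun w => w = u ∨ col w ∈ C \ accessible V E col u C).filter fun w => E y w) <
      #(C \ accessible V E col u C) := by
  have hyC : col y ∈ C := by
    rcases hyB with rfl | hyB
    · exact hP.hole
    · exact (mem_sdiff.1 hyB).1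
  have h1 := hP.split_degree hy hyC (accessible_subset (V := V) (E := E) (col := col) (u := u))
    (mem_accessible.2 (.base hP.hole))
  have h2 := Pending.card_le_neighbors (V := V) (E := E) (col := col) (v := y)
    (T := accessible V E col u C) fun X hX => hP.exists_neighbor ha hy hyB hX
  have h3 := card_sdiff_add_card_eq_card (accessible_subset (V := V) (E := E) (col := col) (u := u)
    (C := C))
  omega

end Coloring

end PeerAssessment

/-! ### The double counts of the Hajnal–Szemerédi argument -/

namespace PeerAssessment

section Coloring

variable {α κ : Type*} {V : Finset α} {E : α → α → Prop} {col : α → κ} {s : ℕ} {u : α}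
  {C D : Finset κ} {h : κ}

open Finset Classical

theorem Pending.hole_accessible (hP : Pending V E col s u C) :
    col u ∈ accessible V E col u C := mem_accessible.2 (.base hP.hole)

theorem card_accessible_add : #(accessible V E col u C) + #(C \ accessible V E col u C) = #C := by
  rw [add_comm]
  exact card_sdiff_add_card_eq_card accessible_subset

/-- If `u` is adjacent to all accessible classes, then there are at least two of them. -/
theorem Pending.exists_accessible_ne (hP : Pending V E col s u C)
    (ha : ∀ X, Reaches V E col u C (col u) X → ¬ Movable E col u u X) :
    ∃ X, Reaches V E col u C (col u) X ∧ X ≠ col u := by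
  by_contra hno
  push Not at hno
  have hA : accessible V E col u C = {col u} := by
    ext X
    rw [mem_accessible, mem_singleton]
    refine ⟨hno X, ?_⟩
    rintro rfl
    exact .base hP.hole
  -- Suppose only the class of `u` is accessible, and let `q` be the number of other classes. The
  -- edges between the `q * s + 1` vertices of `B` and the `s - 1` vertices of `A` are counted: each
  -- vertex of `B` has at least one neighbor in `A`, each vertex of `A` at most `q` neighbors in
  -- `B`.
  set B := V.filter fun v => v = u ∨ col v ∈ C \ accessible V E col u C with hB
  set A := V.filter fun v => col v = col u ∧ v ≠ u with hAd
  have hBc : #B = #(C \ accessible V E col u C) * s + 1 :=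
    hP.card_insert sdiff_subset (by simp [hP.hole_accessible])
  have hAc : #A + 1 = s := by
    rw [← hP.size _ hP.hole, ← card_erase_add_one (a := u) (s := V.filter fun v => col v = col u)
      (by simp [hP.mem_u])]
    congr 2
    ext v
    simp only [hAd, mem_filter, mem_erase]
    tauto
  have h1 : #B ≤ ∑ y ∈ B, #(A.filter fun x => E x y) := by
    rw [card_eq_sum_ones]
    refine sum_le_sum fun y hy => ?_
    rw [hB, mem_filter] at hy
    obtain ⟨w, hw1, hw2, hw3, hw4⟩ := hP.exists_neighbor ha hy.1 hy.2 hP.hole_accessible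
    exact card_pos.2 ⟨w, by simp [hAd, hw1, hw3, hw4, hP.symm _ _ hw2]⟩
  have h2 : ∑ x ∈ A, #(B.filter fun y => E x y) ≤ #A * #(C \ accessible V E col u C) := by
    rw [← smul_eq_mul, ← sum_const]
    refine sum_le_sum fun x hx => ?_
    rw [hAd, mem_filter] at hx
    have h3 := hP.split_degree hx.1 (by rw [hx.2.1]; exact hP.hole)
      (accessible_subset (V := V) (E := E) (col := col) (u := u)) hP.hole_accessible
    have h4 := card_accessible_add (V := V) (E := E) (col := col) (u := u) (C := C)
    have h5 : #(accessible V E col u C) = 1 := by rw [hA, card_singleton]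
    have h6 : #(B.filter fun y => E x y) = #((V.filter fun w => w = u ∨
      col w ∈ C \ accessible V E col u C).filter fun w => E x w) := rfl
    omega
  rw [sum_card_comm] at h2
  have h3 := h1.trans h2
  rw [hBc, ← hAc, mul_comm (#A)] at h3
  generalize #(C \ accessible V E col u C) = q at h3
  rw [Nat.mul_add] at h3
  omega

/-- Vertices outside of the accessible classes that are reachable from `u`. -/
def Reachable (V : Finset α) (E : α → α → Prop) (col : α → κ) (u : α) (C : Finset κ) (y : α) :
    Prop :=
  y = u ∨ ∃ X, Movable E col u u X ∧ Reaches V E col u (C \ accessible V E col u C) (col y) X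

/-- If `u` cannot be inserted, and no solo vertex in an accessible class is movable to another
accessible class that reaches the class of `u` without using the first one, then a vertex of a
class that separates no other class is the only neighbor in its class of two nonadjacent vertices
that are reachable from `u`. -/
theorem Pending.exists_pair (hP : Pending V E col s u C)
    (ha : ∀ X, Reaches V E col u C (col u) X → ¬ Movable E col u u X)
    (hb : ∀ z ∈ V, z ≠ u → Reaches V E col u C (col u) (col z) → ∀ y ∈ V,
      (y = u ∨ col y ∈ C \ accessible V E col u C) → Solo E col u z y → ∀ X, X ≠ col z →
      Reaches V E col u (C.erase (col z)) (col u) X → ¬ Movable E col u z X) :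
    ∃ z ∈ V, ∃ y₁ ∈ V, ∃ y₂ ∈ V, z ≠ u ∧ Reaches V E col u C (col u) (col z) ∧ col z ≠ col u ∧
      (∀ X, Reaches V E col u C (col u) X → X ≠ col z →
        Reaches V E col u (C.erase (col z)) (col u) X) ∧
      Reachable V E col u C y₁ ∧ Reachable V E col u C y₂ ∧ y₁ ≠ y₂ ∧ ¬ E y₁ y₂ ∧
      Solo E col u z y₁ ∧ Solo E col u z y₂ := by
  -- a minimal set of separated classes
  obtain ⟨X₀, hX₀, hX₀'⟩ := hP.exists_accessible_ne ha
  have hne : ((accessible V E col u C).filter fun U =>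
      (separated V E col u C U).Nonempty).Nonempty := by
    -- The class of `u` separates every other accessible class, so the minimum is over a nonempty
    -- set.
    refine ⟨col u, mem_filter.2 ⟨hP.hole_accessible, X₀, mem_separated.2 ⟨hX₀, hX₀', fun h => ?_⟩⟩⟩
    exact absurd h.hole_mem (by simp)
  obtain ⟨U, hU, hUmin⟩ := exists_min_image _ (fun U => #(separated V E col u C U)) hne
  rw [mem_filter, mem_accessible] at hU
  obtain ⟨hU, W, hW⟩ := hU
  have hsep : ∀ W ∈ separated V E col u C U, separated V E col u C W = ∅ := fun W hW =>
    separated_separated hU (fun U' h1 h2 => hUmin U' (mem_filter.2 ⟨mem_accessible.2 h1, h2⟩)) hW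
  have hterm : ∀ W ∈ separated V E col u C U, ∀ X, Reaches V E col u C (col u) X → X ≠ W →
      Reaches V E col u (C.erase W) (col u) X := by
    intro W hW X hX hXW
    by_contra hno
    have := mem_separated.2 ⟨hX, hXW, hno⟩
    rw [hsep W hW] at this
    simp at this
  have hnu : ∀ W ∈ separated V E col u C U, W ≠ col u := by
    rintro W hW rfl
    obtain ⟨h1, h2, h3⟩ := mem_separated.1 hW
    exact h3 (.base (mem_erase.2 ⟨h2, hP.hole⟩))
  have hcol_ne : ∀ z, col z ∈ separated V E col u C U → z ≠ u := by
    rintro z hz rfl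
    exact hnu _ hz rfl
  set 𝒜 := accessible V E col u C with h𝒜
  set 𝒜' := separated V E col u C U with h𝒜'
  set 𝓑 := C \ 𝒜 with h𝓑
  have h𝒜C : 𝒜 ⊆ C := accessible_subset
  have h𝒜'𝒜 : 𝒜' ⊆ 𝒜 := filter_subset _ _
  have hcard : #𝒜 + #𝓑 = #C := card_accessible_add
  set B := V.filter fun v => v = u ∨ col v ∈ 𝓑 with hB
  have hBc : #B = #𝓑 * s + 1 := hP.card_insert sdiff_subset (by simp [h𝓑, hP.hole_accessible, h𝒜])
  -- the number of separated classes is large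
  have hq : #𝓑 < #𝒜' := by
    -- The edges between one separated class `W` and `B` are counted. The class splits into `S`, the
    -- vertices that are the only neighbor of some vertex of `B`, and `T`, the others.
    set S := V.filter fun z => col z = W ∧ ∃ y ∈ B, Solo E col u z y with hS
    set T := V.filter fun z => col z = W ∧ ¬ ∃ y ∈ B, Solo E col u z y with hT
    have hWC : W ∈ C := h𝒜C (h𝒜'𝒜 hW)
    have hST : #S + #T = s := by
      have := card_filter_add_card_filter_not (s := V.filter fun z => col z = W)
        (fun z => ∃ y ∈ B, Solo E col u z y)
      rw [hP.size W hWC, filter_filter, filter_filter] at this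
      exact this
    -- By `hb` such a vertex is movable to no other accessible class, so at least `#𝒜 - 1` of its at
    -- most `#𝒜 + #𝓑 - 1` neighbors are used up there.
    have hSd : ∀ z ∈ S, #(B.filter fun y => E z y) ≤ #𝓑 := by
      intro z hz
      rw [hS, mem_filter] at hz
      obtain ⟨hzV, rfl, y, hy, hsolo⟩ := hz
      rw [hB, mem_filter] at hy
      have hzu := hcol_ne z hW
      have h1 := hP.split_degree hzV hWC h𝒜C hP.hole_accessible
      have h2 := Pending.card_le_neighbors (V := V) (E := E) (col := col) (v := z) (u := u)
        (T := 𝒜.erase (col z)) fun X hX => by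
          by_contra hno
          push Not at hno
          rw [mem_erase, h𝒜, mem_accessible] at hX
          refine hb z hzV hzu (mem_accessible.1 (h𝒜'𝒜 hW)) y hy.1 hy.2 hsolo X hX.1
            (hterm _ hW X hX.2 hX.1) fun w h3 h4 => hno w (hP.mem w z (hP.symm _ _ h3)) h3 h4
      have h3 : #(V.filter fun w => E z w ∧ col w ∈ 𝒜.erase (col z) ∧ w ≠ u) ≤
          #(V.filter fun w => E z w ∧ col w ∈ 𝒜 ∧ w ≠ u) := by
        refine card_le_card fun w hw => ?_
        simp only [mem_filter, mem_erase] at hw ⊢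
        exact ⟨hw.1, hw.2.1, hw.2.2.1.2, hw.2.2.2⟩
      rw [card_erase_of_mem (h𝒜'𝒜 hW)] at h2
      have h4 : #(B.filter fun y => E z y) =
        #((V.filter fun w => w = u ∨ col w ∈ C \ 𝒜).filter fun w => E z w) := rfl
      omega
    -- Since `W` does not reach the hole without `U`, its vertices have neighbors in all accessible
    -- classes that are neither separated nor `U`.
    have hTd : ∀ z ∈ T, #(B.filter fun y => E z y) ≤ #𝓑 + #𝒜' := by
      intro z hz
      rw [hT, mem_filter] at hz
      obtain ⟨hzV, rfl, -⟩ := hz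
      have h1 := hP.split_degree hzV hWC h𝒜C hP.hole_accessible
      have h2 := Pending.card_le_neighbors (V := V) (E := E) (col := col) (v := z) (u := u)
        (T := (𝒜 \ 𝒜').erase U) fun X hX => by
          by_contra hno
          push Not at hno
          rw [mem_erase, mem_sdiff, h𝒜, mem_accessible, h𝒜', mem_separated] at hX
          have hXr : Reaches V E col u (C.erase U) (col u) X := by
            by_contra h
            exact hX.2.2 ⟨hX.2.1, hX.1, h⟩
          obtain ⟨hW1, hW2, hW3⟩ := mem_separated.1 hW
          exact hW3 (.step (mem_erase.2 ⟨hW2, hWC⟩) hzV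
            (fun w h3 h4 => hno w (hP.mem w z (hP.symm _ _ h3)) h3 h4) hXr)
      have h3 : #(V.filter fun w => E z w ∧ col w ∈ (𝒜 \ 𝒜').erase U ∧ w ≠ u) ≤
          #(V.filter fun w => E z w ∧ col w ∈ 𝒜 ∧ w ≠ u) := by
        refine card_le_card fun w hw => ?_
        simp only [mem_filter, mem_erase, mem_sdiff] at hw ⊢
        exact ⟨hw.1, hw.2.1, hw.2.2.1.2.1, hw.2.2.2⟩
      have h4 := pred_card_le_card_erase (s := 𝒜 \ 𝒜') (a := U)
      have h5 := card_sdiff_add_card_eq_card h𝒜'𝒜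
      have h6 : #(B.filter fun y => E z y) =
        #((V.filter fun w => w = u ∨ col w ∈ C \ 𝒜).filter fun w => E z w) := rfl
      omega
    -- A vertex of `B` with a single neighbor in `W` has that neighbor in `S`; otherwise two
    -- neighbors are available. Neighbors in `S` count twice.
    have hyd : ∀ y ∈ B, 2 ≤ 2 * #(S.filter fun z => E z y) + #(T.filter fun z => E z y) := by
      intro y hy
      have hy' := hy
      rw [hB, mem_filter] at hy'
      obtain ⟨w, hw1, hw2, hw3, hw4⟩ := hP.exists_neighbor ha hy'.1 hy'.2 (h𝒜'𝒜 hW)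
      by_cases hwS : w ∈ S
      · have : 0 < #(S.filter fun z => E z y) :=
          card_pos.2 ⟨w, mem_filter.2 ⟨hwS, hP.symm _ _ hw2⟩⟩
        omega
      · have hwT : w ∈ T := by
          rw [hS, mem_filter] at hwS
          rw [hT, mem_filter]
          exact ⟨hw1, hw3, fun h => hwS ⟨hw1, hw3, h⟩⟩
        have hns : ¬ Solo E col u w y := fun h => hwS (by
          rw [hS, mem_filter]; exact ⟨hw1, hw3, y, hy, h⟩)
        unfold Solo at hns
        push Not at hns
        obtain ⟨w', h1, h2, h3, h4⟩ := hns (hP.symm _ _ hw2)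
        have hw'V := hP.mem _ _ (hP.symm _ _ h1)
        by_cases hwS' : w' ∈ S
        · have : 0 < #(S.filter fun z => E z y) :=
            card_pos.2 ⟨w', mem_filter.2 ⟨hwS', hP.symm _ _ h1⟩⟩
          omega
        · have hwT' : w' ∈ T := by
            rw [hS, mem_filter] at hwS'
            rw [hT, mem_filter]
            exact ⟨hw'V, h2.trans hw3, fun h => hwS' ⟨hw'V, h2.trans hw3, h⟩⟩
          have : 1 < #(T.filter fun z => E z y) := one_lt_card.2
            ⟨w, mem_filter.2 ⟨hwT, hP.symm _ _ hw2⟩, w', mem_filter.2 ⟨hwT', hP.symm _ _ h1⟩,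
              h4.symm⟩
          omega
    have hsum : #B * 2 ≤ 2 * (#S * #𝓑) + #T * (#𝓑 + #𝒜') := by
      calc #B * 2 = ∑ y ∈ B, 2 := by rw [sum_const, smul_eq_mul]
        _ ≤ ∑ y ∈ B, (2 * #(S.filter fun z => E z y) + #(T.filter fun z => E z y)) :=
            sum_le_sum hyd
        _ = 2 * ∑ z ∈ S, #(B.filter fun y => E z y) + ∑ z ∈ T, #(B.filter fun y => E z y) := by
            rw [sum_add_distrib, ← mul_sum, sum_card_comm, sum_card_comm (A := T)]
        _ ≤ 2 * (#S * #𝓑) + #T * (#𝓑 + #𝒜') := by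
            gcongr
            · rw [← smul_eq_mul, ← sum_const]
              exact sum_le_sum hSd
            · rw [← smul_eq_mul, ← sum_const]
              exact sum_le_sum hTd
    -- If `#𝒜' ≤ #𝓑`, the right side is at most `2 * s * #𝓑`, whereas the left side is `2 * (s * #𝓑
    -- + 1)`.
    rw [hBc, ← hST] at hsum
    by_contra hlt
    have : #T * #𝒜' ≤ #T * #𝓑 := Nat.mul_le_mul_left _ (by omega)
    nlinarith
  -- the vertices that are reachable from `u`
  set 𝓑' := 𝓑.filter fun Y => ∃ X, Movable E col u u X ∧ Reaches V E col u 𝓑 Y X with h𝓑'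
  have h𝓑'𝓑 : 𝓑' ⊆ 𝓑 := filter_subset _ _
  set B' := V.filter fun v => v = u ∨ col v ∈ 𝓑' with hB'
  have hu𝓑 : col u ∉ 𝓑 := by simp [h𝓑, hP.hole_accessible, h𝒜]
  have hB'c : #B' = #𝓑' * s + 1 := hP.card_insert (h𝓑'𝓑.trans sdiff_subset) fun h => hu𝓑 (h𝓑'𝓑 h)
  have hB'r : ∀ y ∈ B', Reachable V E col u C y := by
    intro y hy
    rw [hB', mem_filter] at hy
    rcases hy.2 with h | h
    · exact .inl h
    · exact .inr (mem_filter.1 h).2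
  have hB'B : ∀ y ∈ B', y ∈ V ∧ (y = u ∨ col y ∈ 𝓑) := by
    intro y hy
    rw [hB', mem_filter] at hy
    exact ⟨hy.1, hy.2.imp_right fun h => h𝓑'𝓑 h⟩
  -- A vertex without such a neighbor would be movable to that class, which would then belong to
  -- `𝓑'`.
  have hnbr : ∀ y ∈ B', ∀ X ∈ 𝓑 \ 𝓑', ∃ w ∈ V, E y w ∧ col w = X ∧ w ≠ u := by
    intro y hy X hX
    by_contra hno
    push Not at hno
    have hm : Movable E col u y X := fun w h1 h2 => hno w (hP.mem w y (hP.symm _ _ h1)) h1 h2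
    rw [mem_sdiff] at hX
    rw [hB', mem_filter] at hy
    refine hX.2 (mem_filter.2 ⟨hX.1, ?_⟩)
    rcases hy.2 with rfl | hy'
    · exact ⟨X, hm, .base hX.1⟩
    · obtain ⟨Y, hY1, hY2⟩ := (mem_filter.1 hy').2
      exact ⟨Y, hY1, hY2.extend hy.1 hm hX.1⟩
  let σ : α → Finset α := fun y => V.filter fun z => col z ∈ 𝒜' ∧ Solo E col u z y
  -- Among its at most `#C - 1` neighbors, `y` has one in each class of `𝒜 \ 𝒜'` and of `𝓑 \ 𝓑'`,
  -- and in each class of `𝒜'` two unless the only one belongs to `σ y`. What remains bounds the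
  -- degree inside `B'`.
  have hdeg : ∀ y ∈ B', #𝒜' + 1 + #(B'.filter fun w => E y w) ≤ #(σ y) + #𝓑' ∧
      1 + #(B'.filter fun w => E y w) ≤ #𝓑' := by
    intro y hy
    obtain ⟨hyV, hyB⟩ := hB'B y hy
    have hyC : col y ∈ C := by
      rcases hyB with rfl | hyB
      · exact hP.hole
      · exact (mem_sdiff.1 hyB).1
    have h1 := hP.split_degree hyV hyC (T := C \ 𝓑') sdiff_subset
      (mem_sdiff.2 ⟨hP.hole, fun h => hu𝓑 (h𝓑'𝓑 h)⟩)
    have e1 : C \ (C \ 𝓑') = 𝓑' := Finset.sdiff_sdiff_eq_self (h𝓑'𝓑.trans sdiff_subset)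
    rw [e1] at h1
    have e2 : #((V.filter fun w => w = u ∨ col w ∈ 𝓑').filter fun w => E y w) =
      #(B'.filter fun w => E y w) := rfl
    rw [e2] at h1
    have h2 := Pending.card_le_neighbors (V := V) (E := E) (col := col) (v := y) (u := u)
      (T := (𝒜 \ 𝒜') ∪ (𝓑 \ 𝓑')) fun X hX => by
        rcases mem_union.1 hX with hX | hX
        · exact hP.exists_neighbor ha hyV hyB (mem_sdiff.1 hX).1
        · exact hnbr y hy X hX
    have hdis : Disjoint (𝒜 \ 𝒜') (𝓑 \ 𝓑') := by
      rw [Finset.disjoint_left]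
      intro X h3 h4
      exact (mem_sdiff.1 (mem_sdiff.1 h4).1).2 (mem_sdiff.1 h3).1
    rw [card_union_of_disjoint hdis] at h2
    have h3 := card_sdiff_add_card_eq_card h𝒜'𝒜
    have h4 := card_sdiff_add_card_eq_card h𝓑'𝓑
    set N₁ := V.filter fun w => E y w ∧ col w ∈ (𝒜 \ 𝒜') ∪ (𝓑 \ 𝓑') ∧ w ≠ u
    set N₂ := V.filter fun w => E y w ∧ col w ∈ 𝒜' with hN₂
    have h5 : #N₁ + #N₂ ≤ #(V.filter fun w => E y w ∧ col w ∈ C \ 𝓑' ∧ w ≠ u) := by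
      rw [← card_union_of_disjoint]
      · refine card_le_card fun w hw => ?_
        simp only [N₁, hN₂, mem_union, mem_filter, mem_sdiff] at hw ⊢
        rcases hw with ⟨h6, h7, h8, h9⟩ | ⟨h6, h7, h8⟩
        · refine ⟨h6, h7, ?_, h9⟩
          rcases h8 with h8 | h8
          · exact ⟨h𝒜C h8.1, fun h => (mem_sdiff.1 (h𝓑'𝓑 h)).2 h8.1⟩
          · exact ⟨(mem_sdiff.1 h8.1).1, h8.2⟩
        · exact ⟨h6, h7, ⟨h𝒜C (h𝒜'𝒜 h8), fun h => (mem_sdiff.1 (h𝓑'𝓑 h)).2 (h𝒜'𝒜 h8)⟩,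
            hcol_ne w h8⟩
      · rw [Finset.disjoint_left]
        intro w h6 h7
        simp only [N₁, hN₂, mem_union, mem_filter, mem_sdiff] at h6 h7
        rcases h6.2.2.1 with h8 | h8
        · exact h8.2 h7.2.2
        · exact (mem_sdiff.1 h8.1).2 (h𝒜'𝒜 h7.2.2)
    have h6 : #𝒜' * 2 ≤ #N₂ + #(σ y) := by
      rw [card_eq_sum_card_fiberwise (f := col) (s := N₂) (t := 𝒜')
          (fun v hv => by simpa using (mem_filter.1 hv).2.2),
        card_eq_sum_card_fiberwise (f := col) (s := σ y) (t := 𝒜')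
          (fun v hv => by simpa using (mem_filter.1 hv).2.1),
        ← sum_add_distrib, ← smul_eq_mul, ← sum_const]
      refine sum_le_sum fun X hX => ?_
      obtain ⟨w, hw1, hw2, hw3, hw4⟩ := hP.exists_neighbor ha hyV hyB (h𝒜'𝒜 hX)
      have hwN : w ∈ N₂.filter fun v => col v = X := by
        simp [hN₂, hw1, hw2, hw3, hX]
      by_cases hs : Solo E col u w y
      · have a1 : 0 < #(N₂.filter fun v => col v = X) := card_pos.2 ⟨w, hwN⟩
        have a2 : 0 < #((σ y).filter fun v => col v = X) :=
          card_pos.2 ⟨w, by simp [σ, hw1, hw3, hX, hs]⟩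
        omega
      · unfold Solo at hs
        push Not at hs
        obtain ⟨w', b1, b2, b3, b4⟩ := hs (hP.symm _ _ hw2)
        have : 1 < #(N₂.filter fun v => col v = X) := one_lt_card.2
          ⟨w, hwN, w', by
            simp [hN₂, hP.mem _ _ (hP.symm _ _ b1), b1, b2.trans hw3, hX], b4.symm⟩
        omega
    have h7 : #𝒜' ≤ #N₂ := by
      have := Pending.card_le_neighbors (V := V) (E := E) (col := col) (v := y) (u := u)
        (T := 𝒜') fun X hX => hP.exists_neighbor ha hyV hyB (h𝒜'𝒜 hX)
      refine this.trans (card_le_card fun w hw => ?_)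
      simp only [mem_filter, hN₂] at hw ⊢
      exact ⟨hw.1, hw.2.1, hw.2.2.1⟩
    omega
  -- a maximal independent set
  let Independent : Finset α → Prop := fun I => ∀ v ∈ I, ∀ w ∈ I, ¬ E v w
  obtain ⟨I, hI, hImax⟩ := exists_max_image (B'.powerset.filter Independent) (fun I => #I)
    ⟨∅, by simp [Independent]⟩
  rw [mem_filter, mem_powerset] at hI
  obtain ⟨hIB, hIind⟩ := hI
  have hdom : ∀ v ∈ B', v ∈ I ∨ ∃ y ∈ I, E y v := by
    intro v hv
    by_contra hno
    push Not at hno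
    have hind : Independent (insert v I) := by
      intro a h1 b h2 hab
      rw [mem_insert] at h1 h2
      rcases h1 with h1 | h1 <;> rcases h2 with h2 | h2
      · exact hP.irrefl v (by rwa [h1, h2] at hab)
      · exact hno.2 b h2 (hP.symm _ _ (h1 ▸ hab))
      · exact hno.2 a h1 (h2 ▸ hab)
      · exact hIind a h1 b h2 hab
    have := hImax (insert v I) (mem_filter.2 ⟨mem_powerset.2 (insert_subset hv hIB), hind⟩)
    rw [card_insert_of_notMem hno.1] at this
    omega
  -- Maximality makes `I` a dominating set of `B'`.
  have hcover : #B' ≤ ∑ y ∈ I, (1 + #(B'.filter fun w => E y w)) := by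
    have : B' ⊆ I.biUnion fun y => insert y (B'.filter fun w => E y w) := by
      intro v hv
      rw [mem_biUnion]
      rcases hdom v hv with h | ⟨y, hy, h⟩
      · exact ⟨v, h, mem_insert_self _ _⟩
      · exact ⟨y, hy, mem_insert_of_mem (mem_filter.2 ⟨hv, h⟩)⟩
    refine (card_le_card this).trans (card_biUnion_le.trans (sum_le_sum fun y hy => ?_))
    rw [add_comm]
    exact card_insert_le _ _
  by_contra hno
  have hdisj : ∀ y₁ ∈ I, ∀ y₂ ∈ I, y₁ ≠ y₂ → Disjoint (σ y₁) (σ y₂) := by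
    intro y₁ h1 y₂ h2 h12
    rw [Finset.disjoint_left]
    intro z hz1 hz2
    simp only [σ, mem_filter] at hz1 hz2
    exact hno ⟨z, hz1.1, y₁, (hB'B y₁ (hIB h1)).1, y₂, (hB'B y₂ (hIB h2)).1, hcol_ne z hz1.2.1,
      mem_accessible.1 (h𝒜'𝒜 hz1.2.1), hnu _ hz1.2.1, hterm _ hz1.2.1, hB'r y₁ (hIB h1),
      hB'r y₂ (hIB h2), h12, hIind y₁ h1 y₂ h2, hz1.2.2, hz2.2.2⟩
  have hσ : ∑ y ∈ I, #(σ y) ≤ #𝒜' * s := by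
    rw [← card_biUnion hdisj, ← hP.card_colored (h𝒜'𝒜.trans h𝒜C)]
    refine card_le_card fun z hz => ?_
    simp only [mem_biUnion, σ, mem_filter] at hz ⊢
    obtain ⟨y, -, h1, h2, -⟩ := hz
    exact ⟨h1, h2⟩
  have s1 : ∑ y ∈ I, (1 + #(B'.filter fun w => E y w)) ≤ #I * #𝓑' := by
    rw [← smul_eq_mul, ← sum_const]
    exact sum_le_sum fun y hy => (hdeg y (hIB hy)).2
  have s2 : #I * #𝒜' + ∑ y ∈ I, (1 + #(B'.filter fun w => E y w)) ≤
      ∑ y ∈ I, #(σ y) + #I * #𝓑' := by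
    rw [← smul_eq_mul, ← sum_const, ← smul_eq_mul, ← sum_const, ← sum_add_distrib,
      ← sum_add_distrib]
    refine sum_le_sum fun y hy => ?_
    have := (hdeg y (hIB hy)).1
    omega
  have hb' : #𝓑' ≤ #𝓑 := card_le_card h𝓑'𝓑
  rw [hB'c] at hcover
  -- Domination gives `s * #𝓑' + 1 ≤ #I * #𝓑'`. If the sets `σ y` for `y ∈ I` were disjoint, adding
  -- the degree bounds would give `(#I - s) * (#𝒜' - #𝓑') + 1 ≤ 0`, although both factors are
  -- positive.
  have s3 : s < #I := by
    by_contra h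
    have : #I * #𝓑' ≤ s * #𝓑' := Nat.mul_le_mul_right _ (by omega)
    rw [mul_comm s] at this
    omega
  obtain ⟨e, he⟩ := Nat.exists_eq_add_of_lt s3
  obtain ⟨f, hf⟩ := Nat.exists_eq_add_of_lt (hb'.trans_lt hq)
  rw [he, hf] at s2
  rw [hf] at hσ
  nlinarith

end Coloring

end PeerAssessment

/-! ### Recoloring by shifts along paths of classes and by rotations -/

namespace PeerAssessment

section Coloring

variable {α κ : Type*}

/-- Exchange the colors of two vertices. -/
def exchange [DecidableEq α] (col : α → κ) (a b : α) : α → κ :=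
  fun v => if v = a then col b else if v = b then col a else col v

/-- The vertex `u` takes the color of `y`, `y` that of `z`, and `z` that of `u`. -/
def rotate [DecidableEq α] (col : α → κ) (u y z : α) : α → κ := exchange (exchange col u y) y z

/-- The coloring is proper outside of `L`. -/
def ProperOutside (E : α → α → Prop) (col : α → κ) (L : Set α) : Prop :=
  ∀ a b, E a b → a ∉ L → b ∉ L → col a ≠ col b

/-- The vertex `v`, which has the color `h` and is not yet inserted, is movable to the color
class `X`, from which increasing stamps lead back to `h`. -/
structure Shifting (V : Finset α) (E : α → α → Prop) (col : α → κ) (L : Set α) (v : α) (h X : κ)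
    (st : κ → ℕ) : Prop where
  mem : v ∈ V
  hole : col v = h
  proper : ProperOutside E col (insert v L)
  movable : Movable E col v v X
  pos : 0 < st X
  stamps : ∀ Y, 0 < st Y → st Y ≤ st X → Y = h ∨
    ∃ x ∈ V, ∃ Z, col x = Y ∧ Movable E col v x Z ∧ 0 < st Z ∧ st Z < st Y

/-- Only colors with the property `P` are changed, and they are replaced by such colors. -/
def ChangesOnly (P : κ → Prop) (col col' : α → κ) : Prop :=
  ∀ w, (¬ P (col w) → col' w = col w) ∧ (P (col w) → P (col' w))

theorem ChangesOnly.refl (P : κ → Prop) (col : α → κ) : ChangesOnly P col col :=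
  fun _ => ⟨fun _ => rfl, id⟩

theorem ChangesOnly.trans {P : κ → Prop} {c c' c'' : α → κ} (h : ChangesOnly P c c')
    (h' : ChangesOnly P c' c'') : ChangesOnly P c c'' := fun w =>
  ⟨fun hw => by rw [(h' w).1 (by rwa [(h w).1 hw]), (h w).1 hw], fun hw => (h' w).2 ((h w).2 hw)⟩

theorem ChangesOnly.eq_of_not {P : κ → Prop} {c c' : α → κ} (h : ChangesOnly P c c') {w : α}
    (hw : ¬ P (c' w)) : c' w = c w := (h w).1 fun h' => hw ((h w).2 h')

theorem changesOnly_exchange [DecidableEq α] {P : κ → Prop} {col : α → κ} {a b : α} (ha : P (col a))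
    (hb : P (col b)) : ChangesOnly P col (exchange col a b) := by
  intro w
  unfold exchange
  split_ifs with h1 h2
  · exact ⟨fun h => absurd ha (h1 ▸ h), fun _ => hb⟩
  · exact ⟨fun h => absurd hb (h2 ▸ h), fun _ => ha⟩
  · exact ⟨fun _ => rfl, id⟩

/-- All color classes have the same sizes. -/
def SameSizes (V : Finset α) (col col' : α → κ) : Prop :=
  ∀ X, {v | v ∈ V ∧ col' v = X}.ncard = {v | v ∈ V ∧ col v = X}.ncard

theorem sameSizes_exchange [DecidableEq α] {V : Finset α} {col : α → κ} {a b : α} (ha : a ∈ V) (hb : b ∈ V) :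
    SameSizes V col (exchange col a b) := by
  intro X
  refine Set.ncard_congr (fun v _ => Equiv.swap a b v) ?_ ?_ ?_
  · rintro v ⟨h1, h2⟩
    unfold exchange at h2
    split_ifs at h2 with h3 h4
    · subst h3
      simpa using ⟨hb, h2⟩
    · subst h4
      simpa using ⟨ha, h2⟩
    · rw [Set.mem_ofPred_eq, Equiv.swap_apply_of_ne_of_ne h3 h4]
      exact ⟨h1, h2⟩
  · intro v w _ _ h
    exact (Equiv.swap a b).injective h
  · rintro v ⟨h1, h2⟩
    refine ⟨Equiv.swap a b v, ⟨?_, ?_⟩, Equiv.swap_apply_self _ _ _⟩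
    · by_cases h3 : v = a
      · subst h3; simpa using hb
      · by_cases h4 : v = b
        · subst h4; simpa using ha
        · rwa [Equiv.swap_apply_of_ne_of_ne h3 h4]
    · unfold exchange
      by_cases h3 : v = a
      · subst h3
        rw [Equiv.swap_apply_left]
        by_cases h5 : b = v
        · simpa [h5] using h2
        · simpa [h5] using h2
      · by_cases h4 : v = b
        · subst h4
          simpa using h2
        · rw [Equiv.swap_apply_of_ne_of_ne h3 h4, if_neg h3, if_neg h4]
          exact h2

theorem SameSizes.trans {V : Finset α} {c c' c'' : α → κ} (h : SameSizes V c c')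
    (h' : SameSizes V c' c'') : SameSizes V c c'' := fun X => (h' X).trans (h X)

theorem ncard_color {V : Finset α} {col : α → κ} (X : κ) [DecidablePred fun v => col v = X] :
    {v | v ∈ V ∧ col v = X}.ncard = (V.filter fun v => col v = X).card := by
  rw [← Set.ncard_coe_finset]
  simp

section Shift

variable {V : Finset α} {E : α → α → Prop} {col : α → κ} {L : Set α} {v : α} {h X : κ} {st : κ → ℕ}

/-- The vertex `v` fits into the class `X`, and `x` inherits both the hole and the role of the
vertex to be inserted; an exchange keeps all class sizes. The remaining path uses stamps at most `st
Z`, which is less than `st X`, so the changed class `X` no longer occurs on it. -/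
theorem Shifting.step [DecidableEq α] (hs : Shifting V E col L v h X st) (symm : ∀ a b, E a b → E b a)
    (irrefl : ∀ a, ¬ E a a) (hX : X ≠ h) {x : α} {Z : κ} (hx : x ∈ V) (hxX : col x = X)
    (hm : Movable E col v x Z) (hZ : 0 < st Z) (hZX : st Z < st X) :
    Shifting V E (exchange col v x) L x h Z st := by
  have hxv : x ≠ v := by
    rintro rfl
    exact hX (hxX.symm.trans hs.hole)
  have ev : exchange col v x v = X := by simp [exchange, hxX]
  have ex : exchange col v x x = h := by simp [exchange, hxv, hs.hole]
  have eo : ∀ w, w ≠ v → w ≠ x → exchange col v x w = col w := fun w h1 h2 => by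
    simp [exchange, h1, h2]
  have hv : ∀ b, E v b → b ≠ x → exchange col v x b ≠ X := by
    intro b hb hbx
    have hbv : b ≠ v := by rintro rfl; exact irrefl _ hb
    rw [eo b hbv hbx]
    exact fun h => hbv (hs.movable b hb h)
  refine ⟨hx, ex, ?_, ?_, hZ, ?_⟩
  · intro a b hab ha hb
    rw [Set.mem_insert_iff, not_or] at ha hb
    by_cases hav : a = v
    · rw [hav, ev]
      exact (hv b (hav ▸ hab) hb.1).symm
    by_cases hbv : b = v
    · rw [hbv, ev]
      exact hv a (symm _ _ (hbv ▸ hab)) ha.1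
    rw [eo a hav ha.1, eo b hbv hb.1]
    refine hs.proper a b hab ?_ ?_
    · rw [Set.mem_insert_iff, not_or]
      exact ⟨hav, ha.2⟩
    · rw [Set.mem_insert_iff, not_or]
      exact ⟨hbv, hb.2⟩
  · intro w hw hwZ
    by_contra hwx
    by_cases hwv : w = v
    · rw [hwv, ev] at hwZ
      rw [hwZ] at hZX
      omega
    · rw [eo w hwv hwx] at hwZ
      exact hwv (hm w hw hwZ)
  · intro Y hY hYZ
    rcases hs.stamps Y hY (by omega) with h | ⟨x', hx', Z', h1, h2, h3, h4⟩
    · exact .inl h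
    by_cases hYh : Y = h
    · exact .inl hYh
    refine .inr ⟨x', hx', Z', ?_, ?_, h3, h4⟩
    · rw [eo x', h1]
      · rintro rfl
        exact hYh (h1.symm.trans hs.hole)
      · rintro rfl
        rw [hxX] at h1
        rw [h1] at hZX
        omega
    · intro w hw hwZ
      by_contra hwx
      by_cases hwv : w = v
      · rw [hwv, ev] at hwZ
        rw [hwZ] at hZX
        omega
      · rw [eo w hwv hwx] at hwZ
        exact hwv (h2 w hw hwZ)

/-- At the end the vertex is movable to the class whose color it already bears, so it has no
neighbor there. -/
theorem Shifting.finish (hs : Shifting V E col L v h h st) (symm : ∀ a b, E a b → E b a)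
    (irrefl : ∀ a, ¬ E a a) : ProperOutside E col L := by
  have hv : ∀ b, E v b → col b ≠ col v := by
    intro b hb h
    have := hs.movable b hb (h.trans hs.hole)
    exact irrefl v (this ▸ hb)
  intro a b hab ha hb
  by_cases hav : a = v
  · rw [hav]
    exact (hv b (hav ▸ hab)).symm
  by_cases hbv : b = v
  · rw [hbv]
    exact hv a (symm _ _ (hbv ▸ hab))
  refine hs.proper a b hab ?_ ?_
  · rw [Set.mem_insert_iff, not_or]
    exact ⟨hav, ha⟩
  · rw [Set.mem_insert_iff, not_or]
    exact ⟨hbv, hb⟩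

end Shift

theorem Pending.congr_size {V : Finset α} {E : α → α → Prop} {col : α → κ} {s : ℕ} {u : α}
    {C : Finset κ} (hP : Pending V E col s u C) {col' : α → κ} (h : SameSizes V col col')
    {X : κ} (hX : X ∈ C) [DecidablePred fun v => col' v = X] :
    (V.filter fun v => col' v = X).card = s := by
  classical
  rw [← ncard_color, h X, ncard_color]
  convert hP.size X hX

section Rotate

variable [DecidableEq α] {V : Finset α} {E : α → α → Prop} {col : α → κ} {s : ℕ} {u y z : α} {C : Finset κ}

/-- The case `y = u` is included; the rotation is then the exchange of `u` and `z`. -/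
theorem rotate_z (hyz : y ≠ z) : rotate col u y z z = col u := by
  unfold rotate exchange
  by_cases h : y = u
  · simp [h]
    exact fun h1 h2 => absurd h1 h2
  · simp [hyz.symm, h]

theorem rotate_y (hzu : z ≠ u) (hyz : y ≠ z) : rotate col u y z y = col z := by
  simp [rotate, exchange, hzu, hyz.symm]

theorem rotate_u (hzu : z ≠ u) (hyu : y ≠ u) : rotate col u y z u = col y := by
  simp [rotate, exchange, hyu.symm, hzu.symm]

theorem rotate_of_ne {v : α} (h1 : v ≠ u) (h2 : v ≠ y) (h3 : v ≠ z) : rotate col u y z v = col v := by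
  simp [rotate, exchange, h1, h2, h3]

theorem sameSizes_rotate (hu : u ∈ V) (hy : y ∈ V) (hz : z ∈ V) :
    SameSizes V col (rotate col u y z) :=
  (sameSizes_exchange hu hy).trans (sameSizes_exchange hy hz)

/-- The vertex `y` conflicts with nothing in its new class, because `z`, which has left, was its
only neighbor there apart from `u`. The vertices `z` and `u` remain exempt, but `u` only if it is
not `y` itself. -/
theorem Pending.proper_rotate (hP : Pending V E col s u C) (hzu : z ≠ u)
    (hs : Solo E col u z y) : ProperOutside E (rotate col u y z) {w | w = z ∨ w = u ∧ y ≠ u} := by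
  have hyz : y ≠ z := by
    rintro rfl
    exact hP.irrefl _ hs.1
  have hy : ∀ b, E y b → b ≠ z → ¬ (b = u ∧ y ≠ u) → rotate col u y z b ≠ col z := by
    intro b hb hbz hbu h
    have hby : b ≠ y := by rintro rfl; exact hP.irrefl _ hb
    have hbu' : b ≠ u := fun h => hbu ⟨h, fun h' => hby (h.trans h'.symm)⟩
    rw [rotate_of_ne hbu' hby hbz] at h
    exact hbz (hs.2 b hb h hbu')
  intro a b hab ha hb
  simp only [Set.mem_ofPred_eq, not_or] at ha hb
  by_cases hay : a = y
  · rw [hay, rotate_y hzu hyz]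
    exact (hy b (hay ▸ hab) hb.1 hb.2).symm
  by_cases hby : b = y
  · rw [hby, rotate_y hzu hyz]
    exact hy a (hP.symm _ _ (hby ▸ hab)) ha.1 ha.2
  have hau : a ≠ u := fun h => ha.2 ⟨h, fun h' => hay (h.trans h'.symm)⟩
  have hbu : b ≠ u := fun h => hb.2 ⟨h, fun h' => hby (h.trans h'.symm)⟩
  rw [rotate_of_ne hau hay ha.1, rotate_of_ne hbu hby hb.1]
  exact hP.proper a b hab hau hbu

open Finset Classical in
/-- The start of the shift in the accessible classes. -/
theorem Pending.shifting_accessible (hP : Pending V E col s u C) {X : κ} {st : κ → ℕ}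
    (hz : z ∈ V) (hzu : z ≠ u)
    (hy : y = u ∨ col y ∈ C \ accessible V E col u C)
    (hs : Solo E col u z y) (hm : Movable E col u z X)
    (hst : ∀ Y, 0 < st Y → Reaches V E col u C (col u) Y ∧ Y ≠ col z) (hX : 0 < st X)
    (hpred : ∀ Y, 0 < st Y → Y = col u ∨ ∃ x ∈ V, ∃ Z, col x = Y ∧ Movable E col u x Z ∧
      0 < st Z ∧ st Z < st Y) :
    Shifting V E (rotate col u y z) {w | w = u ∧ y ≠ u} z (col u) X st := by
  have hyz : y ≠ z := by
    rintro rfl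
    exact hP.irrefl _ hs.1
  have hyacc : ∀ Y, 0 < st Y → y ≠ u → col y ≠ Y := by
    rintro Y hY hyu rfl
    rcases hy with h | h
    · exact hyu h
    · rw [Finset.mem_sdiff, mem_accessible] at h
      exact h.2 (hst _ hY).1
  -- The rotation adds no obstacle to a stamped class: `y` gets the color of `z`, which is not
  -- stamped, `u` gets an inaccessible color unless it is `y`, and `z` is now the exempt vertex.
  have hmov : ∀ x Z, 0 < st Z → Movable E col u x Z → Movable E (rotate col u y z) z x Z := by
    intro x Z hZ hx w hw hwZ
    by_contra hwz
    by_cases hwy : w = y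
    · rw [hwy, rotate_y hzu hyz] at hwZ
      exact (hst Z hZ).2 hwZ.symm
    by_cases hwu : w = u
    · have hyu : y ≠ u := fun h => hwy (hwu.trans h.symm)
      rw [hwu, rotate_u hzu hyu] at hwZ
      exact hyacc Z hZ hyu hwZ
    · rw [rotate_of_ne hwu hwy hwz] at hwZ
      exact hwu (hx w hw hwZ)
  refine ⟨hz, rotate_z hyz, ?_, hmov z X hX hm, hX, ?_⟩
  · intro a b hab ha hb
    exact hP.proper_rotate hzu hs a b hab ha hb
  · intro Y hY _
    rcases hpred Y hY with h | ⟨x, hx, Z, h1, h2, h3, h4⟩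
    · exact .inl h
    by_cases hYu : Y = col u
    · exact .inl hYu
    refine .inr ⟨x, hx, Z, ?_, hmov x Z h3 h2, h3, h4⟩
    rw [rotate_of_ne, h1]
    · rintro rfl
      exact hYu h1.symm
    · rintro rfl
      by_cases hxu : x = u
      · exact hYu (by rw [← h1, hxu])
      · exact hyacc Y hY hxu h1
    · rintro rfl
      exact (hst Y hY).2 h1.symm

open Finset Classical in
/-- The start of the shift in the classes that are not accessible. -/
theorem Pending.shifting_inaccessible (hP : Pending V E col s u C) {X : κ} {st : κ → ℕ}
    (hzu : z ≠ u) (hz : Reaches V E col u C (col u) (col z)) (hyu : y ≠ u)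
    (hs : Solo E col u z y) (hm : Movable E col u u X)
    (hst : ∀ Y, 0 < st Y → Y ∈ C \ accessible V E col u C) (hX : 0 < st X)
    (hpred : ∀ Y, 0 < st Y → Y = col y ∨ ∃ x ∈ V, ∃ Z, col x = Y ∧ Movable E col u x Z ∧
      0 < st Z ∧ st Z < st Y) :
    Shifting V E (rotate col u y z) {z} u (col y) X st := by
  have hyz : y ≠ z := by
    rintro rfl
    exact hP.irrefl _ hs.1
  have hacc : ∀ Y, Reaches V E col u C (col u) Y → ¬ 0 < st Y := by
    intro Y h1 h2
    have := hst Y h2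
    rw [Finset.mem_sdiff, mem_accessible] at this
    exact this.2 h1
  -- Here `y` and `z` get accessible colors, which are not stamped, and `u` stays exempt.
  have hmov : ∀ x Z, 0 < st Z → Movable E col u x Z → Movable E (rotate col u y z) u x Z := by
    intro x Z hZ hx w hw hwZ
    by_contra hwu
    by_cases hwy : w = y
    · rw [hwy, rotate_y hzu hyz] at hwZ
      exact hacc _ hz (hwZ ▸ hZ)
    by_cases hwz : w = z
    · rw [hwz, rotate_z hyz] at hwZ
      exact hacc _ (.base hP.hole) (hwZ ▸ hZ)
    · rw [rotate_of_ne hwu hwy hwz] at hwZ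
      exact hwu (hx w hw hwZ)
  refine ⟨hP.mem_u, rotate_u hzu hyu, ?_, hmov u X hX hm, hX, ?_⟩
  · intro a b hab ha hb
    rw [Set.mem_insert_iff, Set.mem_singleton_iff, not_or] at ha hb
    refine hP.proper_rotate hzu hs a b hab ?_ ?_ <;>
      simp only [Set.mem_ofPred_eq] <;> tauto
  · intro Y hY _
    rcases hpred Y hY with h | ⟨x, hx, Z, h1, h2, h3, h4⟩
    · exact .inl h
    by_cases hYy : Y = col y
    · exact .inl hYy
    refine .inr ⟨x, hx, Z, ?_, hmov x Z h3 h2, h3, h4⟩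
    rw [rotate_of_ne, h1]
    · rintro rfl
      exact hacc _ (.base hP.hole) (h1 ▸ hY)
    · rintro rfl
      exact hYy h1.symm
    · rintro rfl
      exact hacc _ hz (h1 ▸ hY)

open Finset Classical in
/-- After the accessible classes have been completed, `u` has to be inserted into the others. -/
theorem Pending.of_accessible_shift (hP : Pending V E col s u C)
    (ha : ∀ X, Reaches V E col u C (col u) X → ¬ Movable E col u u X)
    (hzu : z ≠ u) (hz : Reaches V E col u C (col u) (col z)) (hyu : y ≠ u)
    (hy : col y ∈ C \ accessible V E col u C) (hs : Solo E col u z y)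
    {P : κ → Prop} (hPacc : ∀ Y, P Y → Reaches V E col u C (col u) Y) {col' : α → κ}
    (hch : ChangesOnly P (rotate col u y z) col') (hsz : SameSizes V col col')
    (hpr : ProperOutside E col' {w | w = u ∧ y ≠ u}) :
    Pending V E col' s u (C \ accessible V E col u C) := by
  have hyz : y ≠ z := by
    rintro rfl
    exact hP.irrefl _ hs.1
  have hnP : ∀ Y, Y ∈ C \ accessible V E col u C → ¬ P Y := by
    intro Y hY hPY
    rw [mem_sdiff, mem_accessible] at hY
    exact hY.2 (hPacc Y hPY)
  have hu' : col' u = col y := by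
    have := (hch u).1
    rw [rotate_u hzu hyu] at this
    exact this (hnP _ hy)
  have hsub : ∀ v, col' v ∈ C \ accessible V E col u C →
      v = u ∨ col v ∈ C \ accessible V E col u C := by
    intro v hv
    rw [hch.eq_of_not (hnP _ hv)] at hv
    by_cases hvu : v = u
    · exact .inl hvu
    by_cases hvy : v = y
    · exact .inr (hvy ▸ hy)
    by_cases hvz : v = z
    · rw [hvz, rotate_z hyz] at hv
      exact absurd hP.hole_accessible (mem_sdiff.1 hv).2
    · rw [rotate_of_ne hvu hvy hvz] at hv
      exact .inr hv
  refine ⟨hP.symm, hP.irrefl, hP.mem, hP.mem_u, fun X hX => ?_, hu' ▸ hy, ?_, ?_⟩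
  · exact hP.congr_size hsz (mem_sdiff.1 hX).1
  · intro v w hvw hv hw
    exact hpr v w hvw (fun h => hv h.1) (fun h => hw h.1)
  · intro v hv hvC
    -- Each vertex concerned had a neighbor in every accessible class, so dropping these classes
    -- lowers its degree at least as much as the number of colors.
    refine lt_of_le_of_lt (card_le_card fun w hw => ?_) (hP.degree_outside ha hv (hsub v hvC))
    simp only [mem_filter] at hw ⊢
    exact ⟨⟨hw.1, hsub w hw.2.2⟩, hw.2.1⟩

open Finset Classical in
/-- After `u` has been inserted and `z` has been removed, more classes are accessible. -/
theorem Pending.of_inaccessible_shift (hP : Pending V E col s u C) {y' : α}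
    (hzV : z ∈ V) (hzu : z ≠ u) (hz : Reaches V E col u C (col u) (col z)) (hzh : col z ≠ col u)
    (hterm : ∀ X, Reaches V E col u C (col u) X → X ≠ col z →
      Reaches V E col u (C.erase (col z)) (col u) X)
    (hb : ∀ X, X ≠ col z → Reaches V E col u (C.erase (col z)) (col u) X → ¬ Movable E col u z X)
    (hy : y = u ∨ col y ∈ C \ accessible V E col u C) (hs : Solo E col u z y)
    (hy'V : y' ∈ V) (hy' : y' = u ∨ col y' ∈ C \ accessible V E col u C) (hs' : Solo E col u z y')
    (hyy' : y ≠ y') (hE : ¬ E y y')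
    {P : κ → Prop} (hPacc : ∀ Y, P Y → Y ∈ C \ accessible V E col u C) {col' : α → κ}
    (hch : ChangesOnly P (rotate col u y z) col') (hsz : SameSizes V col col')
    (hpr : ProperOutside E col' {z}) :
    Pending V E col' s z C ∧ accessible V E col u C ⊂ accessible V E col' z C := by
  have hyz : y ≠ z := by
    rintro rfl
    exact hP.irrefl _ hs.1
  have hyz' : y' ≠ z := by
    rintro rfl
    exact hP.irrefl _ hs'.1
  have hnP : ∀ Y, Reaches V E col u C (col u) Y → ¬ P Y := by
    intro Y hY hPY
    have := hPacc Y hPY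
    rw [mem_sdiff, mem_accessible] at this
    exact this.2 hY
  have hz' : col' z = col u := by
    have := (hch z).1
    rw [rotate_z hyz] at this
    exact this (hnP _ (.base hP.hole))
  have hC : ∀ v, col' v ∈ C ↔ col v ∈ C := by
    intro v
    have h1 : col' v ∈ C ↔ rotate col u y z v ∈ C := by
      by_cases h : P (rotate col u y z v)
      · have h2 := hPacc _ h
        have h3 := hPacc _ ((hch v).2 h)
        exact ⟨fun _ => (mem_sdiff.1 h2).1, fun _ => (mem_sdiff.1 h3).1⟩
      · rw [(hch v).1 h]
    rw [h1]
    by_cases hvy : v = y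
    · rw [hvy, rotate_y hzu hyz]
      refine ⟨fun _ => ?_, fun _ => hz.mem⟩
      rcases hy with h | h
      · exact h ▸ hP.hole
      · exact (mem_sdiff.1 h).1
    by_cases hvu : v = u
    · have hyu : y ≠ u := fun h => hvy (hvu.trans h.symm)
      rw [hvu, rotate_u hzu hyu]
      exact ⟨fun _ => hP.hole, fun _ => (mem_sdiff.1 (hy.resolve_left hyu)).1⟩
    by_cases hvz : v = z
    · rw [hvz, rotate_z hyz]
      exact ⟨fun _ => hz.mem, fun _ => hP.hole⟩
    · rw [rotate_of_ne hvu hvy hvz]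
  -- movability in accessible classes
  have hacc_eq : ∀ w Y, Reaches V E col u C (col u) Y → col' w = Y → w ≠ y → w ≠ z →
      w ≠ u ∧ col w = Y := by
    intro w Y hY hw hwy hwz
    rw [hch.eq_of_not (by rw [hw]; exact hnP Y hY)] at hw
    have hwu : w ≠ u := by
      intro hwu
      have hyu : y ≠ u := fun h => hwy (hwu.trans h.symm)
      rw [hwu, rotate_u hzu hyu] at hw
      have := hy.resolve_left hyu
      rw [mem_sdiff, mem_accessible, hw] at this
      exact this.2 hY
    rw [rotate_of_ne hwu hwy hwz] at hw
    exact ⟨hwu, hw⟩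
  have hy'' : col' y = col z := by
    have := (hch y).1
    rw [rotate_y hzu hyz] at this
    exact this (hnP _ hz)
  have hmov : ∀ x Z, Reaches V E col u C (col u) Z → Z ≠ col z → Movable E col u x Z →
      Movable E col' z x Z := by
    intro x Z hZ hZz hx w hw hwZ
    by_contra hwz
    have hwy : w ≠ y := by
      rintro rfl
      exact hZz (hwZ.symm.trans hy'')
    have := hacc_eq w Z hZ hwZ hwy hwz
    exact this.1 (hx w hw this.2)
  have hkeep : ∀ x, Reaches V E col u C (col u) (col x) → col x ≠ col u → x ≠ z →
      col' x = col x := by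
    intro x hx hxu hxz
    have hxu' : x ≠ u := by rintro rfl; exact hxu rfl
    have hxy : x ≠ y := by
      rintro rfl
      have := hy.resolve_left hxu'
      rw [mem_sdiff, mem_accessible] at this
      exact this.2 hx
    have := (hch x).1
    rw [rotate_of_ne hxu' hxy hxz] at this
    exact this (hnP _ hx)
  have hbase : Reaches V E col' z C (col' z) (col u) := by
    have := hP.hole
    rw [← hz'] at this ⊢
    exact .base this
  have hwide : ∀ X, Reaches V E col u (C.erase (col z)) (col u) X →
      Reaches V E col u C (col u) X := fun X hX => hX.mono fun Y hY => (mem_erase.1 hY.mem).2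
  have hold : ∀ X, Reaches V E col u (C.erase (col z)) (col u) X →
      Reaches V E col' z C (col' z) X := by
    intro X hX
    induction hX with
    | base _ => exact hbase
    | @step x Z h1 h2 h3 h4 ih =>
      by_cases hxu : col x = col u
      · rw [hxu]; exact hbase
      have h5 : Reaches V E col u C (col u) (col x) := hwide _ (.step h1 h2 h3 h4)
      have hxz : x ≠ z := by
        rintro rfl
        simp at h1
      have e := hkeep x h5 hxu hxz
      have h6 := hmov x Z (hwide _ h4) (mem_erase.1 h4.mem).1 h3
      have := Reaches.step (col := col') (by rw [e]; exact h5.mem) h2 h6 ih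
      rwa [e] at this
  -- By `hb` the first step out of the class of `z` was not made by `z`, so it is still possible
  -- after the removal of `z`.
  have hnew : Reaches V E col' z C (col' z) (col z) := by
    obtain ⟨x, hx, Z, h1, h2, h3⟩ := hz.exists_first hzh
    have hZz := (mem_erase.1 h3.mem).1
    have hxz : x ≠ z := by
      rintro rfl
      exact hb Z hZz h3 h2
    have e := hkeep x (h1 ▸ hz) (h1 ▸ hzh) hxz
    have := Reaches.step (col := col') (by rw [e, h1]; exact hz.mem) hx
      (hmov x Z (hwide _ h3) hZz h2) (hold Z h3)
    rwa [e, h1] at this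
  -- The only obstacle was `z`, which has been taken out, and the newcomer `y` is not adjacent to
  -- `y'`. Thus the current class of `y'` becomes accessible.
  have hmy' : Movable E col' z y' (col z) := by
    intro w hw hwz
    by_contra hne
    have hwy : w ≠ y := by
      rintro rfl
      exact hE (hP.symm _ _ hw)
    have := hacc_eq w _ hz hwz hwy hne
    exact hne (hs'.2 w hw this.2 this.1)
  have hy'B : col' y' ∈ C \ accessible V E col u C := by
    have h1 : rotate col u y z y' ∈ C \ accessible V E col u C := by
      by_cases hyu' : y' = u
      · have hyu : y ≠ u := fun h => hyy' (h.trans hyu'.symm)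
        rw [hyu', rotate_u hzu hyu]
        exact hy.resolve_left hyu
      · rw [rotate_of_ne hyu' hyy'.symm hyz']
        exact hy'.resolve_left hyu'
    by_cases h : P (rotate col u y z y')
    · exact hPacc _ ((hch y').2 h)
    · rwa [(hch y').1 h]
  refine ⟨⟨hP.symm, hP.irrefl, hP.mem, hzV, fun X hX => hP.congr_size hsz hX, hz' ▸ hP.hole, ?_,
    ?_⟩, ?_⟩
  · intro v w hvw hv hw
    exact hpr v w hvw hv hw
  · intro v hv hvC
    simp only [hC]
    exact hP.degree v hv ((hC v).1 hvC)
  · refine ⟨fun X hX => ?_, fun hsub => ?_⟩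
    · rw [mem_accessible] at hX ⊢
      by_cases hXz : X = col z
      · rw [hXz]; exact hnew
      · exact hold X (hterm X hX hXz)
    · rw [mem_sdiff] at hy'B
      exact hy'B.2 (hsub (mem_accessible.2 (.step hy'B.1 hy'V hmy' hnew)))

end Rotate

end Coloring

end PeerAssessment

namespace PeerAssessment

/-! ### The program for the equitable coloring

Arrays of natural numbers: `3` the colors, `14` the number of vertices, `15` the number of colors,
`17` the colors under consideration, `18` the vertex to be inserted, `19` a flag, `20` the colors
that may be used for a search, `21` the color at which a search starts, `22` the stamps, a row for
each search, `23` the largest stamp, `24` and `25` the color and the vertex that are considered in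
a shift, `26` the number of the current row of stamps, `29`, `30` loop variables, `31` a flag, `32`
and `33` vertices, `34` an auxiliary variable, `35` the largest vertex of the current subgraph. -/

/-- Two vertices are adjacent if one is assigned to the other, or if they are different dummies;
vertices that exceed the number in the array `35` are isolated. -/
def Store.Edge (s : Store) (v w : ℕ) : Prop :=
  v ≤ s.nat 35 0 0 ∧ w ≤ s.nat 35 0 0 ∧
    ((v < s.nat 0 0 0 ∧ w < s.nat 0 0 0 ∧ (s.nat 2 v w = 1 ∨ s.nat 2 w v = 1)) ∨
      (s.nat 0 0 0 ≤ v ∧ s.nat 0 0 0 ≤ w ∧ v ≠ w))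

/-- The test for adjacency. -/
def edge (v w : NatExp) : Test :=
  .natLe v (scalar 35) ∧ₜ .natLe w (scalar 35) ∧ₜ
    .or (.lt v (scalar 0) ∧ₜ .lt w (scalar 0) ∧ₜ
        .or (.eq (.get 2 v w) (.const 1)) (.eq (.get 2 w v) (.const 1)))
      (.natLe (scalar 0) v ∧ₜ .natLe (scalar 0) w ∧ₜ .ne v w)

@[simp]
theorem holds_edge {v w : NatExp} {s : Store} :
    (edge v w).Holds s ↔ s.Edge (v.val s) (w.val s) := by
  simp [edge, Store.Edge]

theorem Store.edge_congr {s s' : Store} (h0 : s'.nat 0 = s.nat 0) (h2 : s'.nat 2 = s.nat 2)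
    (h35 : s'.nat 35 = s.nat 35) : s'.Edge = s.Edge := by
  unfold Store.Edge
  rw [h0, h2, h35]

@[simp]
theorem Store.edge_setNat (s : Store) {a : ℕ} (i j x : ℕ) (h0 : 0 ≠ a) (h2 : 2 ≠ a) (h35 : 35 ≠ a) :
    (s.setNat a i j x).Edge = s.Edge :=
  s.edge_congr (s.nat_setNat_ne _ _ _ h0) (s.nat_setNat_ne _ _ _ h2) (s.nat_setNat_ne _ _ _ h35)

theorem Agree.edge {d : ℕ} {s s' : Store} (h : Agree d s s') : s'.Edge = s.Edge :=
  s.edge_congr (h.nat 0 (by decide) (by decide)) (h.nat 2 (by decide) (by decide))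
    (h.nat 35 (by decide) (by decide))

/-- The memory contains a graph with `m` vertices and a coloring with `c` colors. -/
structure GraphStore (m c : ℕ) (E : ℕ → ℕ → Prop) (col : ℕ → ℕ) (s : Store) : Prop where
  size : s.nat 14 0 0 = m
  edge : ∀ v w, E v w ↔ v < m ∧ w < m ∧ s.Edge v w
  color : ∀ v, s.nat 3 v 0 = col v
  color_lt : ∀ v < m, col v < c
  -- Since colors are also numbers less than `m`, quantifiers over vertices and over colors share
  -- one bound.
  le : c ≤ m

section

variable {N m c : ℕ} {E : ℕ → ℕ → Prop} {col : ℕ → ℕ} {s s' : Store}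

theorem GraphStore.congr (h : GraphStore m c E col s) (h3 : s'.nat 3 = s.nat 3)
    (h14 : s'.nat 14 = s.nat 14) (he : s'.Edge = s.Edge) : GraphStore m c E col s' :=
  ⟨by rw [h14, h.size], by rw [he]; exact h.edge, by rw [h3]; exact h.color, h.color_lt, h.le⟩

theorem GraphStore.of_agree {d : ℕ} (h : GraphStore m c E col s) (hag : Agree d s s') :
    GraphStore m c E col s' :=
  h.congr (hag.nat 3 (by decide) (by decide)) (hag.nat 14 (by decide) (by decide)) hag.edge

theorem GraphStore.of_frame {p : Program} (h : GraphStore m c E col s) (hF : Frame p s s')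
    (h0 : p.writesNat 0 = false) (h2 : p.writesNat 2 = false) (h3 : p.writesNat 3 = false)
    (h14 : p.writesNat 14 = false) (h35 : p.writesNat 35 = false) : GraphStore m c E col s' :=
  h.congr (hF.nat 3 h3) (hF.nat 14 h14) (s.edge_congr (hF.nat 0 h0) (hF.nat 2 h2) (hF.nat 35 h35))

theorem GraphStore.movable_iff (h : GraphStore m c E col s) {u v X : ℕ} (hv : v < m) :
    Movable E col u v X ↔ ∀ w < m, s.Edge v w → col w = X → w = u := by
  simp only [Movable, h.edge]
  exact ⟨fun H w hw he => H w ⟨hv, hw, he⟩, fun H w he => H w he.2.1 he.2.2⟩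

theorem GraphStore.solo_iff (h : GraphStore m c E col s) {u z y : ℕ} (hz : z < m) (hy : y < m) :
    Solo E col u z y ↔ s.Edge z y ∧ ∀ w < m, s.Edge y w → col w = col z → w ≠ u → w = z := by
  simp only [Solo, h.edge]
  exact ⟨fun H => ⟨H.1.2.2, fun w hw he => H.2 w ⟨hy, hw, he⟩⟩,
    fun H => ⟨⟨hz, hy, H.1⟩, fun w he => H.2 w he.2.1 he.2.2⟩⟩

/-- The formula that says that `v` is movable to the color class `X`. -/
def movable (d : ℕ) (u v X : NatExp) : Fml :=
  .all 14 (.atom (.imp (edge v (bvar d) ∧ₜ .eq (entry 3 (bvar d)) X) (.eq (bvar d) u)))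

/-- The formula that says that `z` is the only neighbor of `y` in its color class. -/
def solo (d : ℕ) (u z y : NatExp) : Fml :=
  .and (.atom (edge z y))
    (.all 14 (.atom (.imp (edge y (bvar d) ∧ₜ .eq (entry 3 (bvar d)) (entry 3 z) ∧ₜ
      .ne (bvar d) u) (.eq (bvar d) z))))

/-- The row `r` of the stamps. -/
def stampRow (m r : ℕ) (s : Store) (Y : ℕ) : ℕ := if Y < m then s.nat 22 r Y else 0

/-- The stamps mark the color classes that reach `h`. -/
structure StampsFrom {α κ : Type*} (V : Finset α) (E : α → α → Prop) (col : α → κ) (u : α)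
    (D : Finset κ) (h : κ) (st : κ → ℕ) : Prop where
  pos_iff : ∀ Y, 0 < st Y ↔ Reaches V E col u D h Y
  pred : ∀ Y, 0 < st Y → Y = h ∨ ∃ x ∈ V, ∃ Z, col x = Y ∧ Movable E col u x Z ∧
    0 < st Z ∧ st Z < st Y

/-- The array `a` contains the indicator function of `D`. -/
def HasSet (m a : ℕ) (D : Finset ℕ) (s : Store) : Prop := ∀ X, X ∈ D ↔ X < m ∧ s.nat a X 0 = 1

def reachNext : Fml :=
  .ex 14 (.ex 14 (.and (.atom (.eq (.get 22 (scalar 26) (entry 3 (bvar 0))) (.const 0) ∧ₜ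
    .eq (entry 20 (entry 3 (bvar 0))) (.const 1) ∧ₜ
    .lt (.const 0) (.get 22 (scalar 26) (bvar 1)))) (movable 2 (scalar 18) (bvar 0) (bvar 1))))

/-- Mark the color classes that reach the one in the array `21`. -/
def reach : Program :=
  forLoop 30 14 (.setNat 22 (scalar 26) (scalar 30) (.const 0)) ;;
  assign 23 (.const 1) ;;
  .ite (.eq (entry 20 (scalar 21)) (.const 1)) (.setNat 22 (scalar 26) (scalar 21) (.const 1)) .skip ;;
  assign 31 (.const 1) ;;
  .while (.lt (.const 0) (scalar 31))
    (branch reachNext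
      (assign 23 (.add (scalar 23) (.const 1)) ;;
        .setNat 22 (scalar 26) (entry 3 (bvar 0)) (scalar 23))
      (assign 31 (.const 0)))

/-- A newly marked class receives the largest stamp, so the class that it leads to has a smaller
one. When no further class can be marked, the marked set is closed under `Reaches.step` and hence
complete. Other rows are preserved because several searches are stored side by side. -/
theorem wp_reach {u h r : ℕ} {D : Finset ℕ} (hN : m + 1 < N) (hG : GraphStore m c E col s)
    (hu : s.nat 18 0 0 = u) (hD : HasSet m 20 D s) (hh : s.nat 21 0 0 = h) (hhm : h < m)
    (hr : s.nat 26 0 0 = r) :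
    wp N reach (fun s' => StampsFrom (Finset.range m) E col u D h (stampRow m r s') ∧
      ∀ r', r' ≠ r → s'.nat 22 r' = s.nat 22 r') s := by
  refine wp_seq (wp_forLoop (fun i s' => (∀ X < i, s'.nat 22 r X = 0) ∧
    ∀ r', r' ≠ r → s'.nat 22 r' = s.nat 22 r') rfl rfl (by decide)
    (by rw [hG.size]; omega) (by simp) ?_ ?_)
  · intro i s₁ hi hF hv hI
    refine wp_setNat ?_
    have h26 : s₁.nat 26 0 0 = r := by rw [hF.nat 26 rfl, hr]
    simp [h26, hv]
    refine ⟨fun X hX h' => hI.1 X (by omega), fun r' hr' => ?_⟩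
    simp [hr', hI.2 r' hr']
  intro s₁ hF₁ ⟨hI1, hI2⟩
  rw [hG.size] at hI1
  have hG₁ := hG.of_frame hF₁ rfl rfl rfl rfl rfl
  have hu₁ : s₁.nat 18 0 0 = u := by rw [hF₁.nat 18 rfl, hu]
  have hh₁ : s₁.nat 21 0 0 = h := by rw [hF₁.nat 21 rfl, hh]
  have hr₁ : s₁.nat 26 0 0 = r := by rw [hF₁.nat 26 rfl, hr]
  have hD₁ : HasSet m 20 D s₁ := by unfold HasSet; rw [hF₁.nat 20 rfl]; exact hD
  have hDh := hD₁ h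
  refine wp_seq (wp_setNat (wp_seq ?_))
  -- the loop
  have key : ∀ s₂, GraphStore m c E col s₂ → s₂.nat 18 0 0 = u → s₂.nat 26 0 0 = r →
      HasSet m 20 D s₂ → s₂.nat 23 0 0 = 1 →
      (∀ X < m, s₂.nat 22 r X = if X = h ∧ h ∈ D then 1 else 0) →
      (∀ r', r' ≠ r → s₂.nat 22 r' = s.nat 22 r') →
      wp N (assign 31 (.const 1) ;;
        .while (.lt (.const 0) (scalar 31))
          (branch reachNext
            (assign 23 (.add (scalar 23) (.const 1)) ;;
              .setNat 22 (scalar 26) (entry 3 (bvar 0)) (scalar 23))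
            (assign 31 (.const 0))))
        (fun s' => StampsFrom (Finset.range m) E col u D h (stampRow m r s') ∧
          ∀ r', r' ≠ r → s'.nat 22 r' = s.nat 22 r') s₂ := by
    intro s₂ hG₂ hu₂ hr₂ hD₂ h23 hst hrow
    refine wp_seq (wp_setNat (wp_while (fun s' =>
      (∀ X < m, 0 < s'.nat 22 r X → Reaches (Finset.range m) E col u D h X) ∧
      (∀ X < m, s'.nat 22 r X ≤ s'.nat 23 0 0) ∧
      (∀ Y < m, 0 < s'.nat 22 r Y → Y = h ∨ ∃ x < m, ∃ Z < m, col x = Y ∧ Movable E col u x Z ∧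
        0 < s'.nat 22 r Z ∧ s'.nat 22 r Z < s'.nat 22 r Y) ∧
      (h ∈ D → 0 < s'.nat 22 r h) ∧ s'.nat 31 0 0 ≤ 1 ∧
      (s'.nat 31 0 0 = 0 → ∀ x < m, ∀ Z < m, 0 < s'.nat 22 r Z → Movable E col u x Z →
        col x ∈ D → 0 < s'.nat 22 r (col x)) ∧
      ∀ r', r' ≠ r → s'.nat 22 r' = s.nat 22 r')
      (fun s' => ((Finset.range m).filter fun X => s'.nat 22 r X = 0).card + s'.nat 31 0 0)
      ?_ ?_ ?_ ?_))
    · simp only [NatExp.val, Store.nat_setNat_ne, ne_eq, Nat.reduceEqDiff, not_false_eq_true]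
      refine ⟨fun X hX h1 => ?_, fun X hX => ?_, fun Y hY h1 => ?_, fun h1 => ?_, ?_, ?_, hrow⟩
      · rw [hst X hX] at h1
        split_ifs at h1 with h2
        · rw [h2.1]; exact .base h2.2
        · omega
      · rw [hst X hX, h23]
        split_ifs <;> omega
      · rw [hst Y hY] at h1
        split_ifs at h1 with h2
        · exact .inl h2.1
        · omega
      · rw [hst h hhm, if_pos ⟨rfl, h1⟩]
        omega
      · simp
      · simp
    · have := Finset.card_filter_le (Finset.range m)
        (fun X => (s₂.setNat 31 0 0 1).nat 22 r X = 0)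
      rw [Finset.card_range] at this
      simp at this ⊢
      omega
    · rintro s₃ hF₃ ⟨h1, h2, h3, h4, h5, h6, h7⟩ hb
      simp at hb
      have hs₂ : GraphStore m c E col (s₂.setNat 31 0 0 1) :=
        hG₂.congr (by simp) (by simp) (by simp)
      have hG₃ := hs₂.of_frame hF₃ rfl rfl rfl rfl rfl
      have hu₃ : s₃.nat 18 0 0 = u := by rw [hF₃.nat 18 rfl]; simpa using hu₂
      have hr₃ : s₃.nat 26 0 0 = r := by rw [hF₃.nat 26 rfl]; simpa using hr₂
      have hD₃ : HasSet m 20 D s₃ := by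
        unfold HasSet; rw [hF₃.nat 20 rfl]; simpa [HasSet] using hD₂
      refine wp_branch rfl ?_ ?_ ?_
      · simp [reachNext, movable, hG₃.size]
        omega
      · intro s₄ hag hw
        simp [reachNext, movable, hag.nat, hag.edge, hG₃.size, hu₃, hr₃, hG₃.color] at hw
        generalize hx0 : s₄.nat 100 0 0 = x at hw
        generalize s₄.nat 100 1 0 = Z at hw
        obtain ⟨hx, hZ, ⟨hst0, hxD, hZpos⟩, hm⟩ := hw
        have hcx : col x < m := (hG₃.color_lt x hx).trans_le hG₃.le
        have hmov : Movable E col u x Z := (hG₃.movable_iff hx).2 hm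
        have hxD' : col x ∈ D := (hD₃ _).2 ⟨hcx, hxD⟩
        have hZne : Z ≠ col x := by intro h'; rw [h'] at hZpos; omega
        refine wp_seq (wp_setNat (wp_setNat ?_))
        simp [hag.nat, hr₃, hG₃.color, hx0]
        refine ⟨⟨?_, ?_, ?_, ?_, ?_, ?_, ?_⟩, ?_⟩
        · intro X hX
          split_ifs with h'
          · intro _
            rw [h']
            exact .step hxD' (Finset.mem_range.2 hx) hmov (h1 Z hZ hZpos)
          · exact h1 X hX
        · intro X hX
          have := h2 X hX
          split_ifs <;> omega
        · intro Y hY hpos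
          by_cases hYx : Y = col x
          · subst hYx
            refine .inr ⟨x, hx, Z, hZ, rfl, hmov, ?_, ?_⟩
            · simpa [hZne] using hZpos
            · have := h2 Z hZ
              simp [hZne]
              omega
          · simp only [hYx, if_false] at hpos ⊢
            rcases h3 Y hY hpos with h' | ⟨x', hx', Z', hZ', e, hm', p1, p2⟩
            · exact .inl h'
            · have : Z' ≠ col x := by intro h'; rw [h'] at p1; omega
              exact .inr ⟨x', hx', Z', hZ', e, hm', by simpa [this] using p1,
                by simpa [this] using p2⟩
        · intro hhD
          have := h4 hhD
          split_ifs <;> omega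
        · exact h5
        · intro h'
          omega
        · intro r' hr'
          simp [hr', h7 r' hr']
        · refine Finset.card_lt_card ⟨fun X hX => ?_, fun hsub => ?_⟩
          · simp only [Finset.mem_filter] at hX ⊢
            refine ⟨hX.1, ?_⟩
            have := hX.2
            split_ifs at this
            exact this
          · have := @hsub (col x) (by simp [hcx, hst0])
            simp at this
      · intro s₄ hag hw
        refine wp_setNat ?_
        simp [hag.nat]
        refine ⟨⟨h1, h2, ?_, h4, ?_, h7⟩, hb⟩
        · exact h3
        · intro x hx Z hZ hZpos hm hxD
          by_contra hcon
          refine hw ?_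
          simp [reachNext, movable, hG₃.size, hu₃, hr₃, hG₃.color]
          refine ⟨x, hx, Z, hZ, ⟨by omega, ((hD₃ _).1 hxD).2, hZpos⟩, ?_⟩
          exact (hG₃.movable_iff hx).1 hm
    · rintro s₃ hF₃ ⟨h1, h2, h3, h4, h5, h6, h7⟩ hb
      simp at hb
      have h6 := h6 hb
      refine ⟨⟨fun Y => ⟨fun hY => ?_, fun hY => ?_⟩, fun Y hY => ?_⟩, h7⟩
      · unfold stampRow at hY
        split_ifs at hY with h'
        · exact h1 Y h' hY
        · omega
      · induction hY with
        | base hm => simpa [stampRow, hhm] using h4 hm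
        | @step x Z hx1 hx2 hx3 hx4 ih =>
          have hx := Finset.mem_range.1 hx2
          have hcx : col x < m := (hG₂.color_lt x hx).trans_le hG₂.le
          have hZm : Z < m := ((hD₂ _).1 hx4.mem).1
          simp only [stampRow, hcx, hZm, if_true] at ih ⊢
          exact h6 x hx Z hZm ih hx3 hx1
      · unfold stampRow at hY
        split_ifs at hY with h'
        swap
        · omega
        rcases h3 Y h' hY with h'' | ⟨x, hx, Z, hZ, e, hm, p1, p2⟩
        · exact .inl h''
        · exact .inr ⟨x, Finset.mem_range.2 hx, Z, e, hm, by simpa [stampRow, hZ] using p1,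
            by simpa [stampRow, hZ, h'] using p2⟩
  refine wp_ite (fun hb => wp_setNat ?_) (fun hb => wp_skip ?_)
  · simp [hh₁] at hb
    have hhD : h ∈ D := hDh.2 ⟨hhm, hb⟩
    simp only [NatExp.val]
    refine key _ (hG₁.congr (by simp) (by simp) (by simp)) (by simpa using hu₁)
      (by simpa using hr₁) (by simpa [HasSet] using hD₁) (by simp) ?_ ?_
    · intro X hX
      simp [hr₁, hh₁, hhD, hI1 X hX]
    · intro r' hr'
      simp [hr₁, hr', hI2 r' hr']
  · simp [hh₁] at hb
    have hhD : h ∉ D := fun h' => hb (hDh.1 h').2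
    refine key _ (hG₁.congr (by simp) (by simp) (by simp)) (by simpa using hu₁)
      (by simpa using hr₁) (by simpa [HasSet] using hD₁) (by simp) ?_ ?_
    · intro X hX
      simp [hhD, hI1 X hX]
    · intro r' hr'
      simp [hI2 r' hr']

end

end PeerAssessment

/-! ### Executing shifts and rotations on the stored coloring -/

namespace PeerAssessment

section

variable {N m c : ℕ} {E : ℕ → ℕ → Prop} {col : ℕ → ℕ} {s s' : Store}

theorem GraphStore.exchange {v w : ℕ} (h : GraphStore m c E col s) (hv : v < m) (hw : w < m)
    (h3 : ∀ x, s'.nat 3 x 0 = exchange col v w x) (h14 : s'.nat 14 = s.nat 14)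
    (he : s'.Edge = s.Edge) : GraphStore m c E (exchange col v w) s' := by
  refine ⟨by rw [h14, h.size], by rw [he]; exact h.edge, h3, fun x hx => ?_, h.le⟩
  unfold PeerAssessment.exchange
  split_ifs
  · exact h.color_lt w hw
  · exact h.color_lt v hv
  · exact h.color_lt x hx

def shiftNext : Fml :=
  .ex 14 (.ex 14 (.and (.atom (.eq (entry 3 (bvar 0)) (scalar 24) ∧ₜ
    .lt (.const 0) (.get 22 (scalar 26) (bvar 1)) ∧ₜ
    .lt (.get 22 (scalar 26) (bvar 1)) (.get 22 (scalar 26) (scalar 24))))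
    (movable 2 (scalar 25) (bvar 0) (bvar 1))))

/-- Move the vertex in the array `25` to the color class in the array `24`, a vertex of this class
to the next one, and so on, until the color in the array `21` is reached. -/
def shift : Program :=
  .while (.ne (scalar 24) (scalar 21))
    (branch shiftNext
      (.setNat 3 (scalar 25) (.const 0) (scalar 24) ;;
        .setNat 3 (bvar 0) (.const 0) (scalar 21) ;;
        assign 25 (bvar 0) ;;
        assign 24 (bvar 1))
      (assign 24 (scalar 21)))

/-- `Shifting.stamps` guarantees a next step until the hole is reached, so the second branch is
never taken. The variant counts the marked classes with stamps below that of the current class. -/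
theorem wp_shift {v h X r : ℕ} {L : Set ℕ} (hN : m < N) (hG : GraphStore m c E col s)
    (symm : ∀ a b, E a b → E b a) (irrefl : ∀ a, ¬ E a a)
    (hv : s.nat 25 0 0 = v) (hX : s.nat 24 0 0 = X) (hh : s.nat 21 0 0 = h) (hr : s.nat 26 0 0 = r)
    (hs : Shifting (Finset.range m) E col L v h X (stampRow m r s)) (hpos : 0 < stampRow m r s h) :
    wp N shift (fun s' => ∃ col', GraphStore m c E col' s' ∧ ProperOutside E col' L ∧
      SameSizes (Finset.range m) col col' ∧ ChangesOnly (fun Y => 0 < stampRow m r s Y) col col')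
      s := by
  set st := stampRow m r s with hst
  refine wp_while (fun s' => ∃ col', GraphStore m c E col' s' ∧
    Shifting (Finset.range m) E col' L (s'.nat 25 0 0) h (s'.nat 24 0 0) st ∧
    SameSizes (Finset.range m) col col' ∧ ChangesOnly (fun Y => 0 < st Y) col col')
    (fun s' => ((Finset.range m).filter fun Y => 0 < st Y ∧ st Y < st (s'.nat 24 0 0)).card)
    ⟨col, hG, by rwa [hv, hX], fun _ => rfl, .refl _ _⟩ ?_ ?_ ?_
  · have := Finset.card_filter_le (Finset.range m)
        (fun Y => 0 < st Y ∧ st Y < st (s.nat 24 0 0))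
    rw [Finset.card_range] at this
    omega
  · rintro s₁ hF ⟨col', hG₁, hs₁, hsz, hch⟩ hb
    have hh₁ : s₁.nat 21 0 0 = h := by rw [hF.nat 21 rfl, hh]
    have hr₁ : s₁.nat 26 0 0 = r := by rw [hF.nat 26 rfl, hr]
    have h22 : s₁.nat 22 = s.nat 22 := hF.nat 22 rfl
    simp [hh₁] at hb
    generalize hv' : s₁.nat 25 0 0 = v' at hs₁
    generalize hX' : s₁.nat 24 0 0 = X' at hs₁ hb
    have hXm : X' < m := by
      have := hs₁.pos
      by_contra hcon
      simp [hst, stampRow, hcon] at this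
    refine wp_branch rfl ?_ ?_ ?_
    · simp [shiftNext, movable, hG₁.size, hN]
    · intro s₂ hag hw
      simp [shiftNext, movable, hag.nat, hag.edge, hG₁.size, hG₁.color, hr₁, h22, hv', hX'] at hw
      generalize hx0 : s₂.nat 100 0 0 = x at hw
      generalize hZ0 : s₂.nat 100 1 0 = Z at hw
      obtain ⟨hx, hZ, ⟨hcx, hZpos, hZlt⟩, hm⟩ := hw
      have hmov : Movable E col' v' x Z := (hG₁.movable_iff hx).2 hm
      have hZpos' : 0 < st Z := by simpa [hst, stampRow, hZ] using hZpos
      have hZlt' : st Z < st X' := by simpa [hst, stampRow, hZ, hXm] using hZlt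
      have hstep := hs₁.step symm irrefl hb (Finset.mem_range.2 hx) hcx hmov hZpos' hZlt'
      refine wp_seq (wp_setNat (wp_seq (wp_setNat (wp_seq (wp_setNat (wp_setNat ?_))))))
      simp only [NatExp.val, hag.nat, Store.nat_setNat_ne, ne_eq, Nat.reduceEqDiff,
        not_false_eq_true, hv', hX', hh₁, hx0, hZ0]
      refine ⟨⟨exchange col' v' x, ?_, ?_, ?_, ?_⟩, ?_⟩
      · refine hG₁.exchange (Finset.mem_range.1 hs₁.mem) hx ?_ ?_ ?_
        · intro w
          simp [hag.nat, hG₁.color, exchange, hs₁.hole, hcx]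
          split_ifs with h1 h2
          · rw [← hcx, ← h1, h2, hs₁.hole]
          all_goals rfl
        · simp [hag.nat]
        · simp [hag.edge]
      · simpa using hstep
      · exact hsz.trans (sameSizes_exchange hs₁.mem (Finset.mem_range.2 hx))
      · refine hch.trans (changesOnly_exchange ?_ ?_)
        · rwa [hs₁.hole]
        · rw [hcx]; exact hs₁.pos
      · simp
        refine Finset.card_lt_card ⟨fun Y hY => ?_, fun hsub => ?_⟩
        · simp only [Finset.mem_filter] at hY ⊢
          exact ⟨hY.1, hY.2.1, hY.2.2.trans hZlt'⟩
        · have := @hsub Z (by simp [hZ, hZpos', hZlt'])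
          simp at this
    · intro s₂ hag hw
      exfalso
      refine hw ?_
      obtain ⟨x, hx, Z, h1, h2, h3, h4⟩ := (hs₁.stamps X' hs₁.pos le_rfl).resolve_left hb
      have hx := Finset.mem_range.1 hx
      have hZm : Z < m := by
        by_contra hcon
        simp [hst, stampRow, hcon] at h3
      simp [shiftNext, movable, hG₁.size, hG₁.color, hr₁, h22, hv', hX']
      refine ⟨x, hx, Z, hZm, ⟨h1, ?_, ?_⟩, (hG₁.movable_iff hx).1 h2⟩
      · simpa [hst, stampRow, hZm] using h3
      · simpa [hst, stampRow, hZm, hXm] using h4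
  · rintro s₁ hF ⟨col', hG₁, hs₁, hsz, hch⟩ hb
    have hh₁ : s₁.nat 21 0 0 = h := by rw [hF.nat 21 rfl, hh]
    simp [hh₁] at hb
    rw [hb] at hs₁
    exact ⟨col', hG₁, hs₁.finish symm irrefl, hsz, hch⟩

/-- Exchange the colors of the vertices in the arrays `a` and `b`. -/
def swapColors (a b : ℕ) : Program :=
  assign 34 (entry 3 (scalar a)) ;;
  .setNat 3 (scalar a) (.const 0) (entry 3 (scalar b)) ;;
  .setNat 3 (scalar b) (.const 0) (scalar 34)

/-- Let the vertices in the arrays `18`, `33`, `32` rotate their colors. -/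
def rotateColors : Program := swapColors 18 33 ;; swapColors 33 32

theorem wp_swapColors {a b v w : ℕ} (hG : GraphStore m c E col s) (ha34 : a ≠ 34)
    (hb3 : b ≠ 3) (hb34 : b ≠ 34) (hv : s.nat a 0 0 = v) (hw : s.nat b 0 0 = w) (hvm : v < m)
    (hwm : w < m) : wp N (swapColors a b) (GraphStore m c E (exchange col v w)) s := by
  refine wp_seq (wp_setNat (wp_seq (wp_setNat (wp_setNat ?_))))
  refine hG.exchange hvm hwm (fun x => ?_) (by simp) (by simp)
  simp [ha34, hb3, hb34, hv, hw, hG.color, exchange]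
  split_ifs with h1 h2
  · rw [← h1, h2]
  all_goals rfl

theorem wp_rotateColors {u y z : ℕ} (hG : GraphStore m c E col s)
    (hu : s.nat 18 0 0 = u) (hy : s.nat 33 0 0 = y) (hz : s.nat 32 0 0 = z) (hum : u < m)
    (hym : y < m) (hzm : z < m) : wp N rotateColors (GraphStore m c E (rotate col u y z)) s := by
  refine wp_seq ((wp_swapColors hG (by decide) (by decide) (by decide) hu hy hum
    hym).mono fun s₁ hF hG₁ => ?_)
  refine wp_swapColors hG₁ (by decide) (by decide) (by decide) ?_ ?_ hym hzm
  · rw [hF.nat 33 rfl, hy]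
  · rw [hF.nat 32 rfl, hz]

end

end PeerAssessment

/-! ### Computing all reachability relations among the color classes -/

namespace PeerAssessment

section

variable {N m c : ℕ} {E : ℕ → ℕ → Prop} {col : ℕ → ℕ} {s s' : Store}

theorem stampRow_congr {r : ℕ} (h : s'.nat 22 r = s.nat 22 r) :
    stampRow m r s' = stampRow m r s := by
  funext Y
  simp [stampRow, h]

@[simp]
theorem stampRow_setNat {a r : ℕ} (i j x : ℕ) (h : 22 ≠ a) :
    stampRow m r (s.setNat a i j x) = stampRow m r s := stampRow_congr (by simp [h])

/-- Put the indicator function of the numbers, held by the array `30`, that pass the test `b` into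
the array `a`. -/
def select (a : ℕ) (b : Test) : Program :=
  forLoop 30 14 (.ite b (.setNat a (scalar 30) (.const 0) (.const 1))
    (.setNat a (scalar 30) (.const 0) (.const 0)))

/-- When the test is made for `i`, the entry `i` still has its old value; an array can thus be
filtered in place. -/
theorem wp_select {a : ℕ} {b : Test} (P : ℕ → Prop) (hm : s.nat 14 0 0 = m) (hN : m ≤ N)
    (h14 : a ≠ 14) (h30 : a ≠ 30)
    (hP : ∀ i < m, ∀ s', Frame (select a b) s s' → s'.nat 30 0 0 = i →
      s'.nat a i 0 = s.nat a i 0 → (b.Holds s' ↔ P i)) :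
    wp N (select a b) (fun s' => ∀ X < m, s'.nat a X 0 = 1 ↔ P X) s := by
  refine wp_forLoop (fun i s' => (∀ X < i, s'.nat a X 0 = 1 ↔ P X) ∧
    ∀ X, i ≤ X → s'.nat a X 0 = s.nat a X 0) (by simp [Program.writesNat, h30.symm])
    (by simp [Program.writesNat, h14.symm]) (by decide) (by omega) (by simp [h30]) ?_ ?_
  · intro i s₁ hi hF hv hI
    have hb := hP i (by omega) s₁ hF hv (hI.2 i le_rfl)
    refine wp_ite (fun h => wp_setNat ?_) (fun h => wp_setNat ?_) <;> rw [hb] at h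
    · simp [h30, hv]
      refine ⟨fun X hX => ?_, fun X hX => ?_⟩
      · by_cases hXi : X = i
        · simp [hXi, h]
        · simpa [hXi] using hI.1 X (by omega)
      · rw [if_neg (by omega)]
        exact hI.2 X (by omega)
    · simp [h30, hv]
      refine ⟨fun X hX => ?_, fun X hX => ?_⟩
      · by_cases hXi : X = i
        · simp [hXi, h]
        · simpa [hXi] using hI.1 X (by omega)
      · rw [if_neg (by omega)]
        exact hI.2 X (by omega)
  · intro s₁ hF hI
    rw [hm] at hI
    exact hI.1

/-- The color class `X` has been found to be accessible. -/
def isAccessible (X : NatExp) : Test :=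
  .lt (.const 0) (.get 22 (.add (scalar 14) (scalar 14)) X)

@[simp]
theorem holds_isAccessible {X : NatExp} : (isAccessible X).Holds s ↔
    0 < s.nat 22 (s.nat 14 0 0 + s.nat 14 0 0) (X.val s) := Iff.rfl

/-- Find the accessible color classes, those that remain accessible when a given class is removed,
and those that reach a given class without using accessible classes. -/
def survey : Program :=
  select 20 (.eq (entry 17 (scalar 30)) (.const 1)) ;;
  assign 21 (entry 3 (scalar 18)) ;;
  assign 26 (.add (scalar 14) (scalar 14)) ;;
  reach ;;
  forLoop 29 14
    (select 20 (.eq (entry 17 (scalar 30)) (.const 1) ∧ₜ .ne (scalar 30) (scalar 29)) ;;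
      assign 26 (scalar 29) ;;
      reach) ;;
  select 20 (.eq (entry 17 (scalar 30)) (.const 1) ∧ₜ .not (isAccessible (scalar 30))) ;;
  forLoop 29 14
    (assign 21 (scalar 29) ;;
      assign 26 (.add (scalar 14) (scalar 29)) ;;
      reach)

/-- The result of the survey. -/
structure Surveyed (m : ℕ) (E : ℕ → ℕ → Prop) (col : ℕ → ℕ) (u : ℕ) (C : Finset ℕ) (s : Store) :
    Prop where
  all : StampsFrom (Finset.range m) E col u C (col u) (stampRow m (m + m) s)
  without : ∀ W < m, ∀ D : Finset ℕ, (∀ X, X ∈ D ↔ X ≠ W ∧ X ∈ C) →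
    StampsFrom (Finset.range m) E col u D (col u) (stampRow m W s)
  rest : ∀ Y < m, ∀ D : Finset ℕ, (∀ X, X ∈ D ↔ X ∈ C ∧ ¬ 0 < stampRow m (m + m) s X) →
    StampsFrom (Finset.range m) E col u D Y (stampRow m (m + Y) s)

/-- The rows do not collide: `W < m` for the search without `W`, `m + Y < m + m` for the search that
ends in `Y`, and `m + m` for the accessible classes. The last is computed first because it
determines the colors allowed in the searches that end in `Y`. -/
theorem wp_survey {u : ℕ} {C : Finset ℕ} (hN : m + 1 < N) (hG : GraphStore m c E col s)
    (hu : s.nat 18 0 0 = u) (hum : u < m) (hC : HasSet m 17 C s) :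
    wp N survey (Surveyed m E col u C) s := by
  have hcu : col u < m := (hG.color_lt u hum).trans_le hG.le
  refine wp_seq ((wp_select (fun X => s.nat 17 X 0 = 1) hG.size (by omega) (by decide) (by decide)
    ?_).mono fun s₁ hF₁ h₁ => ?_)
  · intro i hi s' hF hv _
    simp [hv, hF.nat 17 rfl]
  have hG₁ := hG.of_frame hF₁ rfl rfl rfl rfl rfl
  refine wp_seq (wp_setNat (wp_seq (wp_setNat (wp_seq ?_))))
  have hu₁ : s₁.nat 18 0 0 = u := by rw [hF₁.nat 18 rfl, hu]
  simp [hu₁, hG₁.size, hG₁.color]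
  set s₂ := (s₁.setNat 21 0 0 (col u)).setNat 26 0 0 (m + m) with hs₂
  have hG₂ : GraphStore m c E col s₂ := hG₁.congr (by simp [hs₂]) (by simp [hs₂]) (by simp [hs₂])
  have hC₂ : HasSet m 17 C s₂ := by
    unfold HasSet at hC ⊢
    simpa [hs₂, hF₁.nat 17 rfl] using hC
  have hD₂ : HasSet m 20 C s₂ := by
    intro X
    rw [hC X]
    refine and_congr_right fun hX => ?_
    simp [hs₂, h₁ X hX]
  have hu₂ : s₂.nat 18 0 0 = u := by simp [hs₂, hu₁]
  have h21₂ : s₂.nat 21 0 0 = col u := by simp [hs₂]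
  have h26₂ : s₂.nat 26 0 0 = m + m := by simp [hs₂]
  clear_value s₂
  refine (wp_reach hN hG₂ hu₂ hD₂ h21₂ hcu h26₂).mono fun s₃ hF₃ h₃ => wp_seq ?_
  have hG₃ := hG₂.of_frame hF₃ rfl rfl rfl rfl rfl
  have hC₃ : HasSet m 17 C s₃ := by
    unfold HasSet at hC₂ ⊢
    rwa [hF₃.nat 17 rfl]
  have hu₃ : s₃.nat 18 0 0 = u := by rw [hF₃.nat 18 rfl, hu₂]
  have h21₃ : s₃.nat 21 0 0 = col u := by rw [hF₃.nat 21 rfl, h21₂]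
  refine wp_forLoop (fun i s' =>
    StampsFrom (Finset.range m) E col u C (col u) (stampRow m (m + m) s') ∧
    ∀ W < i, StampsFrom (Finset.range m) E col u (C.filter fun X => X ≠ W) (col u)
      (stampRow m W s')) rfl rfl (by decide) (by rw [hG₃.size]; omega) (by simpa using h₃.1) ?_ ?_
  · intro i s₄ hi hF₄ hv hI
    rw [hG₃.size] at hi
    have hG₄ := hG₃.of_frame hF₄ rfl rfl rfl rfl rfl
    have hu₄ : s₄.nat 18 0 0 = u := by rw [hF₄.nat 18 rfl, hu₃]
    have h21₄ : s₄.nat 21 0 0 = col u := by rw [hF₄.nat 21 rfl, h21₃]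
    have hC₄ : HasSet m 17 C s₄ := by
      unfold HasSet at hC₃ ⊢
      rwa [hF₄.nat 17 rfl]
    refine wp_seq ((wp_select (fun X => s₄.nat 17 X 0 = 1 ∧ X ≠ i) hG₄.size (by omega) (by decide)
      (by decide) ?_).mono fun s₅ hF₅ h₅ => wp_seq (wp_setNat ?_))
    · intro j hj s' hF hv' _
      simp [hv', hF.nat 17 rfl, hF.nat 29 rfl, hv]
    have hG₅ := hG₄.of_frame hF₅ rfl rfl rfl rfl rfl
    have h29 : s₅.nat 29 0 0 = i := by rw [hF₅.nat 29 rfl, hv]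
    simp [h29]
    refine (wp_reach (u := u) (h := col u) (r := i) (D := C.filter fun X => X ≠ i) hN
      (hG₅.congr (by simp) (by simp) (by simp)) ?_ ?_ ?_ hcu (by simp)).mono fun s₆ hF₆ h₆ => ?_
    · simp [hF₅.nat 18 rfl, hu₄]
    · intro X
      rw [Finset.mem_filter, hC₄ X, and_assoc]
      refine and_congr_right fun hX => ?_
      simp [h₅ X hX]
    · simp [hF₅.nat 21 rfl, h21₄]
    · have hrow : ∀ r, r ≠ i → stampRow m r s₆ = stampRow m r s₄ := by
        intro r hr
        refine stampRow_congr ?_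
        rw [h₆.2 r hr]
        simp [hF₅.nat 22 rfl]
      rw [hrow _ (by omega)]
      refine ⟨hI.1, fun W hW => ?_⟩
      by_cases hWi : W = i
      · rw [hWi]; exact h₆.1
      · rw [hrow W hWi]
        exact hI.2 W (by omega)
  intro s₄ hF₄ ⟨hall, hwo⟩
  rw [hG₃.size] at hwo
  have hG₄ := hG₃.of_frame hF₄ rfl rfl rfl rfl rfl
  have hu₄ : s₄.nat 18 0 0 = u := by rw [hF₄.nat 18 rfl, hu₃]
  have hC₄ : HasSet m 17 C s₄ := by
    unfold HasSet at hC₃ ⊢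
    rwa [hF₄.nat 17 rfl]
  refine wp_seq ((wp_select (fun X => s₄.nat 17 X 0 = 1 ∧ ¬ 0 < stampRow m (m + m) s₄ X) hG₄.size
    (by omega) (by decide) (by decide) ?_).mono fun s₅ hF₅ h₅ => ?_)
  · intro j hj s' hF hv' _
    simp [hv', hF.nat 17 rfl, hF.nat 22 rfl, hF.nat 14 rfl, stampRow, hj, hG₄.size]
  have hG₅ := hG₄.of_frame hF₅ rfl rfl rfl rfl rfl
  have hu₅ : s₅.nat 18 0 0 = u := by rw [hF₅.nat 18 rfl, hu₄]
  set D := C.filter fun X => ¬ 0 < stampRow m (m + m) s₄ X with hD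
  have hD₅ : HasSet m 20 D s₅ := by
    intro X
    rw [hD, Finset.mem_filter, hC₄ X, and_assoc]
    exact and_congr_right fun hX => (h₅ X hX).symm
  refine wp_forLoop (fun i s' => (∀ r, r < m ∨ r = m + m → stampRow m r s' = stampRow m r s₄) ∧
    ∀ Y < i, StampsFrom (Finset.range m) E col u D Y (stampRow m (m + Y) s')) rfl rfl (by decide)
    (by rw [hG₅.size]; omega) ?_ ?_ ?_
  · refine ⟨fun r hr => ?_, by simp⟩
    simp only [stampRow_setNat, ne_eq, Nat.reduceEqDiff, not_false_eq_true]
    exact stampRow_congr (by rw [hF₅.nat 22 rfl])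
  · intro i s₆ hi hF₆ hv hI
    rw [hG₅.size] at hi
    have hG₆ := hG₅.of_frame hF₆ rfl rfl rfl rfl rfl
    refine wp_seq (wp_setNat (wp_seq (wp_setNat ?_)))
    simp [hv, hG₆.size]
    refine (wp_reach (u := u) (h := i) (r := m + i) (D := D) hN
      (hG₆.congr (by simp) (by simp) (by simp)) ?_ ?_ ?_ hi (by simp)).mono fun s₇ hF₇ h₇ => ?_
    · simp [hF₆.nat 18 rfl, hu₅]
    · unfold HasSet at hD₅ ⊢
      simpa [hF₆.nat 20 rfl] using hD₅
    · simp
    · have hrow : ∀ r, r ≠ m + i → stampRow m r s₇ = stampRow m r s₆ := by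
        intro r hr
        refine stampRow_congr ?_
        rw [h₇.2 r hr]
        simp
      refine ⟨fun r hr => ?_, fun Y hY => ?_⟩
      · rw [hrow r (by omega), hI.1 r hr]
      · by_cases hYi : Y = i
        · rw [hYi]; exact h₇.1
        · rw [hrow _ (by omega)]
          exact hI.2 Y (by omega)
  · intro s₆ hF₆ ⟨hI1, hI2⟩
    rw [hG₅.size] at hI2
    refine ⟨?_, fun W hW D' hD' => ?_, fun Y hY D' hD' => ?_⟩
    · rw [hI1 _ (.inr rfl)]
      exact hall
    · rw [hI1 _ (.inl hW)]
      have : D' = C.filter fun X => X ≠ W := by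
        ext X
        rw [hD', Finset.mem_filter, and_comm]
      rw [this]
      exact hwo W hW
    · have : D' = D := by
        ext X
        rw [hD', hD, Finset.mem_filter, hI1 _ (.inr rfl)]
      rw [this]
      exact hI2 Y hY

end

end PeerAssessment

/-! ### The three recoloring moves -/

namespace PeerAssessment

section

variable {N m c q u : ℕ} {E : ℕ → ℕ → Prop} {col : ℕ → ℕ} {C : Finset ℕ} {s s' : Store}

/-- Insert the vertex in the array `18` by a shift to an accessible color class. -/
def insertDirectly : Program :=
  assign 24 (bvar 0) ;;
  assign 26 (.add (scalar 14) (scalar 14)) ;;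
  assign 21 (entry 3 (scalar 18)) ;;
  assign 25 (scalar 18) ;;
  shift ;;
  assign 19 (.const 0)

theorem stampRow_pos_lt {r Y : ℕ} (h : 0 < stampRow m r s Y) : Y < m := by
  by_contra hcon
  simp [stampRow, hcon] at h

theorem stampRow_eq {r Y : ℕ} (h : Y < m) : stampRow m r s Y = s.nat 22 r Y := if_pos h

theorem wp_insertDirectly {X : ℕ} (hN : m < N) (hG : GraphStore m c E col s)
    (hu : s.nat 18 0 0 = u) (hS : Surveyed m E col u C s)
    (hP : Pending (Finset.range m) E col q u C) (hX : s.nat 100 0 0 = X)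
    (hpos : 0 < stampRow m (m + m) s X) (hm : Movable E col u u X) :
    wp N insertDirectly (fun s' => ∃ col', GraphStore m c E col' s' ∧
      SameSizes (Finset.range m) col col' ∧ ProperOutside E col' ∅ ∧ s'.nat 19 0 0 = 0) s := by
  refine wp_seq (wp_setNat (wp_seq (wp_setNat (wp_seq (wp_setNat (wp_seq (wp_setNat
    (wp_seq ?_))))))))
  simp [hX, hG.size, hG.color, hu]
  refine (wp_shift (v := u) (h := col u) (X := X) (r := m + m) (L := ∅) hN
    (hG.congr (by simp) (by simp) (by simp)) hP.symm hP.irrefl (by simp) (by simp) (by simp)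
    (by simp) ?_ ?_).mono fun s₁ hF h₁ => wp_setNat ?_
  · simp
    refine ⟨hP.mem_u, rfl, ?_, hm, hpos, fun Y hY _ => hS.all.pred Y hY⟩
    intro a b hab ha hb
    simp at ha hb
    exact hP.proper a b hab ha hb
  · simp
    exact (hS.all.pos_iff _).2 (.base hP.hole)
  · obtain ⟨col', hG₁, hpr, hsz, -⟩ := h₁
    exact ⟨col', hG₁.congr (by simp) (by simp) (by simp), hsz, hpr, by simp⟩

/-- Insert a vertex into the color class of its only neighbor, which is moved to another accessible
class; a vertex that has been taken out of a class that is not accessible leaves a place there. -/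
def insertByRotation : Program :=
  assign 32 (bvar 0) ;;
  assign 33 (bvar 1) ;;
  assign 24 (bvar 2) ;;
  assign 26 (entry 3 (bvar 0)) ;;
  assign 21 (entry 3 (scalar 18)) ;;
  assign 25 (bvar 0) ;;
  rotateColors ;;
  shift ;;
  .ite (.eq (scalar 33) (scalar 18)) (assign 19 (.const 0))
    (select 17 (.eq (entry 17 (scalar 30)) (.const 1) ∧ₜ .not (isAccessible (scalar 30))))

/-- For `y = u` the insertion is complete. Otherwise the accessible classes are finished and `u`
waits in the former class of `y`; the set of colors shrinks strictly because the hole was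
accessible. -/
theorem wp_insertByRotation {z y X : ℕ} (hN : m < N) (hG : GraphStore m c E col s)
    (hu : s.nat 18 0 0 = u) (hC : HasSet m 17 C s) (hS : Surveyed m E col u C s)
    (hP : Pending (Finset.range m) E col q u C)
    (ha : ∀ X, Reaches (Finset.range m) E col u C (col u) X → ¬ Movable E col u u X)
    (hz0 : s.nat 100 0 0 = z) (hy0 : s.nat 100 1 0 = y) (hX0 : s.nat 100 2 0 = X)
    (hzm : z < m) (hym : y < m) (hzu : z ≠ u) (hz : 0 < stampRow m (m + m) s (col z))
    (hy : y = u ∨ col y ∈ C ∧ ¬ 0 < stampRow m (m + m) s (col y))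
    (hs : Solo E col u z y) (hpos : 0 < stampRow m (col z) s X) (hm : Movable E col u z X) :
    wp N insertByRotation (fun s' => ∃ col', GraphStore m c E col' s' ∧
      SameSizes (Finset.range m) col col' ∧ ((s'.nat 19 0 0 = 0 ∧ ProperOutside E col' ∅) ∨
        (s'.nat 19 = s.nat 19 ∧ ∃ C' : Finset ℕ, Pending (Finset.range m) E col' q u C' ∧
          HasSet m 17 C' s' ∧ C' ⊂ C))) s := by
  classical
  have hum : u < m := Finset.mem_range.1 hP.mem_u
  have hcz : col z < m := (hG.color_lt z hzm).trans_le hG.le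
  have hzr := (hS.all.pos_iff _).1 hz
  have hyB : y = u ∨ col y ∈ C \ accessible (Finset.range m) E col u C := by
    refine hy.imp_right fun h => ?_
    rw [Finset.mem_sdiff, mem_accessible, ← hS.all.pos_iff]
    exact h
  have hwo := hS.without (col z) hcz (C.erase (col z)) fun X => Finset.mem_erase
  have hacc : ∀ Y, 0 < stampRow m (col z) s Y →
      Reaches (Finset.range m) E col u C (col u) Y ∧ Y ≠ col z := by
    intro Y hY
    have := (hwo.pos_iff Y).1 hY
    exact ⟨this.mono fun Z hZ => (Finset.mem_erase.1 hZ.mem).2, (Finset.mem_erase.1 this.mem).1⟩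
  have hshift := hP.shifting_accessible (Finset.mem_range.2 hzm) hzu
    (by convert hyB) hs hm hacc hpos hwo.pred
  refine wp_seq (wp_setNat (wp_seq (wp_setNat (wp_seq (wp_setNat (wp_seq (wp_setNat (wp_seq
    (wp_setNat (wp_seq (wp_setNat (wp_seq ?_))))))))))))
  simp [hz0, hy0, hX0, hG.color, hu]
  refine (wp_rotateColors (u := u) (y := y) (z := z) (hG.congr (by simp) (by simp) (by simp))
    (by simp [hu]) (by simp) (by simp) hum hym hzm).mono fun s₁ hF₁ hG₁ => wp_seq ?_
  have hrow : ∀ r, stampRow m r s₁ = stampRow m r s := fun r =>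
    stampRow_congr (by rw [hF₁.nat 22 rfl]; simp)
  refine (wp_shift (v := z) (h := col u) (X := X) (r := col z) (L := {w | w = u ∧ y ≠ u}) hN
    hG₁ hP.symm hP.irrefl ?_ ?_ ?_ ?_ ?_ ?_).mono fun s₂ hF₂ h₂ => ?_
  · rw [hF₁.nat 25 rfl]; simp
  · rw [hF₁.nat 24 rfl]; simp
  · rw [hF₁.nat 21 rfl]; simp
  · rw [hF₁.nat 26 rfl]; simp
  · rw [hrow]; exact hshift
  · rw [hrow, hwo.pos_iff]
    have := ((hwo.pos_iff X).1 hpos).hole_mem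
    exact .base this
  · obtain ⟨col', hG₂, hpr, hsz, hch⟩ := h₂
    have hsz' : SameSizes (Finset.range m) col col' :=
      (sameSizes_rotate hP.mem_u (Finset.mem_range.2 hym) (Finset.mem_range.2 hzm)).trans hsz
    have h33 : s₂.nat 33 0 0 = y := by rw [hF₂.nat 33 rfl, hF₁.nat 33 rfl]; simp
    have h18 : s₂.nat 18 0 0 = u := by rw [hF₂.nat 18 rfl, hF₁.nat 18 rfl]; simpa using hu
    have h17 : s₂.nat 17 = s.nat 17 := by rw [hF₂.nat 17 rfl, hF₁.nat 17 rfl]; simp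
    have h22 : s₂.nat 22 = s.nat 22 := by rw [hF₂.nat 22 rfl, hF₁.nat 22 rfl]; simp
    have h19 : s₂.nat 19 = s.nat 19 := by rw [hF₂.nat 19 rfl, hF₁.nat 19 rfl]; simp
    refine wp_ite (fun hb => wp_setNat ?_) (fun hb => ?_)
    · simp [h33, h18] at hb
      refine ⟨col', hG₂.congr (by simp) (by simp) (by simp), hsz', .inl ⟨by simp, ?_⟩⟩
      simpa [hb] using hpr
    · simp [h33, h18] at hb
      refine (wp_select (fun X => s.nat 17 X 0 = 1 ∧ ¬ 0 < stampRow m (m + m) s X) hG₂.size hN.le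
        (by decide) (by decide) ?_).mono fun s₃ hF₃ h₃ => ?_
      · intro i hi s' hF hv h17'
        simp [hv, h17', h17, hF.nat 22 rfl, h22, hF.nat 14 rfl, hG₂.size, stampRow, hi]
      have hacc' : ∀ Y, 0 < stampRow m (col z) s₁ Y →
          Reaches (Finset.range m) E col u C (col u) Y := by
        intro Y hY
        rw [hrow] at hY
        exact (hacc Y hY).1
      have hP' := hP.of_accessible_shift ha hzu hzr hb (by convert hyB.resolve_left hb) hs
        hacc' hch hsz' hpr
      refine ⟨col', hG₂.of_frame hF₃ rfl rfl rfl rfl rfl, hsz', .inr ⟨?_,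
        C \ accessible (Finset.range m) E col u C, by convert hP', ?_, ?_⟩⟩
      · rw [hF₃.nat 19 rfl, h19]
      · intro Y
        rw [Finset.mem_sdiff, hC Y, mem_accessible, ← hS.all.pos_iff, and_assoc]
        exact and_congr_right fun hY => (h₃ Y hY).symm
      · refine ⟨Finset.sdiff_subset, fun hsub => ?_⟩
        have := hsub hP.hole
        rw [Finset.mem_sdiff] at this
        exact this.2 hP.hole_accessible

/-- For `y ≠ u` this finds the start of a path along which `u` fills the place that `y` leaves; for
`y = u` no such path is needed and the search fails. -/
def vacating : Fml :=
  .ex 14 (.and (.atom (.ne (scalar 33) (scalar 18) ∧ₜ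
    .lt (.const 0) (.get 22 (.add (scalar 14) (entry 3 (scalar 33))) (bvar 0))))
    (movable 1 (scalar 18) (scalar 18) (bvar 0)))

/-- Insert a vertex into the color class of its only neighbor, which is taken out. -/
def replaceVertex : Program :=
  assign 32 (bvar 0) ;;
  assign 33 (bvar 1) ;;
  branch vacating
    (assign 24 (bvar 0) ;;
      assign 26 (.add (scalar 14) (entry 3 (scalar 33))) ;;
      assign 21 (entry 3 (scalar 33)) ;;
      assign 25 (scalar 18) ;;
      rotateColors ;;
      shift)
    rotateColors ;;
  assign 18 (scalar 32)

/-- The condition on the vertices that can be inserted into a class from which `z` is taken out. -/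
def RowReachable (m : ℕ) (E : ℕ → ℕ → Prop) (col : ℕ → ℕ) (u : ℕ) (s : Store) (y : ℕ) : Prop :=
  y = u ∨ ∃ X < m, 0 < s.nat 22 (m + col y) X ∧ Movable E col u u X

/-- The vertex `y'` takes no part in the recoloring. It is the reason why an additional class is
accessible once `z` is the vertex to be inserted. -/
theorem wp_replaceVertex {z y y' : ℕ} (hN : m < N) (hG : GraphStore m c E col s)
    (hu : s.nat 18 0 0 = u) (hS : Surveyed m E col u C s)
    (hP : Pending (Finset.range m) E col q u C)
    (hz0 : s.nat 100 0 0 = z) (hy0 : s.nat 100 1 0 = y)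
    (hzm : z < m) (hym : y < m) (hym' : y' < m) (hz : 0 < stampRow m (m + m) s (col z))
    (hzh : col z ≠ col u)
    (hterm : ∀ X < m, 0 < stampRow m (m + m) s X → X ≠ col z → 0 < stampRow m (col z) s X)
    (hb : ∀ X, 0 < stampRow m (col z) s X → ¬ Movable E col u z X)
    (hy : RowReachable m E col u s y) (hs : Solo E col u z y)
    (hy' : RowReachable m E col u s y') (hs' : Solo E col u z y') (hyy' : y ≠ y') (hE : ¬ E y y') :
    wp N replaceVertex (fun s' => ∃ col', GraphStore m c E col' s' ∧
      SameSizes (Finset.range m) col col' ∧ s'.nat 18 0 0 = z ∧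
      Pending (Finset.range m) E col' q z C ∧
      accessible (Finset.range m) E col u C ⊂ accessible (Finset.range m) E col' z C) s := by
  classical
  have hum : u < m := Finset.mem_range.1 hP.mem_u
  have hcz : col z < m := (hG.color_lt z hzm).trans_le hG.le
  have hzu : z ≠ u := by rintro rfl; exact hzh rfl
  have hzr := (hS.all.pos_iff _).1 hz
  have hrest : ∀ y < m, StampsFrom (Finset.range m) E col u
      (C \ accessible (Finset.range m) E col u C) (col y) (stampRow m (m + col y) s) := by
    intro y hy
    refine hS.rest _ ((hG.color_lt y hy).trans_le hG.le) _ fun X => ?_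
    rw [Finset.mem_sdiff, mem_accessible, hS.all.pos_iff]
  have hB : ∀ y < m, RowReachable m E col u s y →
      y = u ∨ col y ∈ C \ accessible (Finset.range m) E col u C := by
    intro y hym hy
    refine hy.imp_right fun ⟨X, hX, h1, h2⟩ => ?_
    rw [← stampRow_eq hX, (hrest y hym).pos_iff] at h1
    exact h1.hole_mem
  have hwo := hS.without (col z) hcz (C.erase (col z)) fun X => Finset.mem_erase
  have hfin : ∀ (P : ℕ → Prop) (col' : ℕ → ℕ), (∀ Y, P Y → Y ∈ C \ accessible (Finset.range m) E col u C) →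
      ChangesOnly P (rotate col u y z) col' → SameSizes (Finset.range m) col col' →
      ProperOutside E col' {z} → Pending (Finset.range m) E col' q z C ∧
      accessible (Finset.range m) E col u C ⊂ accessible (Finset.range m) E col' z C := by
    intro P col' hPB hch hsz hpr
    refine hP.of_inaccessible_shift (Finset.mem_range.2 hzm) hzu hzr hzh ?_ ?_
      (by convert hB y hym hy) hs (Finset.mem_range.2 hym') (by convert hB y' hym' hy') hs' hyy' hE
      (by convert hPB) hch hsz hpr
    · intro X hX hXz
      have hXm : X < m := stampRow_pos_lt ((hS.all.pos_iff X).2 hX)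
      have := (hwo.pos_iff X).1 (hterm X hXm ((hS.all.pos_iff X).2 hX) hXz)
      convert this
    · intro X _ hX
      refine hb X ((hwo.pos_iff X).2 ?_)
      convert hX
  refine wp_seq (wp_setNat (wp_seq (wp_setNat (wp_seq ?_))))
  simp [hz0, hy0]
  set s₁ := (s.setNat 32 0 0 z).setNat 33 0 0 y with hs₁
  have hG₁ : GraphStore m c E col s₁ := hG.congr (by simp [hs₁]) (by simp [hs₁]) (by simp [hs₁])
  have h18₁ : s₁.nat 18 0 0 = u := by simp [hs₁, hu]
  have h32₁ : s₁.nat 32 0 0 = z := by simp [hs₁]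
  have h33₁ : s₁.nat 33 0 0 = y := by simp [hs₁]
  have h22₁ : s₁.nat 22 = s.nat 22 := by simp [hs₁]
  clear_value s₁
  refine wp_branch rfl ?_ ?_ ?_
  · simp [vacating, movable, hG₁.size, hN]
  · intro s₂ hag hw
    simp [vacating, movable, hag.nat, hag.edge, hG₁.size, hG₁.color, h18₁, h33₁, h22₁] at hw
    generalize hX0 : s₂.nat 100 0 0 = X at hw
    obtain ⟨hXm, ⟨hyu, hpos⟩, hm⟩ := hw
    have hmov : Movable E col u u X := (hG₁.movable_iff hum).2 hm
    rw [← stampRow_eq hXm] at hpos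
    have hG₂ := hG₁.of_agree hag
    refine wp_seq (wp_setNat (wp_seq (wp_setNat (wp_seq (wp_setNat (wp_seq (wp_setNat
      (wp_seq ?_))))))))
    simp [hX0, hG₂.size, hag.nat, h33₁, hG₁.color, h18₁]
    refine (wp_rotateColors (u := u) (y := y) (z := z) (hG₂.congr (by simp) (by simp) (by simp))
      (by simp [hag.nat, h18₁]) (by simp [hag.nat, h33₁]) (by simp [hag.nat, h32₁]) hum hym
      hzm).mono fun s₃ hF₃ hG₃ => ?_
    have hrow : ∀ r, stampRow m r s₃ = stampRow m r s := fun r =>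
      stampRow_congr (by rw [hF₃.nat 22 rfl]; simp [hag.nat, h22₁])
    refine (wp_shift (v := u) (h := col y) (X := X) (r := m + col y) (L := {z}) hN
      hG₃ hP.symm hP.irrefl ?_ ?_ ?_ ?_ ?_ ?_).mono fun s₄ hF₄ h₄ => wp_setNat ?_
    · rw [hF₃.nat 25 rfl]; simp
    · rw [hF₃.nat 24 rfl]; simp
    · rw [hF₃.nat 21 rfl]; simp
    · rw [hF₃.nat 26 rfl]; simp
    · rw [hrow]
      exact hP.shifting_inaccessible hzu hzr hyu hs hmov
        (fun Y hY => by convert (((hrest y hym).pos_iff Y).1 hY).mem) hpos (hrest y hym).pred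
    · rw [hrow, (hrest y hym).pos_iff]
      exact .base (((hrest y hym).pos_iff X).1 hpos).hole_mem
    · obtain ⟨col', hG₄, hpr, hsz, hch⟩ := h₄
      have h32₄ : s₄.nat 32 0 0 = z := by
        rw [hF₄.nat 32 rfl, hF₃.nat 32 rfl]; simp [hag.nat, h32₁]
      have hsz' : SameSizes (Finset.range m) col col' :=
        (sameSizes_rotate hP.mem_u (Finset.mem_range.2 hym) (Finset.mem_range.2 hzm)).trans hsz
      refine ⟨col', hG₄.congr (by simp) (by simp) (by simp), hsz', by simp [h32₄],
        hfin _ col' (fun Y hY => ?_) hch hsz' hpr⟩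
      rw [hrow] at hY
      exact (((hrest y hym).pos_iff Y).1 hY).mem
  · intro s₂ hag hw
    have hyu : y = u := by
      by_contra hyu
      obtain ⟨X, hX, h1, h2⟩ := hy.resolve_left hyu
      refine hw ?_
      simp [vacating, movable, hG₁.size, hG₁.color, h18₁, h33₁, h22₁]
      exact ⟨X, hX, ⟨hyu, h1⟩, (hG₁.movable_iff hum).1 h2⟩
    have hG₂ := hG₁.of_agree hag
    refine (wp_rotateColors (u := u) (y := y) (z := z) hG₂
      (by simp [hag.nat, h18₁]) (by simp [hag.nat, h33₁]) (by simp [hag.nat, h32₁]) hum hym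
      hzm).mono fun s₃ hF₃ hG₃ => wp_setNat ?_
    have h32₃ : s₃.nat 32 0 0 = z := by
      rw [hF₃.nat 32 rfl]; simp [hag.nat, h32₁]
    have hsz := sameSizes_rotate (col := col) hP.mem_u (Finset.mem_range.2 hym)
      (Finset.mem_range.2 hzm)
    refine ⟨_, hG₃.congr (by simp) (by simp) (by simp), hsz, by simp [h32₃],
        hfin (fun _ => False) _ (fun Y hY => hY.elim) (.refl _ _) hsz ?_⟩
    intro a b hab ha hb
    refine hP.proper_rotate hzu hs a b hab ?_ ?_ <;> simpa [hyu] using ‹_›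

end

end PeerAssessment

/-! ### One step of an insertion: some move is always possible -/

namespace PeerAssessment

section

variable {N m c q u : ℕ} {E : ℕ → ℕ → Prop} {col : ℕ → ℕ} {C : Finset ℕ} {s s' : Store}

def canInsertDirectly : Fml :=
  .ex 14 (.and (.atom (isAccessible (bvar 0))) (movable 1 (scalar 18) (scalar 18) (bvar 0)))

def canRotate : Fml :=
  .ex 14 (.ex 14 (.ex 14 (.and (.atom (isAccessible (entry 3 (bvar 0)) ∧ₜ
    .ne (bvar 0) (scalar 18) ∧ₜ
    .or (.eq (bvar 1) (scalar 18)) (.eq (entry 17 (entry 3 (bvar 1))) (.const 1) ∧ₜ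
      .not (isAccessible (entry 3 (bvar 1)))) ∧ₜ
    .lt (.const 0) (.get 22 (entry 3 (bvar 0)) (bvar 2))))
    (.and (solo 3 (scalar 18) (bvar 0) (bvar 1)) (movable 3 (scalar 18) (bvar 0) (bvar 2))))))

/-- The formula that says that the class of `y` is reached from a class to which the vertex in the
array `18` is movable. -/
def rowReachable (d : ℕ) (y : NatExp) : Fml :=
  .imp (.atom (.ne y (scalar 18)))
    (.ex 14 (.and (.atom (.lt (.const 0) (.get 22 (.add (scalar 14) (entry 3 y)) (bvar d))))
      (movable (d + 1) (scalar 18) (scalar 18) (bvar d))))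

def canReplace : Fml :=
  .ex 14 (.ex 14 (.ex 14 (.and (.atom (isAccessible (entry 3 (bvar 0)) ∧ₜ
    .ne (entry 3 (bvar 0)) (entry 3 (scalar 18)) ∧ₜ .ne (bvar 1) (bvar 2) ∧ₜ
    .not (edge (bvar 1) (bvar 2))))
    (.and (.all 14 (.atom (.imp (isAccessible (bvar 3) ∧ₜ .ne (bvar 3) (entry 3 (bvar 0)))
      (.lt (.const 0) (.get 22 (entry 3 (bvar 0)) (bvar 3))))))
    (.and (rowReachable 3 (bvar 1)) (.and (rowReachable 3 (bvar 2))
    (.and (solo 3 (scalar 18) (bvar 0) (bvar 1)) (solo 3 (scalar 18) (bvar 0) (bvar 2)))))))))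

/-- One step towards the insertion of the vertex in the array `18`. -/
def insertStep : Program :=
  survey ;;
  branch canInsertDirectly insertDirectly
    (branch canRotate insertByRotation
      (branch canReplace replaceVertex (assign 19 (.const 0))))

/-- The failures of the first two searches are the hypotheses of `Pending.exists_pair`, whose
conclusion is what the third search looks for; so the last branch is never taken. -/
theorem wp_insertStep (hN : m + 1 < N) (hG : GraphStore m c E col s) (hu : s.nat 18 0 0 = u)
    (hC : HasSet m 17 C s) (hP : Pending (Finset.range m) E col q u C) :
    wp N insertStep (fun s' => ∃ col', GraphStore m c E col' s' ∧
      SameSizes (Finset.range m) col col' ∧ ((s'.nat 19 0 0 = 0 ∧ ProperOutside E col' ∅) ∨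
        (s'.nat 19 = s.nat 19 ∧ ∃ C' u', s'.nat 18 0 0 = u' ∧ HasSet m 17 C' s' ∧
          Pending (Finset.range m) E col' q u' C' ∧ (C' ⊂ C ∨ C' = C ∧
            accessible (Finset.range m) E col u C ⊂ accessible (Finset.range m) E col' u' C)))) s := by
  classical
  have hum : u < m := Finset.mem_range.1 hP.mem_u
  refine wp_seq ((wp_survey hN hG hu hum hC).mono fun s₁ hF₁ hS => ?_)
  have hG₁ := hG.of_frame hF₁ rfl rfl rfl rfl rfl
  have hu₁ : s₁.nat 18 0 0 = u := by rw [hF₁.nat 18 rfl, hu]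
  have hC₁ : HasSet m 17 C s₁ := by
    unfold HasSet at hC ⊢
    rwa [hF₁.nat 17 rfl]
  have h19₁ : s₁.nat 19 = s.nat 19 := hF₁.nat 19 rfl
  clear hF₁ hG hu hC
  have hcm : ∀ v < m, col v < m := fun v hv => (hG₁.color_lt v hv).trans_le hG₁.le
  have trans : ∀ {s₂}, Agree 0 s₁ s₂ → GraphStore m c E col s₂ ∧ s₂.nat 18 0 0 = u ∧
      HasSet m 17 C s₂ ∧ Surveyed m E col u C s₂ ∧ s₂.nat 19 = s.nat 19 ∧
      s₂.nat 22 = s₁.nat 22 := by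
    intro s₂ hag
    have hr : ∀ r, stampRow m r s₂ = stampRow m r s₁ := fun r =>
      stampRow_congr (by simp [hag.nat])
    refine ⟨hG₁.of_agree hag, by simp [hag.nat, hu₁], ?_, ⟨?_, ?_, ?_⟩, by simp [hag.nat, h19₁],
      by simp [hag.nat]⟩
    · unfold HasSet at hC₁ ⊢
      simpa [hag.nat] using hC₁
    · rw [hr]; exact hS.all
    · intro W hW
      rw [hr]
      exact hS.without W hW
    · intro Y hY
      rw [hr, hr]
      exact hS.rest Y hY
  refine wp_branch rfl (by simp [canInsertDirectly, movable, hG₁.size]; omega) ?_ ?_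
  · intro s₂ hag hw
    obtain ⟨hG₂, hu₂, hC₂, hS₂, h19₂, h22₂⟩ := trans hag
    simp [canInsertDirectly, movable, hG₂.size, hG₂.color, hu₂] at hw
    refine (wp_insertDirectly (by omega) hG₂ hu₂ hS₂ hP rfl
      (by rw [stampRow_eq hw.1]; exact hw.2.1)
      ((hG₂.movable_iff hum).2 hw.2.2)).mono fun s₃ _ ⟨col', h1, h2, h3, h4⟩ =>
        ⟨col', h1, h2, .inl ⟨h4, h3⟩⟩
  intro s₂ hag hw
  obtain ⟨hG₂, hu₂, hC₂, hS₂, h19₂, h22₂⟩ := trans hag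
  have ha : ∀ X, Reaches (Finset.range m) E col u C (col u) X → ¬ Movable E col u u X := by
    intro X hX hm
    refine hw ?_
    have hpos := (hS.all.pos_iff X).2 hX
    have hXm := stampRow_pos_lt hpos
    simp [canInsertDirectly, movable, hG₁.size, hG₁.color, hu₁]
    exact ⟨X, hXm, by rwa [stampRow_eq hXm] at hpos, (hG₁.movable_iff hum).1 hm⟩
  clear hw
  refine wp_branch rfl (by simp [canRotate, movable, solo, hG₂.size]; omega) ?_ ?_
  · intro s₃ hag' hw
    obtain ⟨hG₃, hu₃, hC₃, hS₃, h19₃, h22₃⟩ := trans (hag.trans hag')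
    simp [canRotate, movable, solo, hG₃.size, hG₃.color, hu₃] at hw
    generalize hz0 : s₃.nat 100 0 0 = z at hw
    generalize hy0 : s₃.nat 100 1 0 = y at hw
    generalize hX0 : s₃.nat 100 2 0 = X at hw
    obtain ⟨hz, hy, hX, ⟨h1, h2, h3, h4⟩, h5, h6⟩ := hw
    have hy' : y = u ∨ col y ∈ C ∧ ¬ 0 < stampRow m (m + m) s₃ (col y) := by
      refine h3.imp_right fun h => ⟨(hC₃ _).2 ⟨hcm y hy, h.1⟩, ?_⟩
      rw [stampRow_eq (hcm y hy), h.2]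
      omega
    refine (wp_insertByRotation (by omega) hG₃ hu₃ hC₃ hS₃ hP ha hz0 hy0 hX0 hz hy h2
      (by rwa [stampRow_eq (hcm z hz)]) hy' ((hG₃.solo_iff hz hy).2 h5) (by rwa [stampRow_eq hX])
      ((hG₃.movable_iff hz).2 h6)).mono fun s₄ hF₄ ⟨col', g1, g2, g3⟩ => ⟨col', g1, g2, ?_⟩
    refine g3.imp_right fun ⟨k1, C', k2, k3, k4⟩ => ⟨by rw [k1, h19₃], C', u, ?_, k3, k2, .inl k4⟩
    rw [hF₄.nat 18 rfl, hu₃]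
  intro s₃ hag' hw
  have hb : ∀ z < m, z ≠ u → Reaches (Finset.range m) E col u C (col u) (col z) → ∀ y < m,
      (y = u ∨ col y ∈ C \ accessible (Finset.range m) E col u C) → Solo E col u z y → ∀ X,
      0 < stampRow m (col z) s₂ X → ¬ Movable E col u z X := by
    intro z hz hzu hzr y hy hyB hs X hX hm
    refine hw ?_
    have hXm := stampRow_pos_lt hX
    simp [canRotate, movable, solo, hG₂.size, hG₂.color, hu₂]
    refine ⟨z, hz, y, hy, X, hXm, ⟨?_, hzu, ?_, ?_⟩, (hG₂.solo_iff hz hy).1 hs,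
      (hG₂.movable_iff hz).1 hm⟩
    · rw [← hS₂.all.pos_iff, stampRow_eq (hcm z hz)] at hzr
      exact hzr
    · refine hyB.imp_right fun h => ?_
      rw [Finset.mem_sdiff, mem_accessible, ← hS₂.all.pos_iff, stampRow_eq (hcm y hy)] at h
      exact ⟨((hC₂ _).1 h.1).2, by omega⟩
    · rwa [stampRow_eq hXm] at hX
  obtain ⟨hG₃, hu₃, hC₃, hS₃, h19₃, h22₃⟩ := trans (hag.trans hag')
  have hb₃ : ∀ z < m, z ≠ u → Reaches (Finset.range m) E col u C (col u) (col z) → ∀ y < m,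
      (y = u ∨ col y ∈ C \ accessible (Finset.range m) E col u C) → Solo E col u z y → ∀ X,
      0 < stampRow m (col z) s₃ X → ¬ Movable E col u z X := by
    intro z hz hzu hzr y hy hyB hs X hX
    refine hb z hz hzu hzr y hy hyB hs X ?_
    rwa [stampRow_congr (s := s₃) (s' := s₂) (by rw [h22₂, h22₃])]
  clear hw hb
  have hrest : ∀ {s₄}, Surveyed m E col u C s₄ → ∀ y < m, StampsFrom (Finset.range m) E col u
      (C \ accessible (Finset.range m) E col u C) (col y) (stampRow m (m + col y) s₄) := by
    intro s₄ hS y hy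
    refine hS.rest _ (hcm y hy) _ fun X => ?_
    rw [Finset.mem_sdiff, mem_accessible, hS.all.pos_iff]
  refine wp_branch rfl (by simp [canReplace, rowReachable, movable, solo, hG₃.size]; omega) ?_ ?_
  · intro s₄ hag'' hw
    obtain ⟨hG₄, hu₄, hC₄, hS₄, h19₄, h22₄⟩ := trans ((hag.trans hag').trans hag'')
    simp [canReplace, rowReachable, movable, solo, hG₄.size, hG₄.color, hu₄] at hw
    generalize hz0 : s₄.nat 100 0 0 = z at hw
    generalize hy0 : s₄.nat 100 1 0 = y at hw
    generalize s₄.nat 100 2 0 = y' at hw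
    obtain ⟨hz, hy, hy', ⟨h1, h2, h3, h4⟩, h5, h6, h7, h8, h9⟩ := hw
    have hzu : z ≠ u := by rintro rfl; exact h2 rfl
    have hs := (hG₄.solo_iff hz hy).2 h8
    have hR : ∀ y, (¬ y = u → ∃ i < m, 0 < s₄.nat 22 (m + col y) i ∧
        ∀ w < m, s₄.Edge u w → col w = i → w = u) → RowReachable m E col u s₄ y := by
      intro y h
      by_cases hyu : y = u
      · exact .inl hyu
      · obtain ⟨X, hX, g1, g2⟩ := h hyu
        exact .inr ⟨X, hX, g1, (hG₄.movable_iff hum).2 g2⟩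
    have hzpos : 0 < stampRow m (m + m) s₄ (col z) := by rwa [stampRow_eq (hcm z hz)]
    refine (wp_replaceVertex (y' := y') (by omega) hG₄ hu₄ hS₄ hP hz0 hy0 hz hy hy' hzpos h2
      ?_ ?_ (hR y h6) hs (hR y' h7) ((hG₄.solo_iff hz hy').2 h9) h3 ?_).mono
      fun s₅ hF₅ ⟨col', g1, g2, g3, g4, g5⟩ => ⟨col', g1, g2, .inr ⟨?_, C, z, g3, ?_, g4,
        .inr ⟨rfl, g5⟩⟩⟩
    · intro X hX g1 g2
      rw [stampRow_eq hX] at g1 ⊢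
      exact h5 X hX g1 g2
    · intro X hX
      refine hb₃ z hz hzu ((hS₄.all.pos_iff _).1 hzpos) y hy ?_ hs X ?_
      · refine (hR y h6).imp_right fun ⟨X, hX, k1, k2⟩ => ?_
        rw [← stampRow_eq hX, (hrest hS₄ y hy).pos_iff] at k1
        exact k1.hole_mem
      · rwa [stampRow_congr (s := s₄) (s' := s₃) (by rw [h22₃, h22₄])]
    · rw [hG₄.edge]
      exact fun h => h4 h.2.2
    · rw [hF₅.nat 19 rfl, h19₄]
    · unfold HasSet at hC₄ ⊢
      rwa [hF₅.nat 17 rfl]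
  · intro s₄ hag'' hw
    exfalso
    refine hw ?_
    obtain ⟨z, hz, y, hy, y', hy', hzu, hzr, hzh, hterm, hr, hr', hyy', hE, hs, hs'⟩ :=
      hP.exists_pair ha (by
        intro z hz hzu hzr y hy hyB hs X hXz hX
        have hz := Finset.mem_range.1 hz
        refine hb₃ z hz hzu hzr y (Finset.mem_range.1 hy) (by convert hyB) hs X ?_
        rw [(hS₃.without (col z) (hcm z hz) (C.erase (col z)) fun X => Finset.mem_erase).pos_iff]
        convert hX)
    rw [Finset.mem_range] at hz hy hy'
    have hR : ∀ y < m, Reachable (Finset.range m) E col u C y → ¬ y = u →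
        ∃ i < m, 0 < s₃.nat 22 (m + col y) i ∧ ∀ w < m, s₃.Edge u w → col w = i → w = u := by
      intro y hy h hyu
      obtain ⟨X, h1, h2⟩ := h.resolve_left hyu
      have hpos : 0 < stampRow m (m + col y) s₃ X := by
        rw [(hrest hS₃ y hy).pos_iff]
        convert h2
      have hX := stampRow_pos_lt hpos
      exact ⟨X, hX, by rwa [stampRow_eq hX] at hpos, (hG₃.movable_iff hum).1 h1⟩
    simp [canReplace, rowReachable, movable, solo, hG₃.size, hG₃.color, hu₃]
    refine ⟨z, hz, y, hy, y', hy', ⟨?_, hzh, hyy', ?_⟩, ?_, hR y hy hr, hR y' hy' hr',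
      (hG₃.solo_iff hz hy).1 hs, (hG₃.solo_iff hz hy').1 hs'⟩
    · rwa [← hS₃.all.pos_iff, stampRow_eq (hcm z hz)] at hzr
    · exact fun h => hE ((hG₃.edge _ _).2 ⟨hy, hy', h⟩)
    · intro X hX h1 h2
      rw [← stampRow_eq hX, (hS₃.without (col z) (hcm z hz) (C.erase (col z))
        fun X => Finset.mem_erase).pos_iff]
      rw [← stampRow_eq hX, hS₃.all.pos_iff] at h1
      convert hterm X h1 h2

end

end PeerAssessment

/-! ### Termination of an insertion, and the initial coloring -/

namespace PeerAssessment

section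

variable {N m c q u : ℕ} {E : ℕ → ℕ → Prop} {col : ℕ → ℕ} {C : Finset ℕ} {s s' : Store}

/-- The colors under consideration. -/
def activeColors (m : ℕ) (s : Store) : Finset ℕ := (Finset.range m).filter fun X => s.nat 17 X 0 = 1

/-- An upper bound for the number of further steps of an insertion. -/
noncomputable def stepsLeft (m : ℕ) (E : ℕ → ℕ → Prop) (s : Store) : ℕ :=
  (activeColors m s).card * (m + 1) + ((activeColors m s).card -
    (accessible (Finset.range m) E (fun v => s.nat 3 v 0) (s.nat 18 0 0) (activeColors m s)).card) + 1

theorem stepsLeft_eq (hG : GraphStore m c E col s) (hu : s.nat 18 0 0 = u) (hC : HasSet m 17 C s) :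
    stepsLeft m E s = C.card * (m + 1) +
      (C.card - (accessible (Finset.range m) E col u C).card) + 1 := by
  have h1 : activeColors m s = C := by
    ext X
    simp [activeColors, hC X]
  have h2 : (fun v => s.nat 3 v 0) = col := funext hG.color
  rw [stepsLeft, h1, h2, hu]

theorem HasSet.card_le {a : ℕ} (hC : HasSet m a C s) : C.card ≤ m := by
  have : C ⊆ Finset.range m := fun X hX => Finset.mem_range.2 ((hC X).1 hX).1
  simpa using Finset.card_le_card this

/-- Insert the vertex in the array `18`. -/
def insertVertex : Program :=
  select 17 (.lt (scalar 30) (scalar 15)) ;;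
  assign 19 (.const 1) ;;
  .while (.lt (.const 0) (scalar 19)) insertStep

/-- The descent is lexicographic: either colors are dropped, or the colors stay and more classes are
accessible. The weight `m + 1` of a color exceeds the number of inaccessible classes. -/
theorem wp_insertVertex (hN : (m + 1) * (m + 1) < N) (hG : GraphStore m c E col s)
    (hc : s.nat 15 0 0 = c) (hu : s.nat 18 0 0 = u)
    (hP : Pending (Finset.range m) E col q u (Finset.range c)) :
    wp N insertVertex (fun s' => ∃ col', GraphStore m c E col' s' ∧
      SameSizes (Finset.range m) col col' ∧ ProperOutside E col' ∅) s := by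
  have hN' : m + 1 < N := lt_of_le_of_lt (Nat.le_mul_of_pos_left _ (Nat.succ_pos _)) hN
  refine wp_seq ((wp_select (fun X => X < c) hG.size (by omega) (by decide)
    (by decide) ?_).mono fun s₁ hF₁ h₁ => wp_seq (wp_setNat ?_))
  · intro i hi s' hF hv _
    simp [hv, hF.nat 15 rfl, hc]
  have hG₁ := hG.of_frame hF₁ rfl rfl rfl rfl rfl
  have hu₁ : s₁.nat 18 0 0 = u := by rw [hF₁.nat 18 rfl, hu]
  have hle := hG.le
  have hC₁ : HasSet m 17 (Finset.range c) s₁ := by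
    intro X
    rw [Finset.mem_range]
    exact ⟨fun h => ⟨by omega, (h₁ X (by omega)).2 h⟩, fun h => (h₁ X h.1).1 h.2⟩
  simp
  refine wp_while (fun s' => ∃ col', GraphStore m c E col' s' ∧
      SameSizes (Finset.range m) col col' ∧ ((s'.nat 19 0 0 = 0 ∧ ProperOutside E col' ∅) ∨
        (s'.nat 19 0 0 = 1 ∧ ∃ C' u', s'.nat 18 0 0 = u' ∧ HasSet m 17 C' s' ∧
          Pending (Finset.range m) E col' q u' C')))
    (fun s' => s'.nat 19 0 0 * stepsLeft m E s') ?_ ?_ ?_ ?_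
  · refine ⟨col, hG₁.congr (by simp) (by simp) (by simp), fun _ => rfl, .inr ⟨by simp, .range c, u,
      by simpa using hu₁, ?_, hP⟩⟩
    simpa [HasSet] using hC₁
  · have h2 := hC₁.card_le
    rw [stepsLeft_eq (C := .range c) (hG₁.congr (by simp) (by simp) (by simp)) (by simpa using hu₁)
      (by simpa [HasSet] using hC₁)]
    have := Nat.mul_le_mul_right (m + 1) h2
    rw [Nat.add_mul] at hN
    rw [Finset.card_range] at this h2
    simp
    omega
  · rintro s₂ hF ⟨col', hG₂, hsz, h⟩ hb
    simp at hb
    rcases h with h | ⟨h19, C', u', hu', hC', hP'⟩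
    · omega
    refine (wp_insertStep hN' hG₂ hu' hC' hP').mono fun s₃ _ ⟨col'', hG₃, hsz', h⟩ =>
      ⟨⟨col'', hG₃, hsz.trans hsz', ?_⟩, ?_⟩
    · refine h.imp_right fun ⟨h1, C'', u'', h2, h3, h4, _⟩ => ⟨by rw [h1, h19], C'', u'', h2, h3, h4⟩
    · rcases h with h | ⟨h1, C'', u'', h2, h3, h4, h5⟩
      · rw [h.1, h19, zero_mul, one_mul, stepsLeft_eq hG₂ hu' hC']
        omega
      · rw [h1, h19, one_mul, one_mul, stepsLeft_eq hG₂ hu' hC', stepsLeft_eq hG₃ h2 h3]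
        rcases h5 with h5 | ⟨h5, h6⟩
        · have h7 := Finset.card_lt_card h5
          have h8 := hC'.card_le
          have h9 := Nat.mul_le_mul_right (m + 1) (show C''.card + 1 ≤ C'.card from h7)
          rw [Nat.add_mul] at h9
          omega
        · have h7 := Finset.card_lt_card h6
          have h8 := Finset.card_le_card
            (accessible_subset (V := Finset.range m) (E := E) (col := col'') (u := u'') (C := C'))
          rw [h5]
          omega
  · rintro s₂ hF ⟨col', hG₂, hsz, h⟩ hb
    simp at hb
    rcases h with h | h
    · exact ⟨col', hG₂, hsz, h.2⟩
    · omega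

/-- The graph of a 0-1 matrix, to which a clique of dummies is added. -/
def padded (n : ℕ) (M : ℕ → ℕ → ℕ) (v w : ℕ) : Prop :=
  (v < n ∧ w < n ∧ (M v w = 1 ∨ M w v = 1)) ∨ (n ≤ v ∧ n ≤ w ∧ v ≠ w)

theorem padded_symm {n : ℕ} {M : ℕ → ℕ → ℕ} {v w : ℕ} (h : padded n M v w) : padded n M w v := by
  rcases h with ⟨h1, h2, h3⟩ | ⟨h1, h2, h3⟩
  · exact .inl ⟨h2, h1, h3.symm⟩
  · exact .inr ⟨h2, h1, h3.symm⟩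

/-- Color the first vertices periodically, until there are as many vertices of each color. -/
def colorInit : Program :=
  assign 15 (.add (.add (scalar 1) (scalar 1)) (.const 1)) ;;
  assign 14 (.const 0) ;;
  assign 28 (.const 0) ;;
  .while (.or (.lt (scalar 14) (scalar 0)) (.lt (.const 0) (scalar 28)))
    (.setNat 3 (scalar 14) (.const 0) (scalar 28) ;;
      assign 14 (.add (scalar 14) (.const 1)) ;;
      assign 28 (.add (scalar 28) (.const 1)) ;;
      .ite (.eq (scalar 28) (scalar 15)) (assign 28 (.const 0)) .skip)

theorem wp_colorInit {n k : ℕ} (hn : s.nat 0 0 0 = n) (hk : s.nat 1 0 0 = k)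
    (hN : n + 2 * k + 1 ≤ N) : wp N colorInit (fun s' => s'.nat 15 0 0 = 2 * k + 1 ∧
      ∃ q, s'.nat 14 0 0 = q * (2 * k + 1) ∧ n ≤ q * (2 * k + 1) ∧
        q * (2 * k + 1) < n + (2 * k + 1) ∧
        ∀ v < q * (2 * k + 1), s'.nat 3 v 0 = v % (2 * k + 1)) s := by
  refine wp_seq (wp_setNat (wp_seq (wp_setNat (wp_seq (wp_setNat ?_)))))
  simp [hk]
  rw [show k + k + 1 = 2 * k + 1 by ring]
  refine wp_while (fun s' => s'.nat 0 0 0 = n ∧ s'.nat 15 0 0 = 2 * k + 1 ∧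
    s'.nat 28 0 0 < 2 * k + 1 ∧ (∃ q, s'.nat 14 0 0 = q * (2 * k + 1) + s'.nat 28 0 0) ∧
    -- An unfinished block of `2k + 1` vertices starts below `n`; just after a block has been
    -- finished, the number of vertices is less than `n + (2k + 1)` for the same reason.
    s'.nat 14 0 0 - s'.nat 28 0 0 < n + (if s'.nat 28 0 0 = 0 then 2 * k + 1 else 0) ∧
    ∀ v < s'.nat 14 0 0, s'.nat 3 v 0 = v % (2 * k + 1))
    (fun s' => n + (2 * k + 1) - s'.nat 14 0 0) ?_ ?_ ?_ ?_
  · simp [hn]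
  · simp
    omega
  · rintro s₁ - ⟨h0, h15, h28, ⟨q, hq⟩, hlt, hcol⟩ hb
    simp [h0] at hb
    generalize hx : s₁.nat 28 0 0 = x at *
    generalize hv : s₁.nat 14 0 0 = v at *
    have hvx : v % (2 * k + 1) = x := by
      rw [hq, Nat.mul_add_mod_of_lt h28]
    have hcol' : ∀ w ≤ v, (if w = v then x else s₁.nat 3 w 0) = w % (2 * k + 1) := by
      intro w hw
      split_ifs with h
      · rw [h, hvx]
      · exact hcol w (by omega)
    have hlt' : v < n + (2 * k + 1) := by
      split_ifs at hlt <;> omega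
    refine wp_seq (wp_setNat (wp_seq (wp_setNat (wp_seq (wp_setNat (wp_ite (fun hb' => wp_setNat ?_)
      (fun hb' => wp_skip ?_)))))))
    · simp [hx, h15] at hb'
      simp [hv, hx, h0, h15]
      refine ⟨⟨⟨q + 1, ?_⟩, ?_, hcol'⟩, ?_⟩
      · rw [Nat.add_mul]; omega
      · split_ifs at hlt <;> omega
      · omega
    · simp [hx, h15] at hb'
      simp [hv, hx, h0, h15]
      refine ⟨⟨by omega, ⟨q, by omega⟩, ?_, hcol'⟩, ?_⟩
      · split_ifs at hlt <;> omega
      · omega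
  · rintro s₁ - ⟨h0, h15, h28, ⟨q, hq⟩, hlt, hcol⟩ hb
    simp [h0] at hb
    rw [hb.2, add_zero] at hq
    rw [hq] at hcol hlt hb
    simp [hb.2] at hlt
    exact ⟨h15, q, hq, hb.1, hlt, hcol⟩

end

end PeerAssessment

/-! ### Equitable coloring by padding with dummies and successive insertion -/

namespace PeerAssessment

section

variable {N : ℕ} {s s' : Store}

/-- The program for the equitable coloring. -/
def colorProgram : Program :=
  colorInit ;;
  forLoop 27 14 (assign 35 (scalar 27) ;; assign 18 (scalar 27) ;; insertVertex)

theorem card_range_mod (c q X : ℕ) (hX : X < c) :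
    ((Finset.range (q * c)).filter fun v => v % c = X).card = q := by
  have h := Nat.count_modEq_card (q * c) (show 0 < c by omega) X
  rw [Nat.count_eq_card_filter_range] at h
  simp only [Nat.ModEq, Nat.mod_eq_of_lt hX] at h
  rw [h, Nat.mul_mod_left, Nat.mul_div_cancel _ (by omega)]
  simp

open Finset in
-- There are at most `2k` dummies, so a clique of them respects the degree bound, and no edge joins
-- them to the other vertices.
theorem card_padded_lt {n k m : ℕ} {M : ℕ → ℕ → ℕ} (hm : m < n + (2 * k + 1))
    [∀ v, DecidablePred (padded n M v)]
    (hdeg : ∀ v < n, #{w ∈ range n | M v w = 1 ∨ M w v = 1} ≤ 2 * k) {v : ℕ} (hv : v < m) :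
    #{w ∈ range m | padded n M v w} < 2 * k + 1 := by
  by_cases hvn : v < n
  · refine lt_of_le_of_lt (card_le_card fun w hw => ?_) (Nat.lt_succ_of_le (hdeg v hvn))
    rw [mem_filter] at hw ⊢
    rcases hw.2 with h | h
    · exact ⟨mem_range.2 h.2.1, h.2.2⟩
    · omega
  · have h1 : #((Ico n m).erase v) < 2 * k + 1 := by
      rw [card_erase_of_mem (mem_Ico.2 ⟨by omega, hv⟩), Nat.card_Ico]
      omega
    refine lt_of_le_of_lt (card_le_card fun w hw => ?_) h1
    rw [mem_filter, mem_range] at hw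
    rw [mem_erase, mem_Ico]
    rcases hw.2 with h | h
    · omega
    · exact ⟨h.2.2.symm, h.2.1, hw.1⟩

open Finset in
/-- The coloring in the memory is proper, and its classes have the size `q` or `q - 1`. -/
structure HasColoring (n c q : ℕ) (s : Store) : Prop where
  lt : ∀ v < n, s.nat 3 v 0 < c
  proper : ∀ v < n, ∀ w < n, s.nat 2 v w = 1 → s.nat 3 v 0 ≠ s.nat 3 w 0
  le : ∀ X < c, #{v ∈ range n | s.nat 3 v 0 = X} ≤ q
  ge : ∀ X < c, q ≤ #{v ∈ range n | s.nat 3 v 0 = X} + 1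

open Finset in
-- At stage `i` only the edges among the vertices up to `i` are present. The coloring is then proper
-- except at `i`, and inserting `i` repairs it without changing class sizes.
theorem wp_colorProgram {n k : ℕ} (hn : s.nat 0 0 0 = n) (hk : s.nat 1 0 0 = k) (hn0 : 0 < n)
    (hirr : ∀ v < n, s.nat 2 v v ≠ 1)
    (hdeg : ∀ v < n, #{w ∈ range n | s.nat 2 v w = 1 ∨ s.nat 2 w v = 1} ≤ 2 * k)
    (hN : (n + 2 * k + 1) * (n + 2 * k + 1) < N) :
    wp N colorProgram (fun s' => ∃ q, HasColoring n (2 * k + 1) q s') s := by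
  classical
  have hN' : n + 2 * k + 1 < N := lt_of_le_of_lt (Nat.le_mul_of_pos_left _ (Nat.succ_pos _)) hN
  refine wp_seq ((wp_colorInit hn hk hN'.le).mono fun s₁ hF₁ ⟨h15, q, h14, hnm, hmn, hcol⟩ => ?_)
  have hn₁ : s₁.nat 0 0 0 = n := by rw [hF₁.nat 0 rfl, hn]
  have hM₁ : s₁.nat 2 = s.nat 2 := hF₁.nat 2 rfl
  set m := q * (2 * k + 1) with hm
  have hq : 0 < q := by
    rcases Nat.eq_zero_or_pos q with h | h
    · rw [h, zero_mul] at hm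
      omega
    · exact h
  have hcm : 2 * k + 1 ≤ m := Nat.le_mul_of_pos_left _ hq
  have hNm : (m + 1) * (m + 1) < N :=
    lt_of_le_of_lt (Nat.mul_le_mul (by omega) (by omega)) hN
  have hsize : ∀ col : ℕ → ℕ, SameSizes (range m) (fun v => s₁.nat 3 v 0) col →
      ∀ X < 2 * k + 1, {v | v ∈ range m ∧ col v = X}.ncard = q := by
    intro col hc X hX
    rw [hc X, ncard_color, ← card_range_mod (2 * k + 1) q X hX]
    refine congrArg card (filter_congr fun v hv => ?_)
    rw [hcol v (mem_range.1 hv)]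
  refine wp_forLoop (fun i s' => ∃ col : ℕ → ℕ, (∀ v, s'.nat 3 v 0 = col v) ∧
    (∀ v < m, col v < 2 * k + 1) ∧ SameSizes (range m) (fun v => s₁.nat 3 v 0) col ∧
    ∀ v < i, ∀ w < i, padded n (s.nat 2) v w → col v ≠ col w) rfl rfl (by decide) (by omega) ?_ ?_ ?_
  · refine ⟨fun v => s₁.nat 3 v 0, by simp, fun v hv => ?_, fun _ => rfl, by simp⟩
    simp only [hcol v hv]
    exact Nat.mod_lt _ (by omega)
  · rintro i s₂ hi hF₂ hv ⟨col, hc1, hc2, hc3, hc4⟩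
    have hi : i < m := by omega
    set E : ℕ → ℕ → Prop := fun v w => v < m ∧ w < m ∧ v ≤ i ∧ w ≤ i ∧ padded n (s.nat 2) v w
    have hG₂ : GraphStore m (2 * k + 1) E col ((s₂.setNat 35 0 0 i).setNat 18 0 0 i) := by
      refine ⟨?_, fun v w => ?_, ?_, hc2, hcm⟩
      · simp [hF₂.nat 14 rfl, h14]
      · simp [E, Store.Edge, padded, hF₂.nat 0 rfl, hF₂.nat 2 rfl, hn₁, hM₁]
      · simpa using hc1
    have hP : Pending (range m) E col q i (range (2 * k + 1)) := by
      refine ⟨?_, ?_, ?_, mem_range.2 hi, ?_, mem_range.2 (hc2 i hi), ?_, ?_⟩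
      · rintro v w ⟨h1, h2, h3, h4, h5⟩
        exact ⟨h2, h1, h4, h3, padded_symm h5⟩
      · rintro v ⟨h1, h2, h3, h4, h5 | h5⟩
        · exact hirr v h5.1 (by tauto)
        · exact h5.2.2 rfl
      · exact fun v w h => mem_range.2 h.1
      · intro X hX
        rw [← ncard_color, hsize col hc3 X (mem_range.1 hX)]
      · rintro v w ⟨h1, h2, h3, h4, h5⟩ hv hw
        exact hc4 v (by omega) w (by omega) h5
      · intro v hv _
        rw [card_range]
        refine lt_of_le_of_lt (card_le_card fun w hw => ?_)
          (card_padded_lt hmn hdeg (mem_range.1 hv))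
        simp only [mem_filter] at hw ⊢
        exact ⟨hw.1, hw.2.1.2.2.2.2⟩
    refine wp_seq (wp_setNat (wp_seq (wp_setNat ?_)))
    simp only [NatExp.val, hv, Store.nat_setNat_ne, ne_eq, Nat.reduceEqDiff, not_false_eq_true]
    refine (wp_insertVertex hNm hG₂ (by simp [hF₂.nat 15 rfl, h15]) (by simp) hP).mono
      fun s₃ _ ⟨col', hG₃, hsz, hpr⟩ => ⟨col', by simpa using hG₃.color, hG₃.color_lt,
        hc3.trans hsz, fun v hv w hw h => ?_⟩
    exact hpr v w ⟨by omega, by omega, by omega, by omega, h⟩ (by simp) (by simp)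
  · rintro s₂ hF₂ ⟨col, hc1, hc2, hc3, hc4⟩
    rw [h14] at hc4
    have hM₂ : s₂.nat 2 = s.nat 2 := by rw [hF₂.nat 2 rfl, hM₁]
    have hcard : ∀ X < 2 * k + 1, #{v ∈ range n | col v = X} + #{v ∈ Ico n m | col v = X} = q := by
      intro X hX
      rw [← card_union_of_disjoint, ← filter_union]
      · have : range n ∪ Ico n m = range m := by
          ext v
          simp only [mem_union, mem_range, mem_Ico]
          omega
        rw [this, ← ncard_color, hsize col hc3 X hX]
      · rw [disjoint_left]
        intro v hv hv'
        simp only [mem_filter, mem_range, mem_Ico] at hv hv'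
        omega
    -- The dummies form a clique, so each class of size `q` loses at most one vertex when they are
    -- deleted.
    have hdummy : ∀ X, #{v ∈ Ico n m | col v = X} ≤ 1 := by
      intro X
      rw [card_le_one]
      intro v hv w hw
      simp only [mem_filter, mem_Ico] at hv hw
      by_contra hvw
      exact hc4 v hv.1.2 w hw.1.2 (.inr ⟨hv.1.1, hw.1.1, hvw⟩) (hv.2.trans hw.2.symm)
    refine ⟨q, ⟨fun v hv => ?_, fun v hv w hw h => ?_, fun X hX => ?_, fun X hX => ?_⟩⟩
    · rw [hc1]
      exact hc2 v (by omega)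
    · rw [hc1, hc1]
      rw [hM₂] at h
      exact hc4 v (by omega) w (by omega) (.inl ⟨hv, hw, .inl h⟩)
    · have := hcard X hX
      simp only [hc1]
      omega
    · have := hcard X hX
      have := hdummy X
      simp only [hc1]
      omega

end

end PeerAssessment

namespace PeerAssessment

open Finset

/-! ### Assignments and equitable colorings -/

section

variable {n k : ℕ} {S : Matrix (Fin n) (Fin n) ℝ} {M : Finset (Fin n × Fin n)}

theorem card_filter_range (n : ℕ) (P : ℕ → Prop) [DecidablePred P] :
    #{w ∈ range n | P w} = #{w : Fin n | P w} := by
  rw [card_filter, card_filter, Finset.sum_range]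

theorem IsAssignment.totalDegree_eq (hM : IsAssignment k M) (v : Fin n) :
    totalDegree (assignmentGraph M) v = 2 * k := by
  have h1 : {w | (assignmentGraph M).Adj v w}.ncard = k := by
    rw [← hM.agent_load v, ← Set.ncard_coe_finset]
    simp [assignmentGraph]
  have h2 : {w | (assignmentGraph M).Adj w v}.ncard = k := by
    rw [← hM.submission_load v, ← Set.ncard_coe_finset]
    simp [assignmentGraph]
  rw [totalDegree, h1, h2]
  ring

theorem IsAssignment.wp_colorProgram (hM : IsAssignment k M) {N : ℕ} {s : Store}
    (hn : s.nat 0 0 0 = n) (hk : s.nat 1 0 0 = k) (hn0 : 0 < n)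
    (h2 : ∀ i j : Fin n, s.nat 2 i j = 1 ↔ (i, j) ∈ M)
    (hN : (n + 2 * k + 1) * (n + 2 * k + 1) < N) :
    wp N colorProgram (fun s' => ∃ f : Fin n → Fin (2 * k + 1),
      IsEquitableColoring (assignmentGraph M) f ∧ ∀ i : Fin n, s'.nat 3 i 0 = f i) s := by
  refine (PeerAssessment.wp_colorProgram hn hk hn0 (fun v hv => ?_) (fun v hv => ?_) hN).mono
    fun s' hF ⟨q, hq⟩ => ?_
  · have := hM.no_self ⟨v, hv⟩
    rwa [← h2] at this
  · rw [filter_or]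
    refine (card_union_le _ _).trans ?_
    rw [card_filter_range, card_filter_range]
    have e1 := hM.agent_load ⟨v, hv⟩
    have e2 := hM.submission_load ⟨v, hv⟩
    simp only [← h2] at e1 e2
    omega
  · have hncard : ∀ x : Fin (2 * k + 1),
        {v : Fin n | (⟨s'.nat 3 v 0, hq.lt v v.2⟩ : Fin (2 * k + 1)) = x}.ncard =
          #{v ∈ range n | s'.nat 3 v 0 = x} := by
      intro x
      rw [card_filter_range, ← Set.ncard_coe_finset]
      simp [Fin.ext_iff]
    refine ⟨fun i => ⟨s'.nat 3 i 0, hq.lt i i.2⟩, ⟨fun v w h => ?_, fun x y => ?_⟩, fun i => rfl⟩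
    · have h' : s.nat 2 v w = 1 := (h2 v w).2 h
      rw [← hF.nat 2 rfl] at h'
      simpa [Fin.ext_iff] using hq.proper v v.2 w w.2 h'
    · rw [hncard, hncard]
      have := hq.le x x.2
      have := hq.ge y y.2
      omega

open Classical in
-- Existence is read off from the total correctness of the coloring program, run on a memory that
-- holds the matrix of `M`.
theorem IsAssignment.exists_isEquitableColoring (hM : IsAssignment k M) (hn0 : 0 < n) :
    ∃ f : Fin n → Fin (2 * k + 1), IsEquitableColoring (assignmentGraph M) f := by
  obtain ⟨_, _, _, _, f, hf, _⟩ := hM.wp_colorProgram (s := ⟨fun a i j => if a = 0 then n else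
    if a = 1 then k else if ∃ x y : Fin n, x = i ∧ y = j ∧ (x, y) ∈ M then 1 else 0,
    fun _ _ _ => 0⟩) (by simp) (by simp) hn0 (by simp [← Fin.ext_iff]) (Nat.lt_succ_self _)
  exact ⟨f, hf⟩

theorem IsMaxSimilarityAssignment.totalSimilarity_eq (hM : IsMaxSimilarityAssignment S k M) :
    totalSimilarity S M = opt S k := by
  have : IsGreatest {x | ∃ M, IsAssignment k M ∧ totalSimilarity S M = x} (totalSimilarity S M) := by
    refine ⟨⟨M, hM.1, rfl⟩, ?_⟩
    rintro x ⟨M', hM', rfl⟩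
    exact hM.2 M' hM'
  exact this.csSup_eq.symm

/-- All values are the minimum or the minimum plus one, and the average is at least the minimum and
strictly less than the minimum plus one. If the larger value occurs, the average exceeds the minimum
and its ceiling is the larger value. -/
theorem eq_floor_or_eq_ceil {c : ℕ} (g : Fin c → ℕ) (hg : ∀ x y, g x ≤ g y + 1) (t : Fin c) :
    g t = ⌊(↑(∑ x, g x) : ℝ) / c⌋₊ ∨ g t = ⌈(↑(∑ x, g x) : ℝ) / c⌉₊ := by
  have hc : 0 < c := t.pos
  have hc' : (0 : ℝ) < c := Nat.cast_pos.2 hc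
  obtain ⟨y, -, hy⟩ := exists_min_image univ g ⟨t, mem_univ t⟩
  have hle : g y * c ≤ ∑ x, g x := by
    calc g y * c = ∑ _x : Fin c, g y := by simp [mul_comm]
      _ ≤ _ := sum_le_sum fun x _ => hy x (mem_univ x)
  have hlt : ∑ x, g x < (g y + 1) * c := by
    calc ∑ x, g x < ∑ _x : Fin c, (g y + 1) :=
          sum_lt_sum (fun x _ => hg x y) ⟨y, mem_univ y, Nat.lt_succ_self _⟩
      _ = _ := by simp [mul_comm]
  by_cases hty : g t = g y
  · left
    rw [Nat.floor_div_eq_div, hty]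
    exact (Nat.div_eq_of_lt_le hle hlt).symm
  · right
    have hty' : g t = g y + 1 := by
      have := hy t (mem_univ t)
      have := hg t y
      omega
    have hlt' : g y * c < ∑ x, g x := by
      calc g y * c = ∑ _x : Fin c, g y := by simp [mul_comm]
        _ < _ := sum_lt_sum (fun x _ => hy x (mem_univ x)) ⟨t, mem_univ t, by omega⟩
    rw [hty']
    refine ((Nat.ceil_eq_iff (Nat.succ_ne_zero _)).2 ⟨?_, ?_⟩).symm
    · rw [lt_div_iff₀ hc']
      exact_mod_cast hlt'
    · rw [div_le_iff₀ hc']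
      exact_mod_cast hlt.le

theorem isAgentPartition_colorClasses {m : ℕ} (f : Fin n → Fin m) :
    IsAgentPartition (colorClasses f) := by
  refine ⟨fun t u htu => ?_, fun i => ⟨f i, by simp [colorClasses]⟩⟩
  rw [disjoint_left]
  intro i hi hi'
  simp only [colorClasses, mem_filter] at hi hi'
  exact htu (hi.2.symm.trans hi'.2)

theorem sum_card_colorClasses {m : ℕ} (f : Fin n → Fin m) : ∑ t, #(colorClasses f t) = n := by
  have := card_eq_sum_card_fiberwise (f := f) (s := univ) (t := univ) fun _ _ => by simp
  rw [card_univ, Fintype.card_fin] at this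
  exact this.symm

theorem IsEquitableColoring.card_le {m : ℕ} {G : Digraph (Fin n)} {f : Fin n → Fin m}
    (hf : IsEquitableColoring G f) (t u : Fin m) :
    #(colorClasses f t) ≤ #(colorClasses f u) + 1 := by
  have h : ∀ x, {v | f v = x}.ncard = #(colorClasses f x) := by
    intro x
    rw [← Set.ncard_coe_finset]
    simp [colorClasses]
  have := hf.2 t u
  rw [h, h] at this
  omega

theorem IsEquitableColoring.respects {m : ℕ} {f : Fin n → Fin m}
    (hf : IsEquitableColoring (assignmentGraph M) f) : Respects M (colorClasses f) := by
  intro t i hi j hj hij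
  simp only [colorClasses, mem_filter] at hi hj
  exact hf.1 i j hij (hi.2.trans hj.2.symm)

/-- The multi-partition algorithm. -/
def multiPartitionProgram : Program := matchProgram ;; colorProgram

theorem initialStore_inputStore (k : ℕ) (S : Matrix (Fin n) (Fin n) ℝ) :
    InitialStore n k (inputStore k S) := by
  refine ⟨?_, ?_, fun a h0 h1 i j => ?_, fun a h0 i j => ?_⟩
  · simp [inputStore]
  · simp [inputStore]
  · simp [inputStore, h0, h1]
  · simp [inputStore, h0]

theorem wp_multiPartitionProgram {N : ℕ} (S : Matrix (Fin n) (Fin n) ℝ) (hkn : k < n)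
    (hN : (n * k + 1) * (2 * n + 2) ≤ N) (hN' : (n + 2 * k + 1) * (n + 2 * k + 1) < N) :
    wp N multiPartitionProgram (fun s => ∃ M, ∃ parts : Fin (2 * k + 1) → Finset (Fin n),
      s.HasOutput M parts ∧ IsMultiPartitionOutput S k M parts) (inputStore k S) := by
  refine wp_seq ((wp_matchProgram hN hkn (initialStore_inputStore k S)).mono
    fun s₁ hF₁ ⟨hL, hrow⟩ => ?_)
  have hmax : IsMaxSimilarityAssignment S k (ones n (s₁.nat 2)) := by
    refine hL.matrix.isMaxSimilarityAssignment (fun i j => ?_) hrow hL.col_le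
    rw [hF₁.real 0 rfl]
    simp [inputStore]
  refine (hmax.1.wp_colorProgram hL.size hL.load (by omega) (fun i j => mem_ones.symm) hN').mono
    fun s₂ hF₂ ⟨f, hf, h3⟩ => ⟨_, colorClasses f, ⟨fun i j => ?_, fun i => ?_, fun t i => ?_⟩,
      hmax, f, hf, rfl⟩
  · rw [hF₂.nat 2 rfl]
    simp only [mem_ones]
    rcases hL.matrix.zero_or_one i i.2 j j.2 with h | h <;> simp [h]
  · rw [h3]
    exact (f i).2
  · rw [h3]
    simp [colorClasses, Fin.ext_iff]

end

end PeerAssessment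

theorem mainTheorem5 :
    -- one program and one polynomial serve all inputs
    ∃ (prog : Program) (p : Polynomial ℕ),
      ∀ (n k : ℕ) (S : Matrix (Fin n) (Fin n) ℝ),
        1 ≤ k → k < n → (∀ i j, S i j ∈ Set.Icc (0 : ℝ) 1) →
        -- whichever optimal assignment is taken, the coloring step can be carried out
        (∀ M : Finset (Fin n × Fin n), IsMaxSimilarityAssignment S k M →
          (∀ v, totalDegree (assignmentGraph M) v ≤ 2 * k) ∧
          ∃ f : Fin n → Fin (2 * k + 1), IsEquitableColoring (assignmentGraph M) f) ∧
        -- every possible result of the algorithm is as claimed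
        (∀ (M : Finset (Fin n × Fin n)) (parts : Fin (2 * k + 1) → Finset (Fin n)),
          IsMultiPartitionOutput S k M parts →
            IsAgentPartition parts ∧
            (∀ t, (parts t).card = ⌊(n : ℝ) / (2 * k + 1)⌋₊ ∨
              (parts t).card = ⌈(n : ℝ) / (2 * k + 1)⌉₊) ∧
            (∀ t u, (parts t).card ≤ (parts u).card + 1) ∧
            IsAssignment k M ∧
            Respects M parts ∧
            IsStrategyproofViaPartitioning (2 * k + 1) M ∧
            totalSimilarity S M = opt S k) ∧
        -- the algorithm is carried out in polynomial time
        ∃ (s : Store) (t : ℕ) (M : Finset (Fin n × Fin n))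
          (parts : Fin (2 * k + 1) → Finset (Fin n)),
          Runs prog (inputStore k S) t s ∧ t ≤ p.eval n ∧
            s.HasOutput M parts ∧ IsMultiPartitionOutput S k M parts := by
  obtain ⟨p, hp⟩ := multiPartitionProgram.exists_polynomial_time
  -- The inner polynomial bounds the iterations of every loop: the first product serves the
  -- assignment and the second the coloring, with `k` replaced by `n` by means of `k < n`.
  refine ⟨multiPartitionProgram, p.comp ((.X * .X + 1) * (2 * .X + 2) + (3 * .X + 1) * (3 * .X + 1)),
    fun n k S hk hkn hS => ⟨fun M hM => ⟨fun v => (hM.1.totalDegree_eq v).le,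
      hM.1.exists_isEquitableColoring (by omega)⟩, ?_, ?_⟩⟩
  · rintro M _ ⟨hM, f, hf, rfl⟩
    have hpart := isAgentPartition_colorClasses f
    refine ⟨hpart, fun t => ?_, hf.card_le, hM.1, hf.respects, ⟨_, hpart, hf.respects⟩,
      hM.totalSimilarity_eq⟩
    have := eq_floor_or_eq_ceil (fun t => (colorClasses f t).card) hf.card_le t
    rw [sum_card_colorClasses] at this
    exact_mod_cast this
  · have hN : (n + 2 * k + 1) * (n + 2 * k + 1) < (3 * n + 1) * (3 * n + 1) :=
      Nat.mul_lt_mul_of_lt_of_le (by omega) (by omega) (by omega)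
    obtain ⟨t, s, hr, ht, M, parts, hout, hM⟩ := wp_multiPartitionProgram
      (N := (n * n + 1) * (2 * n + 2) + (3 * n + 1) * (3 * n + 1)) S hkn
      (Nat.le_add_right_of_le (by gcongr)) (by omega)
    refine ⟨s, t, M, parts, hr, ht.trans_eq ?_, hout, hM⟩
    rw [hp, Polynomial.eval_comp]
    simp
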